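/- **Setting.** Let $n\ge 1$, $\mu\ge 1$, $M\ge 0$ be integers and $a(0),a(1),\dots$ complex numbers. Let $d_\mu(k)$ be given by $\sum_{k\ge0} d_\mu(k)x^k=\big(\sum_{j\ge0}x^{\mu j}\big)^n$, and suppose that the series $b_\mu(k)=(D^\mu a)_k=\sum_{m\ge k}a(m)d_\mu(m-k)$, $k\ge 0$, converge absolutely, with $\sum_k|b_\mu(k)|<\infty$ and $\sum_k(k+1)|b_\mu(k)|^2<\infty$. Let $\xi(m)$, $m\in\mathbb Z$, be a second order stochastic sequence whose increments $\xi^{(n)}(m,s)=\sum_{l=0}^n(-1)^l\binom nl\xi(m-ls)$ have mean $0$ and are stationary with spectral density $f\ge 0$: $$E\,\xi^{(n)}(m_0+m,s_1)\overline{\xi^{(n)}(m_0,s_2)}=\frac1{2\pi}\int_{-\pi}^{\pi}e^{i\lambda m}(1-e^{-is_1\lambda})^n(1-e^{is_2\lambda})^n\lambda^{-2n}f(\lambda)\,d\lambda .$$ The functional $A\xi=\sum_{k\ge0}a(k)\xi(k)$ is understood as $A\xi=B\xi-V\xi$, where $B\xi=\sum_{k\ge0}b_\mu(k)\xi^{(n)}(k,\mu)$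 and $V\xi=\sum_{k=-\mu n}^{-1}v_\mu(k)\xi(k)$ with $v_\mu(k)=\sum_{0\le l\le n,\ l\mu\ge -k}(-1)^l\binom nl b_\mu(l\mu+k)$. Linear estimates of $A\xi$ from $\xi(m)$, $m\le -1$, are the variables $-V\xi+\eta$ with $\eta$ in the closed linear span of $\xi^{(n)}(k,\mu)$, $k\le-1$; the estimate with the smallest mean square error is the optimal one. A density $f^0$ in a class $D$ is *least favorable in $D$* if the error of the optimal estimate of $A\xi$ under $f^0$ is the maximum of these errors over $f\in D$. Let $(\rho_0,\dots,\rho_M)$ be a strictly positive sequence (the Toeplitz matrix $(\rho_{|j-k|})_{j,k=0}^M$ is positive definite), $P_0=\rho_0$, and let $D_M$ be the set of nonnegative integrable $f$ on $[-\pi,\pi]$ with $\frac1{2\pi}\int_{-\pi}^{\pi}f(\lambda)\cos(m\lambda)\,d\lambda=\rho_m$, $m=0,\dots,M$. Let $$w_\mu(z)=\exp\Big\{\frac1{4\pi}\int_{-\pi}^{\pi}\frac{e^{i\lambda}+z}{e^{i\lambda}-z}\,\ln\frac{|1-e^{-i\lambda\mu}|^{2n}}{\lambda^{2n}}\,d\lambda\Big\}=\sum_{k\ge0}w_\mu(k)z^k\qquad(|z|<1),$$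 $(W^\mu\varphi)_j=\sum_{k\le j}w_\mu(j-k)\varphi(k)$ and $(D^\mu A\psi)_k=\sum_{m\ge0}\sum_{l\ge k}\psi(m)a(m+l)d_\mu(l-k)$. Write $f_\varphi(\lambda)=\big|\sum_{k\ge0}\varphi(k)e^{-i\lambda k}\big|^2$ for $\varphi\in\ell_2$. Call $\varphi$ *admissible* if $\|\varphi\|^2=P_0$, $f_\varphi\in D_M$, and $\varphi$ gives a canonical factorization of $f_\varphi$, that is, $\Phi(z)=\sum_k\varphi(k)z^k$ has radius of convergence greater than $1$ and no zeros in $|z|\le1$. Consider the eigen-equation $$D^\mu AW^\mu\varphi=\alpha\overline{\varphi},\qquad \alpha\in\mathbb C,\tag{45}$$ and the form of the density $$f^0(\lambda)=\frac{\big|c\sum_{k\ge0}(D^\mu A\varphi_\mu)_k e^{i\lambda k}\big|^2}{\big|\sum_{m=0}^{M}c_m e^{-i\lambda m}\big|^2},\qquad \varphi_\mu=W^\mu\varphi,\quad c\in\mathbb C,\ c_0,\dots,c_M\in\mathbb R,\tag{52}$$ (equality for almost every $\lambda$, the series in the numerator converging in mean square). Let $\nu_MP_0$ be the maximum (supremum)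 of $\|D^\mu AW^\mu\varphi\|^2$ over the admissible solutions $\varphi$ of (45), and $\nu_M^+P_0$ its maximum (supremum) over the admissible $\varphi$ for which $f_\varphi$ is of the form (52) for some $c,c_0,\dots,c_M$; over the empty set the value is $0$. **Theorem 6.1.** (1) If $\varphi^0$ is an admissible solution of (45) with $\nu_MP_0=\nu_M^+P_0=\|D^\mu AW^\mu\varphi^0\|^2$, then the density $f_{\varphi^0}(\lambda)=\big|\sum_{k\ge0}\varphi^0(k)e^{-i\lambda k}\big|^2$ is least favorable in $D_M$ for the optimal linear estimation of $A\xi$. (2) If $\nu_M<\nu_M^+$, then there are admissible $\varphi$ for which $f_\varphi$ is of the form (52); and for every admissible $\varphi$ and every $c,c_0,\dots,c_M$ such that the density $f^0$ in (52) has the canonical factorization $f^0=f_\varphi$, the density $f^0$ is least favorable in $D_M$, and $\varphi$ is a solution of the extremum problem $$\|D^\mu A\psi_\mu\|^2\to\max,\qquad \psi_\mu=W^\mu\psi,\quad \psi\in\ell_2,\ f_\psi\in D_M .$$ -/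

import Mathlib

open Real MeasureTheory Filter Topology
open scoped ENNReal

noncomputable section

namespace Extrapolation

/-! ### Sequences with stationary increments -/

/-- The increment of order `n` with step `s`: `∑_{l=0}^n (-1)^l C(n,l) ξ(m - l s)`. -/
def increment {E : Type*} [AddCommGroup E] [Module ℂ E] (n : ℕ) (s : ℤ) (ξ : ℤ → E) (m : ℤ) : E :=
  ∑ l ∈ Finset.range (n + 1), ((-1 : ℂ) ^ l * (n.choose l : ℂ)) • ξ (m - l * s)

/-- A second order stochastic sequence `ξ` on the probability space `(Ω, P)` whose increments of
order `n` have mean zero and are wide sense stationary with spectral density `f`: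
`E ξ⁽ⁿ⁾(m₀+m, s₁) conj (ξ⁽ⁿ⁾(m₀, s₂))` is equal to
`(1/2π) ∫_{-π}^{π} e^{i t m} (1 - e^{-i s₁ t})ⁿ (1 - e^{i s₂ t})ⁿ t^{-2n} f(t) dt`.
(In Mathlib the inner product `inner ℂ Y X` of `L²(P)` is `E X conj(Y)`.) -/
structure HasSpectralDensity {Ω : Type} [MeasurableSpace Ω] (P : Measure Ω) (n : ℕ) (f : ℝ → ℝ)
    (ξ : ℤ → Lp ℂ 2 P) : Prop where
  mean_zero : ∀ m s : ℤ, ∫ ω, (increment n s ξ m : Lp ℂ 2 P) ω ∂P = 0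
  structural : ∀ m₀ m s₁ s₂ : ℤ,
    inner ℂ (increment n s₂ ξ m₀) (increment n s₁ ξ (m₀ + m)) =
      1 / (2 * π) * ∫ t in (-π)..π,
        Complex.exp (Complex.I * t * m) * (1 - Complex.exp (-(Complex.I * s₁ * t))) ^ n *
          (1 - Complex.exp (Complex.I * s₂ * t)) ^ n / (t : ℂ) ^ (2 * n) * (f t : ℂ)

/-! ### The functional and the error of its optimal linear estimate -/

/-- The coefficients `d_μ(k)`, given by `∑ d_μ(k) x^k = (∑_j x^{μ j})^n`. -/
def dCoeff (n μ : ℕ) (k : ℕ) : ℂ :=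
  PowerSeries.coeff k ((PowerSeries.mk fun j => if μ ∣ j then (1 : ℂ) else 0) ^ n)

/-- `b_μ(k) = (D^μ a)_k = ∑_{m ≥ k} a(m) d_μ(m - k)`. -/
def bCoeff (n μ : ℕ) (a : ℕ → ℂ) (k : ℕ) : ℂ :=
  ∑' i : ℕ, a (k + i) * dCoeff n μ i

/-- `v_μ(-(j+1))`, the sum of `(-1)^l C(n,l) b_μ(l μ - (j+1))` over `l ≤ n` with `l μ ≥ j + 1`. -/
def vCoeff (n μ : ℕ) (a : ℕ → ℂ) (j : ℕ) : ℂ :=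
  ∑ l ∈ (Finset.range (n + 1)).filter (fun l => j + 1 ≤ l * μ),
    (-1 : ℂ) ^ l * (n.choose l : ℂ) * bCoeff n μ a (l * μ - (j + 1))

section Functional

variable {Ω : Type} [MeasurableSpace Ω] {P : Measure Ω}

/-- `Bξ = ∑_{k ≥ 0} b_μ(k) ξ⁽ⁿ⁾(k, μ)`, a series in `L²(P)`. -/
def functionalB (n μ : ℕ) (a : ℕ → ℂ) (ξ : ℤ → Lp ℂ 2 P) : Lp ℂ 2 P :=
  ∑' k : ℕ, bCoeff n μ a k • increment n (μ : ℤ) ξ (k : ℤ)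

/-- `Vξ = ∑_{k=-μn}^{-1} v_μ(k) ξ(k)`, a combination of observed values. -/
def functionalV (n μ : ℕ) (a : ℕ → ℂ) (ξ : ℤ → Lp ℂ 2 P) : Lp ℂ 2 P :=
  ∑ j ∈ Finset.range (μ * n), vCoeff n μ a j • ξ (-((j : ℤ) + 1))

/-- The functional `Aξ = ∑_{k ≥ 0} a(k) ξ(k)`, given a meaning by `Aξ = Bξ - Vξ`
(for finitely supported `a` this is the finite sum, see `functionalA_eq_sum`). -/
def functionalA (n μ : ℕ) (a : ℕ → ℂ) (ξ : ℤ → Lp ℂ 2 P) : Lp ℂ 2 P :=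
  functionalB n μ a ξ - functionalV n μ a ξ

/-- The linear estimates of `Aξ` from the observations `ξ(m)`, `m ≤ -1`: the variables
`-Vξ + η` with `η` in the closed linear span of the observed increments `ξ⁽ⁿ⁾(k, μ)`, `k ≤ -1`. -/
def linearEstimates (n μ : ℕ) (a : ℕ → ℂ) (ξ : ℤ → Lp ℂ 2 P) : Set (Lp ℂ 2 P) :=
  {X | ∃ η ∈ (Submodule.span ℂ
      {Y : Lp ℂ 2 P | ∃ k : ℤ, k ≤ -1 ∧ Y = increment n (μ : ℤ) ξ k}).topologicalClosure,
    X = -functionalV n μ a ξ + η}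

/-- The mean square error of the optimal linear estimate of `Aξ`. -/
def optimalError (n μ : ℕ) (a : ℕ → ℂ) (ξ : ℤ → Lp ℂ 2 P) : ℝ :=
  Metric.infDist (functionalA n μ a ξ) (linearEstimates n μ a ξ) ^ 2

end Functional

/-- `f₀ ∈ D` is least favorable in `D` for the optimal linear estimation of `Aξ`: the error of the
optimal estimate for a sequence with spectral density `f₀` is the largest one over `D`. (It depends
on the sequence only through the spectral density; the quantifiers make this part of the claim.) -/
def IsLeastFavorable (n μ : ℕ) (a : ℕ → ℂ) (D : Set (ℝ → ℝ)) (f₀ : ℝ → ℝ) : Prop :=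
  f₀ ∈ D ∧
  (∃ (Ω : Type) (_ : MeasurableSpace Ω) (P : Measure Ω) (_ : IsProbabilityMeasure P)
    (ξ : ℤ → Lp ℂ 2 P), HasSpectralDensity P n f₀ ξ) ∧
  ∀ (Ω₀ : Type) [MeasurableSpace Ω₀] (P₀ : Measure Ω₀) [IsProbabilityMeasure P₀]
    (ξ₀ : ℤ → Lp ℂ 2 P₀), HasSpectralDensity P₀ n f₀ ξ₀ →
  ∀ f ∈ D, ∀ (Ω : Type) [MeasurableSpace Ω] (P : Measure Ω) [IsProbabilityMeasure P]
    (ξ : ℤ → Lp ℂ 2 P), HasSpectralDensity P n f ξ →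
  optimalError n μ a ξ ≤ optimalError n μ a ξ₀

/-- The class `D_M` of spectral densities with `(1/2π) ∫ f(t) cos(mt) dt = ρ_m`, `m = 0, …, M`. -/
def momentClass (M : ℕ) (ρ : ℕ → ℝ) : Set (ℝ → ℝ) :=
  {f | IntervalIntegrable f volume (-π) π ∧
    (∀ᵐ t ∂volume.restrict (Set.Ioc (-π) π), 0 ≤ f t) ∧
    ∀ m ≤ M, 1 / (2 * π) * ∫ t in (-π)..π, f t * Real.cos (m * t) = ρ m}

/-! ### Factorization and the operators `W^μ`, `D^μ A` -/

/-- `Φ(z) = ∑ φ(k) z^k` has radius of convergence greater than one and no zero in `|z| ≤ 1`. -/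
def IsCanonical (φ : ℕ → ℂ) : Prop :=
  (∃ r : ℝ, 1 < r ∧ Summable fun k => ‖φ k‖ * r ^ k) ∧
  ∀ z : ℂ, ‖z‖ ≤ 1 → ∑' k, φ k * z ^ k ≠ 0

/-- The density `|∑ φ(k) e^{-itk}|²`. -/
def factorDensity (φ : ℕ → ℂ) (t : ℝ) : ℝ :=
  ‖∑' k : ℕ, φ k * Complex.exp (-(Complex.I * t * k))‖ ^ 2

/-- `w_μ(z) = exp ((1/4π) ∫ (e^{it}+z)/(e^{it}-z) log (|1-e^{-itμ}|^{2n} / t^{2n}) dt)`. -/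
def wFun (n μ : ℕ) (z : ℂ) : ℂ :=
  Complex.exp (1 / (4 * π) * ∫ t in (-π)..π,
    (Complex.exp (Complex.I * t) + z) / (Complex.exp (Complex.I * t) - z) *
      (Real.log (‖1 - Complex.exp (-(Complex.I * t * μ))‖ ^ (2 * n) / t ^ (2 * n)) : ℂ))

/-- The Taylor coefficients of `w_μ` at `0`. -/
def wCoeff (n μ : ℕ) (k : ℕ) : ℂ :=
  iteratedDeriv k (wFun n μ) 0 / (k.factorial : ℂ)

/-- `(W^μ φ)_j = ∑_{k ≤ j} w_μ(j-k) φ(k)`. -/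
def opW (n μ : ℕ) (φ : ℕ → ℂ) (j : ℕ) : ℂ :=
  ∑ k ∈ Finset.range (j + 1), wCoeff n μ (j - k) * φ k

/-- `(D^μ A ψ)_k = ∑_{m ≥ 0} ∑_{l ≥ k} ψ(m) a(m+l) d_μ(l-k)`, with `l = k + i`. -/
def opDA (n μ : ℕ) (a : ℕ → ℂ) (ψ : ℕ → ℂ) (k : ℕ) : ℂ :=
  ∑' m : ℕ, ψ m * ∑' i : ℕ, a (m + (k + i)) * dCoeff n μ i

/-- `D^μ A W^μ φ`. -/
def opDAW (n μ : ℕ) (a : ℕ → ℂ) (φ : ℕ → ℂ) : ℕ → ℂ :=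
  opDA n μ a (opW n μ φ)

/-- The squared `ℓ²` norm, with values in `[0, ∞]`. -/
def normSq (c : ℕ → ℂ) : ℝ≥0∞ := ∑' k, ‖c k‖ₑ ^ 2

/-- `G(t) = ∑_{k ≥ 0} c(k) e^{iσtk}` as a mean square convergent series on `(-π, π)`. -/
def IsMeanSquareSum (σ : ℤ) (c : ℕ → ℂ) (G : ℝ → ℂ) : Prop :=
  MemLp G 2 (volume.restrict (Set.Ioc (-π) π)) ∧
  Tendsto (fun N : ℕ => ∫ t in (-π)..π,
    ‖G t - ∑ k ∈ Finset.range N, c k * Complex.exp (Complex.I * σ * t * k)‖ ^ 2) atTop (𝓝 0)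

/-! ### The two families of candidates -/

/-- Those `φ` with `‖φ‖² = P₀ = ρ₀` which determine the canonical factorization of a density
`|∑ φ(k) e^{-itk}|²` in `D_M`. -/
def admissible (M : ℕ) (ρ : ℕ → ℝ) : Set (ℕ → ℂ) :=
  {φ | normSq φ = ENNReal.ofReal (ρ 0) ∧ IsCanonical φ ∧ factorDensity φ ∈ momentClass M ρ}

/-- The admissible solutions of `D^μ A W^μ φ = α conj(φ)`, `α ∈ ℂ`. -/
def eigenSolutions (n μ M : ℕ) (a : ℕ → ℂ) (ρ : ℕ → ℝ) : Set (ℕ → ℂ) :=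
  {φ | φ ∈ admissible M ρ ∧ ∃ α : ℂ, ∀ k, opDAW n μ a φ k = α * starRingEnd ℂ (φ k)}

/-- The density `f` is of the form
`|c ∑_k (D^μ A φ_μ)_k e^{itk}|² / |∑_{m=0}^M p_m e^{-itm}|²`, `φ_μ = W^μ φ`. -/
def IsRationalForm (n μ M : ℕ) (a : ℕ → ℂ) (φ : ℕ → ℂ) (c : ℂ) (p : ℕ → ℝ) (f : ℝ → ℝ) : Prop :=
  ∃ R : ℝ → ℂ, IsMeanSquareSum 1 (opDA n μ a (opW n μ φ)) R ∧
    ∀ᵐ t ∂volume.restrict (Set.Ioc (-π) π),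
      f t = ‖c * R t‖ ^ 2 /
        ‖∑ m ∈ Finset.range (M + 1), (p m : ℂ) * Complex.exp (-(Complex.I * t * m))‖ ^ 2

/-- The admissible `φ` for which the density is of the rational form for some parameters. -/
def rationalSolutions (n μ M : ℕ) (a : ℕ → ℂ) (ρ : ℕ → ℝ) : Set (ℕ → ℂ) :=
  {φ | φ ∈ admissible M ρ ∧
    ∃ (c : ℂ) (p : ℕ → ℝ), IsRationalForm n μ M a φ c p (factorDensity φ)}

/-- `ν_M P₀`: the maximum of `‖D^μ A W^μ φ‖²` over the eigen-equation solutions. -/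
def nuEigen (n μ M : ℕ) (a : ℕ → ℂ) (ρ : ℕ → ℝ) : ℝ≥0∞ :=
  ⨆ φ ∈ eigenSolutions n μ M a ρ, normSq (opDAW n μ a φ)

/-- `ν_M⁺ P₀`: the maximum of `‖D^μ A W^μ φ‖²` over the rational solutions. -/
def nuRational (n μ M : ℕ) (a : ℕ → ℂ) (ρ : ℕ → ℝ) : ℝ≥0∞ :=
  ⨆ φ ∈ rationalSolutions n μ M a ρ, normSq (opDAW n μ a φ)

/-- `φ` solves the extremum problem `‖D^μ A ψ_μ‖² → max`, `ψ_μ = W^μ ψ`, over all `ψ ∈ ℓ²` with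
`|∑ ψ(k) e^{-itk}|² ∈ D`. -/
def SolvesExtremumProblem (n μ : ℕ) (a : ℕ → ℂ) (D : Set (ℝ → ℝ)) (φ : ℕ → ℂ) : Prop :=
  normSq φ < ∞ ∧ (∃ G, IsMeanSquareSum (-1) φ G ∧ (fun t => ‖G t‖ ^ 2) ∈ D) ∧
  ∀ ψ : ℕ → ℂ, normSq ψ < ∞ →
    ∀ G, IsMeanSquareSum (-1) ψ G → (fun t => ‖G t‖ ^ 2) ∈ D →
      normSq (opDAW n μ a ψ) ≤ normSq (opDAW n μ a φ)

/-! ### Every nonnegative integrable function is a spectral density -/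

theorem sum_alternating_pow (n : ℕ) (s m : ℂ) (j : ℕ) (hj : j < n) :
    ∑ l ∈ Finset.range (n + 1), ((-1 : ℂ) ^ l * (n.choose l : ℂ)) * (m - l * s) ^ j = 0 := by
  have h := fwdDiff_iter_sum_mul_pow_eq_zero (R := ℂ) (n := n) (fun _ => 0)
  have h2 := congrFun (Polynomial.fwdDiff_iter_eq_zero_of_degree_lt (R := ℂ)
    (P := (Polynomial.C m - Polynomial.X * Polynomial.C s) ^ j) (n := n) (by
      refine lt_of_le_of_lt Polynomial.natDegree_pow_le ?_
      refine lt_of_le_of_lt (Nat.mul_le_mul_left j (?_ : _ ≤ 1)) (by simpa using hj)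
      compute_degree)) 0
  rw [fwdDiff_iter_eq_sum_shift] at h2
  have h3 : ((-1 : ℂ) ^ n) * ∑ l ∈ Finset.range (n + 1),
      ((-1 : ℂ) ^ l * (n.choose l : ℂ)) * (m - l * s) ^ j = 0 := by
    simp only [Pi.zero_apply] at h2
    rw [← h2, Finset.mul_sum]
    refine Finset.sum_congr rfl fun l hl => ?_
    have hl' : l ≤ n := by simpa [Nat.lt_succ_iff] using hl
    have : (-1 : ℂ) ^ (n - l) = (-1) ^ n * (-1) ^ l := by
      obtain ⟨d, rfl⟩ := Nat.exists_eq_add_of_le hl'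
      rw [Nat.add_sub_cancel_left, pow_add, mul_right_comm, ← pow_add, Even.neg_one_pow ⟨l, rfl⟩,
        one_mul]
    simp [this]
    ring
  exact (mul_eq_zero.1 h3).resolve_left (pow_ne_zero _ (by norm_num))

/-- The kernel `(e^{itm} - ∑_{j<n} (itm)^j/j!) / (it)^n`. -/
def incrKernel (n : ℕ) (m : ℤ) (t : ℝ) : ℂ :=
  (Complex.exp (Complex.I * t * m) -
    ∑ j ∈ Finset.range n, (Complex.I * t * m) ^ j / (j.factorial : ℂ)) / (Complex.I * t) ^ n

theorem sum_incrKernel (n : ℕ) (s m : ℤ) (t : ℝ) :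
    ∑ l ∈ Finset.range (n + 1), ((-1 : ℂ) ^ l * (n.choose l : ℂ)) * incrKernel n (m - l * s) t =
      Complex.exp (Complex.I * t * m) * (1 - Complex.exp (-(Complex.I * s * t))) ^ n /
        (Complex.I * t) ^ n := by
  simp only [incrKernel, mul_div_assoc']
  rw [← Finset.sum_div]
  congr 1
  simp only [mul_sub, Finset.sum_sub_distrib]
  have h1 : ∑ l ∈ Finset.range (n + 1), ((-1 : ℂ) ^ l * (n.choose l : ℂ)) *
      ∑ j ∈ Finset.range n, (Complex.I * t * ((m - l * s : ℤ) : ℂ)) ^ j / (j.factorial : ℂ) = 0 := by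
    simp only [Finset.mul_sum]
    rw [Finset.sum_comm]
    refine Finset.sum_eq_zero fun j hj => ?_
    have := sum_alternating_pow n s m j (Finset.mem_range.1 hj)
    have h : ∑ l ∈ Finset.range (n + 1), ((-1 : ℂ) ^ l * (n.choose l : ℂ)) *
        ((Complex.I * t * ((m - l * s : ℤ) : ℂ)) ^ j / (j.factorial : ℂ)) =
        (Complex.I * t) ^ j / (j.factorial : ℂ) *
        ∑ l ∈ Finset.range (n + 1), ((-1 : ℂ) ^ l * (n.choose l : ℂ)) * ((m : ℂ) - l * s) ^ j := by
      rw [Finset.mul_sum]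
      refine Finset.sum_congr rfl fun l _ => ?_
      push_cast
      rw [mul_pow]
      ring
    rw [h, this, mul_zero]
  rw [h1, sub_zero, sub_eq_neg_add, add_pow, Finset.mul_sum]
  refine Finset.sum_congr rfl fun l _ => ?_
  have : Complex.exp (Complex.I * t * ((m - l * s : ℤ) : ℂ)) =
      Complex.exp (Complex.I * t * m) * Complex.exp (-(Complex.I * s * t)) ^ l := by
    rw [← Complex.exp_nat_mul, ← Complex.exp_add]
    congr 1
    push_cast
    ring
  rw [this, neg_pow (Complex.exp _)]
  simp
  ring

theorem measurable_incrKernel (n : ℕ) (m : ℤ) : Measurable (incrKernel n m) := by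
  unfold incrKernel
  fun_prop

theorem norm_incrKernel_le (n : ℕ) (m : ℤ) (t : ℝ) (ht : |t| ≤ π) :
    ‖incrKernel n m t‖ ≤ |(m : ℝ)| ^ n * Real.exp (π * |(m : ℝ)|) := by
  have h := Complex.norm_exp_sub_sum_le_norm_mul_exp (Complex.I * t * m) n
  have hn : ‖Complex.I * t * m‖ = |t| * |(m : ℝ)| := by simp
  rw [hn] at h
  have hE : 0 ≤ |(m : ℝ)| ^ n * Real.exp (π * |(m : ℝ)|) := by positivity
  unfold incrKernel
  rw [norm_div]
  refine div_le_of_le_mul₀ (by positivity) hE (h.trans ?_)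
  have : ‖(Complex.I * t) ^ n‖ = |t| ^ n := by simp
  rw [this, mul_pow]
  have : Real.exp (|t| * |(m : ℝ)|) ≤ Real.exp (π * |(m : ℝ)|) := by gcongr
  calc |t| ^ n * |(m : ℝ)| ^ n * Real.exp (|t| * |(m : ℝ)|)
      ≤ |t| ^ n * |(m : ℝ)| ^ n * Real.exp (π * |(m : ℝ)|) := by gcongr
    _ = _ := by ring

theorem coeFn_sum_smul {Ω ι : Type} [MeasurableSpace Ω] {P : Measure Ω} (S : Finset ι) (c : ι → ℂ)
    (x : ι → Lp ℂ 2 P) :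
    ((∑ i ∈ S, c i • x i : Lp ℂ 2 P) : Ω → ℂ) =ᵐ[P] fun ω => ∑ i ∈ S, c i * x i ω := by
  classical
  induction S using Finset.induction_on with
  | empty =>
    simp only [Finset.sum_empty]
    exact Lp.coeFn_zero ℂ 2 P
  | insert i S hi ih =>
    rw [Finset.sum_insert hi]
    filter_upwards [ih, Lp.coeFn_add (c i • x i) (∑ i ∈ S, c i • x i),
      Lp.coeFn_smul (c i) (x i)] with ω h1 h2 h3
    rw [h2, Finset.sum_insert hi, Pi.add_apply, h1, h3]
    simp

/-- The uniform distribution on `(-π, π]`. -/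
def unifMeasure : Measure ℝ := ENNReal.ofReal (1 / (2 * π)) • volume.restrict (Set.Ioc (-π) π)

/-- The distribution of a fair sign. -/
def coinMeasure : Measure Bool := (2⁻¹ : ℝ≥0∞) • Measure.count

instance : IsProbabilityMeasure unifMeasure := ⟨by
  simp only [unifMeasure, Measure.smul_apply, Measure.restrict_apply_univ, Real.volume_Ioc, smul_eq_mul]
  rw [← ENNReal.ofReal_mul (by positivity), ← ENNReal.ofReal_one]
  congr 1
  field_simp
  ring⟩

instance : IsProbabilityMeasure coinMeasure := ⟨by
  simp only [coinMeasure, Measure.smul_apply, smul_eq_mul, Measure.count_univ, ENat.card_eq_coe_fintype_card,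
    Fintype.card_bool]
  exact ENNReal.inv_mul_cancel (by norm_num) (by norm_num)⟩

theorem integral_unifMeasure (g : ℝ → ℂ) :
    ∫ t, g t ∂unifMeasure = 1 / (2 * π) * ∫ t in (-π)..π, g t := by
  rw [unifMeasure, integral_smul_measure, intervalIntegral.integral_of_le (by linarith [pi_pos]),
    ENNReal.toReal_ofReal (by positivity)]
  simp

/-- The sign `±1`. -/
def signFun (b : Bool) : ℂ := if b then 1 else -1

theorem integral_signFun : ∫ b, signFun b ∂coinMeasure = 0 := by
  rw [coinMeasure, integral_smul_measure, integral_fintype (by simp)]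
  simp [signFun]

/-- Every nonnegative integrable function is the spectral density of some second order sequence
with stationary increments. -/
theorem exists_hasSpectralDensity (n : ℕ) (f : ℝ → ℝ) (hf : IntervalIntegrable f volume (-π) π)
    (hf0 : ∀ᵐ t ∂volume.restrict (Set.Ioc (-π) π), 0 ≤ f t) :
    ∃ (Ω : Type) (_ : MeasurableSpace Ω) (P : Measure Ω) (_ : IsProbabilityMeasure P)
      (ξ : ℤ → Lp ℂ 2 P), HasSpectralDensity P n f ξ := by
  have hac : unifMeasure ≪ volume.restrict (Set.Ioc (-π) π) := Measure.smul_absolutelyContinuous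
  have hint : Integrable f unifMeasure := by
    rw [intervalIntegrable_iff_integrableOn_Ioc_of_le (by linarith [pi_pos])] at hf
    exact hf.smul_measure ENNReal.ofReal_ne_top
  have hpos : ∀ᵐ t ∂unifMeasure, 0 ≤ f t := hac.ae_le hf0
  have hbd : ∀ᵐ t ∂unifMeasure, |t| ≤ π := by
    refine hac.ae_le ?_
    filter_upwards [ae_restrict_mem measurableSet_Ioc] with t ht
    exact abs_le.2 ⟨ht.1.le, ht.2⟩
  have hsq : MemLp (fun t => ((√(f t) : ℝ) : ℂ)) 2 unifMeasure := by
    have hm : AEStronglyMeasurable (fun t => ((√(f t) : ℝ) : ℂ)) unifMeasure :=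
      (Complex.continuous_ofReal.comp Real.continuous_sqrt).comp_aestronglyMeasurable hint.1
    rw [memLp_two_iff_integrable_sq_norm hm]
    refine hint.congr ?_
    filter_upwards [hpos] with t ht
    simp [Real.sq_sqrt ht]
  have hker : ∀ m, MemLp (fun t => incrKernel n m t * ((√(f t) : ℝ) : ℂ)) 2 unifMeasure := by
    intro m
    refine MemLp.of_le_mul (c := |(m : ℝ)| ^ n * Real.exp (π * |(m : ℝ)|)) hsq
      ((measurable_incrKernel n m).aestronglyMeasurable.mul hsq.1) ?_
    filter_upwards [hbd] with t ht
    rw [norm_mul]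
    exact mul_le_mul_of_nonneg_right (norm_incrKernel_le n m t ht) (norm_nonneg _)
  have hprod : ∀ m, MemLp (fun ω : ℝ × Bool => signFun ω.2 * (incrKernel n m ω.1 * ((√(f ω.1) : ℝ) : ℂ))) 2
      (unifMeasure.prod coinMeasure) := by
    intro m
    refine MemLp.of_le_mul (c := 1) ((hker m).comp_fst coinMeasure) ?_ ?_
    · exact ((measurable_of_finite signFun).comp measurable_snd).aestronglyMeasurable.mul
        ((hker m).comp_fst coinMeasure).1
    · refine Eventually.of_forall fun ω => ?_
      unfold signFun
      split_ifs <;> simp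
  let ξ : ℤ → Lp ℂ 2 (unifMeasure.prod coinMeasure) := fun m => (hprod m).toLp _
  have hinc : ∀ s m : ℤ, ((increment n s ξ m : Lp ℂ 2 (unifMeasure.prod coinMeasure)) : ℝ × Bool → ℂ) =ᵐ[unifMeasure.prod coinMeasure] fun ω =>
      (Complex.exp (Complex.I * ω.1 * m) * (1 - Complex.exp (-(Complex.I * s * ω.1))) ^ n /
        (Complex.I * ω.1) ^ n * ((√(f ω.1) : ℝ) : ℂ)) * signFun ω.2 := by
    intro s m
    have h1 : ∀ᵐ ω ∂(unifMeasure.prod coinMeasure), ∀ k : ℤ, ξ k ω =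
        signFun ω.2 * (incrKernel n k ω.1 * ((√(f ω.1) : ℝ) : ℂ)) :=
      ae_all_iff.2 fun k => MemLp.coeFn_toLp (hprod k)
    filter_upwards [h1, coeFn_sum_smul (Finset.range (n + 1))
      (fun l => (-1 : ℂ) ^ l * (n.choose l : ℂ)) (fun l => ξ (m - l * s))] with ω h1 h2
    unfold increment
    rw [h2, ← sum_incrKernel, Finset.sum_mul, Finset.sum_mul]
    refine Finset.sum_congr rfl fun l _ => ?_
    rw [h1]
    ring
  refine ⟨ℝ × Bool, inferInstance, unifMeasure.prod coinMeasure, inferInstance, ξ, ⟨fun m s => ?_, ?_⟩⟩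
  · rw [integral_congr_ae (hinc s m), integral_prod_mul
      (fun t : ℝ => Complex.exp (Complex.I * t * m) * (1 - Complex.exp (-(Complex.I * s * t))) ^ n /
        (Complex.I * t) ^ n * ((√(f t) : ℝ) : ℂ)) signFun, integral_signFun, mul_zero]
  · intro m₀ m s₁ s₂
    rw [L2.inner_def, ← integral_unifMeasure]
    have : ∫ t, (Complex.exp (Complex.I * t * m) * (1 - Complex.exp (-(Complex.I * s₁ * t))) ^ n *
          (1 - Complex.exp (Complex.I * s₂ * t)) ^ n / (t : ℂ) ^ (2 * n) * (f t : ℂ)) ∂unifMeasure =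
        ∫ ω, (Complex.exp (Complex.I * ω.1 * m) *
          (1 - Complex.exp (-(Complex.I * s₁ * ω.1))) ^ n *
          (1 - Complex.exp (Complex.I * s₂ * ω.1)) ^ n / (ω.1 : ℂ) ^ (2 * n) * (f ω.1 : ℂ)) *
          (fun _ => (1 : ℂ)) ω.2 ∂(unifMeasure.prod coinMeasure) := by
      rw [integral_prod_mul (fun t : ℝ => (Complex.exp (Complex.I * t * m) *
          (1 - Complex.exp (-(Complex.I * s₁ * t))) ^ n *
          (1 - Complex.exp (Complex.I * s₂ * t)) ^ n / (t : ℂ) ^ (2 * n) * (f t : ℂ)))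
          (fun _ => (1 : ℂ))]
      rw [integral_const, probReal_univ, one_smul, mul_one]
    rw [this]
    refine integral_congr_ae ?_
    have hpos' : ∀ᵐ ω ∂(unifMeasure.prod coinMeasure), 0 ≤ f ω.1 :=
      Measure.quasiMeasurePreserving_fst.ae hpos
    filter_upwards [hinc s₂ m₀, hinc s₁ (m₀ + m), hpos'] with ω h1 h2 h3
    rw [h1, h2, RCLike.inner_apply]
    have hs : signFun ω.2 * starRingEnd ℂ (signFun ω.2) = 1 := by
      unfold signFun
      split_ifs <;> simp
    have hq : ((√(f ω.1) : ℝ) : ℂ) * ((√(f ω.1) : ℝ) : ℂ) = (f ω.1 : ℂ) := by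
      rw [← Complex.ofReal_mul, Real.mul_self_sqrt h3]
    have he : Complex.exp (Complex.I * ω.1 * ((m₀ + m : ℤ) : ℂ)) *
        Complex.exp (-(Complex.I * ω.1 * m₀)) = Complex.exp (Complex.I * ω.1 * m) := by
      rw [← Complex.exp_add]
      congr 1
      push_cast
      ring
    simp only [map_mul, map_div₀, map_pow, map_sub, map_one, ← Complex.exp_conj, map_neg,
      Complex.conj_I, Complex.conj_ofReal, map_intCast]
    have e1 : -Complex.I * (ω.1 : ℂ) * (m₀ : ℂ) = -(Complex.I * ω.1 * m₀) := by ring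
    have e2 : -(-Complex.I * (s₂ : ℂ) * (ω.1 : ℂ)) = Complex.I * s₂ * ω.1 := by ring
    have e3 : (Complex.I * (ω.1 : ℂ)) ^ n * (-Complex.I * (ω.1 : ℂ)) ^ n = (ω.1 : ℂ) ^ (2 * n) := by
      rw [← mul_pow, pow_mul]
      congr 1
      linear_combination (-(ω.1 : ℂ) ^ 2) * Complex.I_mul_I
    rw [e1, e2, ← he, ← hq, ← e3]
    linear_combination (Complex.exp (Complex.I * ω.1 * ((m₀ + m : ℤ) : ℂ)) *
      Complex.exp (-(Complex.I * ω.1 * m₀)) *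
      (1 - Complex.exp (-(Complex.I * s₁ * ω.1))) ^ n * (1 - Complex.exp (Complex.I * s₂ * ω.1)) ^ n /
      ((Complex.I * (ω.1 : ℂ)) ^ n * (-Complex.I * (ω.1 : ℂ)) ^ n) *
      (((√(f ω.1) : ℝ) : ℂ) * ((√(f ω.1) : ℝ) : ℂ))) * hs

/-! ### `Aξ` is the sum `∑ a(k) ξ(k)` when `a` has finite support -/

theorem sum_dCoeff (n μ : ℕ) (hμ : 1 ≤ μ) (p : ℕ) :
    ∑ l ∈ (Finset.range (n + 1)).filter (fun l => l * μ ≤ p),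
      (-1 : ℂ) ^ l * (n.choose l : ℂ) * dCoeff n μ (p - l * μ) = if p = 0 then 1 else 0 := by
  have h1 : (1 - (PowerSeries.X : PowerSeries ℂ) ^ μ) *
      (PowerSeries.mk fun j => if μ ∣ j then (1 : ℂ) else 0) = 1 := by
    ext k
    rw [sub_mul, one_mul, map_sub, PowerSeries.coeff_X_pow_mul', PowerSeries.coeff_one]
    simp only [PowerSeries.coeff_mk]
    by_cases hk : k = 0
    · subst hk
      have : ¬ μ ≤ 0 := by omega
      simp [this]
    · by_cases h : μ ≤ k
      · have : (μ ∣ k ∨ k ≤ μ) ↔ μ ∣ k :=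
          ⟨fun h' => h'.elim id fun h'' => (le_antisymm h h'') ▸ dvd_rfl, Or.inl⟩
        simp [h, hk, Nat.dvd_sub_self_right, this]
      · have : ¬ μ ∣ k := fun hd => h (Nat.le_of_dvd (Nat.pos_of_ne_zero hk) hd)
        simp [h, hk, this]
  have h2 := congrArg (PowerSeries.coeff p) (congrArg (· ^ n) h1)
  simp only [mul_pow, one_pow, PowerSeries.coeff_one] at h2
  rw [← h2, sub_eq_neg_add, add_pow, Finset.sum_mul, map_sum, Finset.sum_filter]
  refine Finset.sum_congr rfl fun l _ => ?_
  have : (-(PowerSeries.X : PowerSeries ℂ) ^ μ) ^ l * 1 ^ (n - l) * (n.choose l : PowerSeries ℂ) *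
      (PowerSeries.mk fun j => if μ ∣ j then (1 : ℂ) else 0) ^ n =
      PowerSeries.C ((-1 : ℂ) ^ l * (n.choose l : ℂ)) * (PowerSeries.X ^ (l * μ) *
      (PowerSeries.mk fun j => if μ ∣ j then (1 : ℂ) else 0) ^ n) := by
    rw [neg_pow, ← pow_mul, mul_comm μ l]
    simp
    ring
  rw [this, PowerSeries.coeff_C_mul, PowerSeries.coeff_X_pow_mul']
  split_ifs <;> simp [dCoeff]

/-- The coefficients `b_μ` of a finitely supported `a`. -/
theorem bCoeff_eq_sum (n μ : ℕ) (a : ℕ → ℂ) (N : ℕ) (ha : ∀ k, N ≤ k → a k = 0) (k : ℕ) :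
    bCoeff n μ a k = ∑ m ∈ Finset.range N, if k ≤ m then a m * dCoeff n μ (m - k) else 0 := by
  unfold bCoeff
  rw [tsum_eq_sum (s := Finset.range (N - k)) (fun i hi => by
    rw [ha _ (by simp at hi; omega), zero_mul]), ← Finset.sum_filter]
  refine Finset.sum_bij (fun i _ => k + i) ?_ ?_ ?_ ?_
  · intro i hi
    simp at hi ⊢
    omega
  · intro i _ j _ h
    omega
  · intro m hm
    simp at hm
    exact ⟨m - k, by simp; omega, by omega⟩
  · intro i _
    simp

theorem shift_sum {E : Type*} [AddCommGroup E] [Module ℂ E] (n μ m l : ℕ) (hl : l ≤ n) (d : ℕ → ℂ)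
    (ξ : ℤ → E) :
    ∑ k ∈ Finset.range (m + 1), d (m - k) • ξ ((k : ℤ) - l * μ) =
      (∑ i ∈ Finset.range (m + 1), if l * μ ≤ m - i then d (m - i - l * μ) • ξ i else 0) +
      ∑ j ∈ Finset.range (μ * n), if j + 1 ≤ l * μ ∧ l * μ - (j + 1) ≤ m then
        d (m - (l * μ - (j + 1))) • ξ (-((j : ℤ) + 1)) else 0 := by
  have hln : l * μ ≤ μ * n := by
    rw [mul_comm]
    exact Nat.mul_le_mul_left μ hl
  rw [← Finset.sum_filter_add_sum_filter_not _ (fun k => l * μ ≤ k)]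
  congr 1
  · by_cases hm : l * μ ≤ m
    · have hc : ∀ i ∈ Finset.range (m + 1), (if l * μ ≤ m - i then
          d (m - i - l * μ) • ξ (i : ℤ) else 0) =
          if i < m + 1 - l * μ then d (m - i - l * μ) • ξ (i : ℤ) else 0 := by
        intro i hi
        simp at hi
        congr 1
        simp only [eq_iff_iff]
        omega
      rw [Finset.sum_congr rfl hc, ← Finset.sum_filter]
      refine Finset.sum_bij (fun k _ => k - l * μ) ?_ ?_ ?_ ?_
      · intro k hk
        simp only [Finset.mem_filter, Finset.mem_range] at hk ⊢
        omega
      · intro k hk k' hk' h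
        simp only [Finset.mem_filter, Finset.mem_range] at hk hk'
        omega
      · intro i hi
        simp only [Finset.mem_filter, Finset.mem_range] at hi
        exact ⟨i + l * μ, by simp only [Finset.mem_filter, Finset.mem_range]; omega, by omega⟩
      · intro k hk
        simp only [Finset.mem_filter, Finset.mem_range] at hk
        have h1 : m - (k - l * μ) - l * μ = m - k := by omega
        have h2 : ((k - l * μ : ℕ) : ℤ) = (k : ℤ) - l * μ := by
          rw [Nat.cast_sub hk.2]
          push_cast
          ring
        rw [h1, h2]
    · rw [Finset.sum_eq_zero, Finset.sum_eq_zero]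
      · intro i _
        rw [if_neg (by omega)]
      · intro k hk
        simp only [Finset.mem_filter, Finset.mem_range] at hk
        omega
  · rw [← Finset.sum_filter]
    refine Finset.sum_bij (fun k _ => l * μ - (k + 1)) ?_ ?_ ?_ ?_
    · intro k hk
      simp only [Finset.mem_filter, Finset.mem_range] at hk ⊢
      omega
    · intro k hk k' hk' h
      simp only [Finset.mem_filter, Finset.mem_range] at hk hk'
      omega
    · intro j hj
      simp only [Finset.mem_filter, Finset.mem_range] at hj
      exact ⟨l * μ - (j + 1), by simp only [Finset.mem_filter, Finset.mem_range]; omega, by omega⟩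
    · intro k hk
      simp only [Finset.mem_filter, Finset.mem_range] at hk
      have h1 : l * μ - (l * μ - (k + 1) + 1) = k := by omega
      have h2 : -(((l * μ - (k + 1) : ℕ) : ℤ) + 1) = (k : ℤ) - l * μ := by
        rw [Nat.cast_sub (by omega)]
        push_cast
        ring
      rw [h1, h2]

/-- For finitely supported `a` the functional `Aξ` is the finite sum `∑ a(k) ξ(k)`. -/
theorem functionalA_eq_sum {Ω : Type} [MeasurableSpace Ω] {P : Measure Ω} (n μ : ℕ) (hμ : 1 ≤ μ)
    (a : ℕ → ℂ) (N : ℕ) (ha : ∀ k, N ≤ k → a k = 0) (ξ : ℤ → Lp ℂ 2 P) :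
    functionalA n μ a ξ = ∑ k ∈ Finset.range N, a k • ξ (k : ℤ) := by
  have hb := bCoeff_eq_sum n μ a N ha
  have key : ∀ m : ℕ, ∑ k ∈ Finset.range (m + 1), dCoeff n μ (m - k) • increment n μ ξ (k : ℤ) =
      ξ m + ∑ j ∈ Finset.range (μ * n), (∑ l ∈ (Finset.range (n + 1)).filter
        (fun l => j + 1 ≤ l * μ), (-1 : ℂ) ^ l * (n.choose l : ℂ) *
          (if l * μ - (j + 1) ≤ m then dCoeff n μ (m - (l * μ - (j + 1))) else 0)) •
            ξ (-((j : ℤ) + 1)) := by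
    intro m
    have e1 : ∑ k ∈ Finset.range (m + 1), dCoeff n μ (m - k) • increment n μ ξ (k : ℤ) =
        ∑ l ∈ Finset.range (n + 1), ((-1 : ℂ) ^ l * (n.choose l : ℂ)) •
          ∑ k ∈ Finset.range (m + 1), dCoeff n μ (m - k) • ξ ((k : ℤ) - l * μ) := by
      simp only [increment, Finset.smul_sum]
      rw [Finset.sum_comm]
      refine Finset.sum_congr rfl fun l _ => Finset.sum_congr rfl fun k _ => ?_
      rw [smul_comm]
    rw [e1, Finset.sum_congr rfl fun l hl => by
      rw [shift_sum n μ m l (Nat.lt_succ_iff.1 (Finset.mem_range.1 hl)) (dCoeff n μ) ξ]]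
    simp only [smul_add, Finset.sum_add_distrib]
    congr 1
    · simp only [Finset.smul_sum]
      rw [Finset.sum_comm, Finset.sum_eq_single m]
      · have h := sum_dCoeff n μ hμ 0
        rw [Finset.sum_filter] at h
        rw [if_pos rfl] at h
        conv_rhs => rw [← one_smul ℂ (ξ (m : ℤ)), ← h, Finset.sum_smul]
        refine Finset.sum_congr rfl fun l _ => ?_
        rw [Nat.sub_self]
        split_ifs <;> simp [mul_smul]
      · intro i hi him
        simp only [Finset.mem_range] at hi
        have h := sum_dCoeff n μ hμ (m - i)
        rw [Finset.sum_filter, if_neg (by omega)] at h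
        have h' := congrArg (fun c : ℂ => c • ξ (i : ℤ)) h
        simp only [zero_smul, Finset.sum_smul] at h'
        refine Eq.trans (Finset.sum_congr rfl fun l _ => ?_) h'
        split_ifs <;> simp [mul_smul]
      · intro h
        simp at h
    · simp only [Finset.smul_sum]
      rw [Finset.sum_comm]
      refine Finset.sum_congr rfl fun j _ => ?_
      rw [Finset.sum_filter, Finset.sum_smul]
      refine Finset.sum_congr rfl fun l _ => ?_
      by_cases h1 : j + 1 ≤ l * μ <;> by_cases h2 : l * μ - (j + 1) ≤ m <;>
        simp [h1, h2, mul_smul]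
  have hB : functionalB n μ a ξ = ∑ m ∈ Finset.range N, a m •
      ∑ k ∈ Finset.range (m + 1), dCoeff n μ (m - k) • increment n μ ξ (k : ℤ) := by
    unfold functionalB
    rw [tsum_eq_sum (s := Finset.range N) (fun k hk => by
      rw [hb, Finset.sum_eq_zero, zero_smul]
      intro m hm
      simp at hk hm
      rw [if_neg (by omega)])]
    simp only [hb, Finset.sum_smul, Finset.smul_sum]
    rw [Finset.sum_comm]
    refine Finset.sum_congr rfl fun m hm => ?_
    simp only [Finset.mem_range] at hm
    rw [← Finset.sum_subset (Finset.range_subset_range.2 (show m + 1 ≤ N by omega))]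
    · refine Finset.sum_congr rfl fun k hk => ?_
      simp only [Finset.mem_range] at hk
      rw [if_pos (by omega), mul_smul]
    · intro k _ hk
      simp only [Finset.mem_range] at hk
      rw [if_neg (by omega), zero_smul]
  have hV : functionalV n μ a ξ = ∑ m ∈ Finset.range N, a m •
      ∑ j ∈ Finset.range (μ * n), (∑ l ∈ (Finset.range (n + 1)).filter
        (fun l => j + 1 ≤ l * μ), (-1 : ℂ) ^ l * (n.choose l : ℂ) *
          (if l * μ - (j + 1) ≤ m then dCoeff n μ (m - (l * μ - (j + 1))) else 0)) •
            ξ (-((j : ℤ) + 1)) := by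
    unfold functionalV
    simp only [Finset.smul_sum]
    rw [Finset.sum_comm]
    refine Finset.sum_congr rfl fun j _ => ?_
    simp only [smul_smul, ← Finset.sum_smul]
    congr 1
    unfold vCoeff
    simp only [hb, Finset.mul_sum]
    rw [Finset.sum_comm]
    refine Finset.sum_congr rfl fun m _ => Finset.sum_congr rfl fun l _ => ?_
    split_ifs
    · ring
    · simp
  unfold functionalA
  rw [hB, hV, ← Finset.sum_sub_distrib]
  refine Finset.sum_congr rfl fun m _ => ?_
  rw [key, smul_add, add_sub_cancel_right]

end Extrapolation

end

open Extrapolation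

/-! The proof is a saddle point argument. Let W be the boundary value of w_μ in the variable
e^{-it}, so that |W|² is the weight |1-e^{-iμt}|^{2n}/t^{2n}. Since -Vξ is common to all estimates,
a linear estimate amounts to choosing coefficients c on ℤ with c = b_μ on ℕ, and its error under f
is the mean of |∑ c_k e^{ikt}|² |W|² f.

Lower bound (`sum_norm_opDAW_le`): if f = |G|² with G = ∑ ψ(k) e^{-ikt}, the Fourier coefficients of
(∑ c_k e^{ikt}) W G at frequencies j ≥ 0 involve only c on ℕ and equal (D^μ A W^μ ψ)_j. By Bessel
every error is at least ‖D^μ A W^μ ψ‖².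

Upper bound (`exists_tendsto_error`): for a canonical φ with Φ = ∑ φ(k) e^{-ikt}, past coefficients
can be chosen to cancel, in the limit, the negative frequencies of (∑ b_μ(k) e^{ikt}) W Φ. What
remains is C = ∑ (D^μ A W^μ φ)_j e^{ijt}, so the error under any f tends to the mean of (|C|²/|Φ|²)
f, called `errorAt`. At f = |Φ|² this is ‖D^μ A W^μ φ‖².

Saddle point (`errorAt_eq_of_rational`): the form (52) says that |C|²/|Φ|² is a constant times the
squared modulus of a real trigonometric polynomial of degree at most M, so `errorAt` depends on f
only through ρ_0, …, ρ_M and is constant on D_M. Therefore, for f in D_M, the optimal error under f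
is at most `errorAt` at f, which equals ‖D^μ A W^μ φ‖², which is at most the optimal error under
f_φ. The same chain with |G|² in place of f solves the extremum problem. For (1), the value at φ⁰
equals ν_M⁺P₀ and so dominates the constant belonging to any φ of the form (52).

The analytic work is to keep W, Φ, 1/Φ in the algebra of absolutely convergent power series.
Evaluating the Herglotz integral gives w_μ = (1+z+…+z^{μ-1})^n E with E and 1/E in the algebra. The
polynomial factor has zeros on the circle when μ > 1, which is why the cancellation is only
approximate. -/

/-! ### Absolutely convergent power series on the closed unit disc -/

/-- `F` is the sum of the power series with the absolutely summable coefficients `c` on the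
closed unit disc. -/
structure HasAbsSeries (F : ℂ → ℂ) (c : ℕ → ℂ) : Prop where
  summable : Summable fun k => ‖c k‖
  hasSum : ∀ z : ℂ, ‖z‖ ≤ 1 → HasSum (fun k => c k * z ^ k) (F z)

namespace HasAbsSeries

variable {F G : ℂ → ℂ} {c d : ℕ → ℂ}

theorem norm_term_le (c : ℕ → ℂ) {z : ℂ} (hz : ‖z‖ ≤ 1) (k : ℕ) : ‖c k * z ^ k‖ ≤ ‖c k‖ := by
  rw [norm_mul, norm_pow]
  exact mul_le_of_le_one_right (norm_nonneg _) (pow_le_one₀ (norm_nonneg _) hz)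

theorem summable_norm_term (h : Summable fun k => ‖c k‖) {z : ℂ} (hz : ‖z‖ ≤ 1) :
    Summable fun k => ‖c k * z ^ k‖ :=
  Summable.of_nonneg_of_le (fun _ => norm_nonneg _) (norm_term_le c hz) h

theorem of_summable (h : Summable fun k => ‖c k‖) :
    HasAbsSeries (fun z => ∑' k, c k * z ^ k) c :=
  ⟨h, fun _ hz => (summable_norm_term h hz).of_norm.hasSum⟩

theorem congr (h : HasAbsSeries F c) (hFG : ∀ z : ℂ, ‖z‖ ≤ 1 → G z = F z) : HasAbsSeries G c :=
  ⟨h.summable, fun z hz => by rw [hFG z hz]; exact h.hasSum z hz⟩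

theorem add (hF : HasAbsSeries F c) (hG : HasAbsSeries G d) :
    HasAbsSeries (fun z => F z + G z) (fun k => c k + d k) :=
  ⟨Summable.of_nonneg_of_le (fun _ => norm_nonneg _) (fun _ => norm_add_le _ _)
    (hF.summable.add hG.summable), fun z hz => by
    simpa only [add_mul] using (hF.hasSum z hz).add (hG.hasSum z hz)⟩

theorem const_mul (hF : HasAbsSeries F c) (a : ℂ) :
    HasAbsSeries (fun z => a * F z) (fun k => a * c k) :=
  ⟨by simpa only [norm_mul] using hF.summable.mul_left ‖a‖, fun z hz => by
    simpa only [mul_assoc] using (hF.hasSum z hz).mul_left a⟩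

theorem mul (hF : HasAbsSeries F c) (hG : HasAbsSeries G d) :
    HasAbsSeries (fun z => F z * G z) (fun j => ∑ k ∈ Finset.range (j + 1), c k * d (j - k)) := by
  refine ⟨summable_norm_sum_mul_range_of_summable_norm hF.summable hG.summable, fun z hz => ?_⟩
  have h := hasSum_sum_range_mul_of_summable_norm (summable_norm_term hF.summable hz)
    (summable_norm_term hG.summable hz)
  rw [(hF.hasSum z hz).tsum_eq, (hG.hasSum z hz).tsum_eq] at h
  refine h.congr_fun fun j => ?_
  rw [Finset.sum_mul]
  refine Finset.sum_congr rfl fun k hk => ?_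
  have : j = k + (j - k) := by
    have := Finset.mem_range.1 hk
    omega
  conv_lhs => rw [this, pow_add, Nat.add_sub_cancel_left]
  ring

theorem tsum_norm_mul_le (hc : Summable fun k => ‖c k‖) (hd : Summable fun k => ‖d k‖) :
    ∑' j, ‖∑ k ∈ Finset.range (j + 1), c k * d (j - k)‖ ≤ (∑' k, ‖c k‖) * ∑' k, ‖d k‖ := by
  have hc' : Summable fun k => ‖(‖c k‖ : ℝ)‖ := by simpa using hc
  have hd' : Summable fun k => ‖(‖d k‖ : ℝ)‖ := by simpa using hd
  have h := hasSum_sum_range_mul_of_summable_norm hc' hd'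
  rw [← h.tsum_eq]
  refine Summable.tsum_le_tsum (fun j => ?_)
    (summable_norm_sum_mul_range_of_summable_norm hc hd) h.summable
  exact (norm_sum_le _ _).trans (le_of_eq (by simp))

theorem one : HasAbsSeries (fun _ => 1) (fun k => if k = 0 then 1 else 0) := by
  constructor
  · exact summable_of_ne_finset_zero (s := {0}) fun k hk => by simp at hk; simp [hk]
  · intro z _
    have := hasSum_single (f := fun k => (if k = 0 then (1 : ℂ) else 0) * z ^ k) 0
      (fun k hk => by simp [hk])
    simpa using this

theorem X_pow (m : ℕ) : HasAbsSeries (fun z => z ^ m) (fun k => if k = m then 1 else 0) := by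
  constructor
  · exact summable_of_ne_finset_zero (s := {m}) fun k hk => by simp at hk; simp [hk]
  · intro z _
    have := hasSum_single (f := fun k => (if k = m then (1 : ℂ) else 0) * z ^ k) m
      (fun k hk => by simp [hk])
    simpa using this

/-- The coefficient norm is submultiplicative; its bound on powers is what makes compositions
converge. -/
theorem exists_pow (hF : HasAbsSeries F c) (j : ℕ) :
    ∃ d, HasAbsSeries (fun z => F z ^ j) d ∧ ∑' k, ‖d k‖ ≤ (∑' k, ‖c k‖) ^ j := by
  induction j with
  | zero =>
    refine ⟨_, one.congr (fun z _ => by simp), ?_⟩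
    rw [tsum_eq_single 0 fun k hk => by simp [hk]]
    simp
  | succ j ih =>
    obtain ⟨d, hd, hle⟩ := ih
    refine ⟨_, (hd.mul hF).congr fun z _ => pow_succ _ _, (tsum_norm_mul_le hd.summable hF.summable).trans ?_⟩
    rw [pow_succ]
    exact mul_le_mul_of_nonneg_right hle (tsum_nonneg fun _ => norm_nonneg _)

theorem exists_finset_sum {ι : Type*} (s : Finset ι) {F : ι → ℂ → ℂ}
    (hF : ∀ i ∈ s, ∃ c, HasAbsSeries (F i) c) :
    ∃ c, HasAbsSeries (fun z => ∑ i ∈ s, F i z) c := by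
  classical
  induction s using Finset.induction_on with
  | empty => exact ⟨_, (one.const_mul 0).congr fun z _ => by simp⟩
  | insert i s hi ih =>
    obtain ⟨c, hc⟩ := hF i (Finset.mem_insert_self i s)
    obtain ⟨d, hd⟩ := ih fun j hj => hF j (Finset.mem_insert_of_mem hj)
    exact ⟨_, (hc.add hd).congr fun z _ => Finset.sum_insert hi⟩

/-- Functional calculus in the algebra: the double family of the coefficients of a_j F^j is
absolutely summable, dominated by ‖a_j‖ times the j-th power of the coefficient norm of F, so it may
be summed in either order. -/
theorem exists_comp (hF : HasAbsSeries F c) {g : ℂ → ℂ} {a : ℕ → ℂ}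
    (hg : ∀ z, ‖z‖ ≤ 1 → HasSum (fun j => a j * F z ^ j) (g (F z)))
    (ha : Summable fun j => ‖a j‖ * (∑' k, ‖c k‖) ^ j) :
    ∃ e, HasAbsSeries (fun z => g (F z)) e := by
  choose d hd hle using hF.exists_pow
  set S := ∑' k, ‖c k‖
  have hsum : Summable fun p : ℕ × ℕ => ‖a p.1 * d p.1 p.2‖ := by
    refine (summable_prod_of_nonneg (f := fun p : ℕ × ℕ => ‖a p.1 * d p.1 p.2‖)
      (fun p => norm_nonneg _)).2 ⟨fun j => ?_, ?_⟩
    · simpa only [norm_mul] using (hd j).summable.mul_left ‖a j‖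
    · refine Summable.of_nonneg_of_le (fun j => tsum_nonneg fun k => norm_nonneg _) (fun j => ?_) ha
      simp only [norm_mul]
      rw [tsum_mul_left]
      exact mul_le_mul_of_nonneg_left (hle j) (norm_nonneg _)
  have hsum' : Summable fun p : ℕ × ℕ => ‖a p.2 * d p.2 p.1‖ := hsum.prod_symm
  refine ⟨fun k => ∑' j, a j * d j k, ?_, fun z hz => ?_⟩
  · refine Summable.of_nonneg_of_le (fun _ => norm_nonneg _) (fun k => ?_) hsum'.prod
    exact norm_tsum_le_tsum_norm (hsum'.prod_factor k)
  · have hz' : Summable fun p : ℕ × ℕ => a p.2 * d p.2 p.1 * z ^ p.1 := by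
      refine Summable.of_norm (Summable.of_nonneg_of_le (fun _ => norm_nonneg _) (fun p => ?_) hsum')
      exact norm_term_le (fun k => a p.2 * d p.2 k) hz p.1
    have h1 := hz'.hasSum.prod_fiberwise (fun k => (hz'.prod_factor k).hasSum)
    have h2 : ∑' p : ℕ × ℕ, a p.2 * d p.2 p.1 * z ^ p.1 = g (F z) := by
      have h3 := hz'.prod_symm.hasSum.prod_fiberwise
        (g := fun j => a j * F z ^ j) fun j => by
          refine (((hd j).hasSum z hz).mul_left (a j)).congr_fun fun k => ?_
          simp only [Prod.swap]
          ring
      rw [(hg z hz).unique h3]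
      exact ((Equiv.prodComm ℕ ℕ).tsum_eq (fun p : ℕ × ℕ => a p.2 * d p.2 p.1 * z ^ p.1)).symm
    rw [h2] at h1
    simpa only [tsum_mul_right] using h1

theorem exists_exp (hF : HasAbsSeries F c) : ∃ e, HasAbsSeries (fun z => Complex.exp (F z)) e := by
  refine hF.exists_comp (a := fun j => ((j.factorial : ℝ)⁻¹ : ℂ)) (fun z _ => ?_) ?_
  · rw [Complex.exp_eq_exp_ℂ]
    refine (NormedSpace.expSeries_div_hasSum_exp (F z)).congr_fun fun j => ?_
    push_cast
    rw [div_eq_inv_mul]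
  · refine (Real.summable_pow_div_factorial (∑' k, ‖c k‖)).congr fun j => ?_
    rw [norm_inv, Complex.norm_real, Real.norm_natCast, div_eq_inv_mul]

theorem continuousOn (hF : HasAbsSeries F c) : ContinuousOn F (Metric.closedBall 0 1) := by
  have : ContinuousOn (fun z : ℂ => ∑' k, c k * z ^ k) (Metric.closedBall 0 1) :=
    continuousOn_tsum (fun k => by fun_prop) hF.summable fun k z hz =>
      norm_term_le c (by simpa using hz) k
  exact this.congr fun z hz => ((hF.hasSum z (by simpa using hz)).tsum_eq).symm

/-- Uniqueness of Taylor coefficients. It identifies `wCoeff`, defined through derivatives at 0,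
with coefficients of an absolutely convergent series. -/
theorem coeff_eq_iteratedDeriv (hF : HasAbsSeries F c) {w : ℂ → ℂ}
    (hw : ∀ z : ℂ, ‖z‖ < 1 → w z = F z) (k : ℕ) :
    iteratedDeriv k w 0 / (k.factorial : ℂ) = c k := by
  have h : HasFPowerSeriesAt w (FormalMultilinearSeries.ofScalars ℂ c) 0 := by
    rw [hasFPowerSeriesAt_iff]
    filter_upwards [Metric.ball_mem_nhds (0 : ℂ) one_pos] with z hz
    have hz' : ‖z‖ < 1 := by simpa using hz
    rw [zero_add, hw z hz']
    simpa [mul_comm] using hF.hasSum z hz'.le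
  have h2 := h.analyticAt.hasFPowerSeriesAt
  have h3 := congrArg (fun p => p.coeff k) (h2.eq_formalMultilinearSeries h)
  simpa using h3

end HasAbsSeries

/-! ### Canonical factors and their reciprocals -/

theorem Extrapolation.IsCanonical.summable_norm {φ : ℕ → ℂ} (h : IsCanonical φ) : Summable fun k => ‖φ k‖ := by
  obtain ⟨r, hr, hs⟩ := h.1
  exact Summable.of_nonneg_of_le (fun _ => norm_nonneg _)
    (fun k => le_mul_of_one_le_right (norm_nonneg _) (one_le_pow₀ hr.le)) hs

/-- The reciprocal of a canonical factor has an absolutely convergent series. -/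
theorem Extrapolation.IsCanonical.exists_inv {φ : ℕ → ℂ} (h : IsCanonical φ) :
    ∃ c, HasAbsSeries (fun z => (∑' k, φ k * z ^ k)⁻¹) c := by
  obtain ⟨⟨r, hr, hs⟩, h0⟩ := h
  set Φ : ℂ → ℂ := fun z => ∑' k, φ k * z ^ k
  have hdiff : DifferentiableOn ℂ Φ (Metric.ball 0 r) := by
    refine Complex.differentiableOn_tsum_of_summable_norm hs (fun k => by fun_prop)
      Metric.isOpen_ball fun k z hz => ?_
    rw [norm_mul, norm_pow]
    have : ‖z‖ ≤ r := by simpa using (Metric.mem_ball.1 hz).le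
    gcongr
  -- The zeros in a slightly larger closed disc form a compact set; a zero of least modulus lies
  -- outside the unit disc, so Φ stays zero-free on some larger open disc.
  obtain ⟨s, hs1, hsr, hs0⟩ : ∃ s, 1 < s ∧ s ≤ r ∧ ∀ z : ℂ, ‖z‖ < s → Φ z ≠ 0 := by
    set t := (1 + r) / 2
    have ht : 1 < t := by simp only [t]; linarith
    have htr : t < r := by simp only [t]; linarith
    have hc : ContinuousOn Φ (Metric.closedBall 0 t) :=
      hdiff.continuousOn.mono (Metric.closedBall_subset_ball htr)
    have hK : IsCompact (Metric.closedBall (0 : ℂ) t ∩ Φ ⁻¹' {0}) :=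
      (isCompact_closedBall (0 : ℂ) t).of_isClosed_subset
        (hc.preimage_isClosed_of_isClosed Metric.isClosed_closedBall isClosed_singleton)
        Set.inter_subset_left
    rcases Set.eq_empty_or_nonempty (Metric.closedBall (0 : ℂ) t ∩ Φ ⁻¹' {0}) with he | hne
    · refine ⟨t, ht, htr.le, fun z hz hz0 => ?_⟩
      have : z ∈ Metric.closedBall (0 : ℂ) t ∩ Φ ⁻¹' {0} := ⟨by simpa using hz.le, hz0⟩
      rw [he] at this
      exact this
    · obtain ⟨x, hx, hmin⟩ := hK.exists_isMinOn hne continuous_norm.continuousOn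
      refine ⟨‖x‖, ?_, ?_, fun z hz hz0 => ?_⟩
      · by_contra! hle
        exact h0 x hle hx.2
      · have : ‖x‖ ≤ t := by simpa using hx.1
        linarith
      · have hxt : ‖x‖ ≤ t := by simpa using hx.1
        have : z ∈ Metric.closedBall (0 : ℂ) t ∩ Φ ⁻¹' {0} := ⟨by simp; linarith, hz0⟩
        have := hmin this
        simp at this
        linarith
  obtain ⟨R, hR1, hRs⟩ := exists_between hs1
  lift R to NNReal using by linarith
  have hd : DifferentiableOn ℂ (fun z => (Φ z)⁻¹) (Metric.closedBall 0 R) := by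
    refine (hdiff.mono (Metric.closedBall_subset_ball (hRs.trans_le hsr))).inv fun z hz => hs0 z ?_
    have : ‖z‖ ≤ R := by simpa using hz
    linarith
  -- The Cauchy series on a disc of radius R > 1 converges absolutely at radius one.
  have hp := hd.hasFPowerSeriesOnBall (by exact_mod_cast one_pos.trans hR1)
  have hrad : ((1 : NNReal) : ℝ≥0∞) < (cauchyPowerSeries (fun z => (Φ z)⁻¹) 0 R).radius :=
    lt_of_lt_of_le (by exact_mod_cast hR1) hp.r_le
  refine ⟨fun k => (cauchyPowerSeries (fun z => (Φ z)⁻¹) 0 R).coeff k, ?_, fun z hz => ?_⟩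
  · have := (cauchyPowerSeries (fun z => (Φ z)⁻¹) 0 R).summable_norm_mul_pow hrad
    refine Summable.of_nonneg_of_le (fun _ => norm_nonneg _) (fun k => ?_) this
    rw [FormalMultilinearSeries.norm_apply_eq_norm_coef]
    simp
  · have := hp.hasSum (y := z) (by
      simp only [Metric.mem_eball, edist_zero_right]
      rw [enorm_eq_nnnorm]
      have : ‖z‖₊ < R := lt_of_le_of_lt (b := 1) (by exact_mod_cast hz) (by exact_mod_cast hR1)
      exact_mod_cast this)
    simpa [mul_comm] using this

/-! ### Trigonometric series on `(-π, π]` -/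

/-- The character `t ↦ e^{itm}`. -/
noncomputable def expChar (m : ℤ) (t : ℝ) : ℂ := Complex.exp (Complex.I * t * m)

theorem continuous_expChar (m : ℤ) : Continuous (expChar m) := by
  unfold expChar
  fun_prop

@[simp]
theorem norm_expChar (m : ℤ) (t : ℝ) : ‖expChar m t‖ = 1 := by
  have : Complex.I * t * m = ((t * m : ℝ) : ℂ) * Complex.I := by push_cast; ring
  rw [expChar, this, Complex.norm_exp_ofReal_mul_I]

theorem expChar_add (k m : ℤ) (t : ℝ) : expChar (k + m) t = expChar k t * expChar m t := by
  rw [expChar, expChar, expChar, ← Complex.exp_add]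
  congr 1
  push_cast
  ring

@[simp]
theorem expChar_zero (t : ℝ) : expChar 0 t = 1 := by simp [expChar]

theorem expChar_neg (m : ℤ) (t : ℝ) : expChar (-m) t = (starRingEnd ℂ) (expChar m t) := by
  simp [expChar, ← Complex.exp_conj]

theorem expChar_nat_mul (k : ℤ) (m : ℕ) (t : ℝ) : expChar (m * k) t = expChar k t ^ m := by
  rw [expChar, expChar, ← Complex.exp_nat_mul]
  congr 1
  push_cast
  ring

theorem integral_expChar (m : ℤ) :
    ∫ t in (-π)..π, expChar m t = if m = 0 then (2 * π : ℂ) else 0 := by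
  split_ifs with h
  · subst h
    simp
    ring
  · have hc : Complex.I * m ≠ 0 := by simp [h]
    have : ∀ t : ℝ, expChar m t = Complex.exp (Complex.I * m * t) := fun t => by
      rw [expChar]
      ring_nf
    simp only [this]
    rw [integral_exp_mul_complex hc]
    have : Complex.I * m * ((π : ℝ) : ℂ) = Complex.I * m * ((-π : ℝ) : ℂ) + m * (2 * π * Complex.I) := by
      push_cast
      ring
    rw [this, Complex.exp_add, Complex.exp_int_mul_two_pi_mul_I]
    simp

theorem summable_mul_expChar {ι : Type*} {c : ι → ℂ} (hc : Summable fun i => ‖c i‖) (k : ι → ℤ)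
    (t : ℝ) : Summable fun i => c i * expChar (k i) t :=
  Summable.of_norm (by simpa using hc)

theorem continuous_tsum_expChar {ι : Type*} {c : ι → ℂ} (hc : Summable fun i => ‖c i‖)
    (k : ι → ℤ) : Continuous fun t => ∑' i, c i * expChar (k i) t :=
  continuous_tsum (fun i => (continuous_const.mul (continuous_expChar _))) hc fun i t => by simp

theorem norm_tsum_expChar_le {ι : Type*} {c : ι → ℂ} (hc : Summable fun i => ‖c i‖)
    (k : ι → ℤ) (t : ℝ) : ‖∑' i, c i * expChar (k i) t‖ ≤ ∑' i, ‖c i‖ :=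
  (norm_tsum_le_tsum_norm (by simpa using hc)).trans (by simp)

/-- Termwise integration of an absolutely convergent trigonometric series against `G`. -/
theorem hasSum_integral_expChar_mul {ι : Type*} [Countable ι] {c : ι → ℂ}
    (hc : Summable fun i => ‖c i‖) (k : ι → ℤ) {G : ℝ → ℂ}
    (hG : IntervalIntegrable G volume (-π) π) :
    HasSum (fun i => c i * ∫ t in (-π)..π, expChar (k i) t * G t)
      (∫ t in (-π)..π, (∑' i, c i * expChar (k i) t) * G t) := by
  simp only [intervalIntegral.integral_of_le (neg_le_self pi_pos.le)]
  have hG' : Integrable G (volume.restrict (Set.Ioc (-π) π)) :=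
    (intervalIntegrable_iff_integrableOn_Ioc_of_le (neg_le_self pi_pos.le)).1 hG
  have h1 : ∀ i, Integrable (fun t => c i * expChar (k i) t * G t)
      (volume.restrict (Set.Ioc (-π) π)) := fun i =>
    hG'.bdd_mul (c := ‖c i‖) (continuous_const.mul (continuous_expChar _)).aestronglyMeasurable
      (Eventually.of_forall fun t => by simp)
  have h2 := hasSum_integral_of_summable_integral_norm h1 (by
    simp only [norm_mul, norm_expChar, mul_one, integral_const_mul]
    exact hc.mul_right _)
  simp only [tsum_mul_right] at h2
  simpa only [mul_assoc, integral_const_mul] using h2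

/-- The Fourier coefficients of an absolutely convergent trigonometric series. -/
theorem integral_expChar_mul_tsum {ι : Type*} [Countable ι] {c : ι → ℂ}
    (hc : Summable fun i => ‖c i‖) {k : ι → ℤ} (j : ℤ) :
    HasSum (fun i => if j + k i = 0 then 2 * π * c i else 0)
      (∫ t in (-π)..π, expChar j t * ∑' i, c i * expChar (k i) t) := by
  have h := hasSum_integral_expChar_mul hc k ((continuous_expChar j).intervalIntegrable (-π) π)
  simp only [← expChar_add, integral_expChar] at h
  simp only [mul_comm (expChar j _)]
  refine h.congr_fun fun i => ?_
  rw [add_comm (k i) j]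
  split_ifs <;> ring

/-! ### Herglotz integrals -/

theorem HasAbsSeries.hasSum_expChar {F : ℂ → ℂ} {c : ℕ → ℂ} (h : HasAbsSeries F c) (s : ℤ)
    (t : ℝ) : F (expChar s t) = ∑' k : ℕ, c k * expChar (k * s) t := by
  simp only [expChar_nat_mul]
  exact ((h.hasSum _ (norm_expChar s t).le).tsum_eq).symm

/-- With e = e^{it} the kernel is 2(1 - z/e)⁻¹ - 1, a geometric series whose constant term is
halved. -/
theorem herglotzKernel_eq {z : ℂ} (hz : ‖z‖ < 1) (t : ℝ) :
    (Complex.exp (Complex.I * t) + z) / (Complex.exp (Complex.I * t) - z) =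
      ∑' k : ℕ, ((if k = 0 then 1 else 2) * z ^ k) * expChar (-k) t := by
  set e := Complex.exp (Complex.I * t)
  have he : e = expChar 1 t := by simp [e, expChar]
  have hn : ‖e‖ = 1 := by rw [he, norm_expChar]
  have he0 : e ≠ 0 := by
    intro h
    simp [h] at hn
  have hx : ‖z / e‖ < 1 := by rwa [norm_div, hn, div_one]
  have h1 : e - z ≠ 0 := by
    intro h
    rw [sub_eq_zero.1 h] at hn
    linarith
  have hk : ∀ k : ℕ, expChar (-k) t = (e⁻¹) ^ k := by
    intro k
    have := expChar_nat_mul (-1) k t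
    rw [mul_neg_one] at this
    rw [this, he]
    congr 1
    have h2 := expChar_add (-1) 1 t
    rw [neg_add_cancel, expChar_zero] at h2
    exact eq_inv_of_mul_eq_one_left h2.symm
  have h2 : HasSum (fun k : ℕ => 2 * (z / e) ^ k - if k = 0 then 1 else 0)
      (2 * (1 - z / e)⁻¹ - 1) := by
    refine ((hasSum_geometric_of_norm_lt_one hx).mul_left 2).sub ?_
    exact hasSum_ite_eq 0 1
  have h3 : (e + z) / (e - z) = 2 * (1 - z / e)⁻¹ - 1 := by
    have : 1 - z / e = (e - z) / e := by field_simp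
    rw [this, inv_div]
    field_simp
    ring
  rw [h3, ← h2.tsum_eq]
  refine tsum_congr fun k => ?_
  rw [hk, div_pow, inv_pow]
  by_cases hk0 : k = 0
  · subst hk0
    norm_num
  · simp [hk0]
    ring

theorem summable_herglotz {z : ℂ} (hz : ‖z‖ < 1) :
    Summable fun k : ℕ => ‖(if k = 0 then 1 else 2 : ℂ) * z ^ k‖ := by
  refine Summable.of_nonneg_of_le (fun _ => norm_nonneg _) (fun k => ?_)
    ((summable_geometric_of_lt_one (norm_nonneg z) hz).mul_left 2)
  rw [norm_mul, norm_pow]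
  gcongr
  split_ifs <;> simp

/-- The Herglotz integral of the real part of an absolutely convergent power series. -/
theorem integral_herglotz {F : ℂ → ℂ} {c : ℕ → ℂ} (hF : HasAbsSeries F c) (h0 : (F 0).im = 0)
    {z : ℂ} (hz : ‖z‖ < 1) :
    ∫ t in (-π)..π, (Complex.exp (Complex.I * t) + z) / (Complex.exp (Complex.I * t) - z) *
      ((F (expChar 1 t)).re : ℂ) = 2 * π * F z := by
  have hcont : Continuous fun t : ℝ => F (expChar 1 t) :=
    hF.continuousOn.comp_continuous (continuous_expChar 1) fun t => by simp
  have hre : Continuous fun t : ℝ => ((F (expChar 1 t)).re : ℂ) :=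
    Complex.continuous_ofReal.comp (Complex.continuous_re.comp hcont)
  have hc0 : c 0 = F 0 := by
    have h1 := hF.hasSum 0 (by simp)
    have h2 := hasSum_single (f := fun k => c k * (0 : ℂ) ^ k) 0 (fun k hk => by simp [hk])
    simpa using h2.unique h1
  -- Re F is the average of F and its conjugate, so its j-th Fourier coefficient is c_j/2 for j > 0
  -- and c_0 for j = 0 because F(0) is real. The weights 2 and 1 of the kernel then restore F.
  have hcoef : ∀ j : ℕ, ∫ t in (-π)..π, expChar (-j) t * ((F (expChar 1 t)).re : ℂ) =
      if j = 0 then 2 * π * c 0 else π * c j := by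
    intro j
    have e1 : ∫ t in (-π)..π, expChar (-j) t * F (expChar 1 t) = 2 * π * c j := by
      simp only [hF.hasSum_expChar]
      refine (integral_expChar_mul_tsum hF.summable (-j : ℤ)).unique ?_
      have := hasSum_single (f := fun i : ℕ => if -(j : ℤ) + (i : ℤ) * 1 = 0 then 2 * π * c i else 0) j
        (fun i hi => by rw [if_neg]; omega)
      simpa using this
    have e2 : ∫ t in (-π)..π, expChar (-j) t * (starRingEnd ℂ) (F (expChar 1 t)) =
        if j = 0 then 2 * π * c 0 else 0 := by
      have hcj : ∀ t, (starRingEnd ℂ) (F (expChar 1 t)) =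
          ∑' k : ℕ, (starRingEnd ℂ) (c k) * expChar (-k) t := by
        intro t
        rw [hF.hasSum_expChar, Complex.conj_tsum]
        refine tsum_congr fun k => ?_
        rw [map_mul, mul_one, ← expChar_neg]
      simp only [hcj]
      have hs : Summable fun k => ‖(starRingEnd ℂ) (c k)‖ := by
        simpa only [RCLike.norm_conj] using hF.summable
      refine (integral_expChar_mul_tsum hs (-j : ℤ)).unique ?_
      split_ifs with hj
      · subst hj
        have hr : (starRingEnd ℂ) (c 0) = c 0 := by
          rw [hc0]
          exact Complex.conj_eq_iff_im.2 h0
        have := hasSum_single (f := fun i : ℕ => if -((0 : ℕ) : ℤ) + -(i : ℤ) = 0 then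
          2 * π * (starRingEnd ℂ) (c i) else 0) 0 (fun i hi => by rw [if_neg]; omega)
        simpa [hr] using this
      · convert hasSum_zero using 2 with i
        rw [if_neg]
        omega
    have hi1 : IntervalIntegrable (fun t => expChar (-j) t * F (expChar 1 t)) volume (-π) π :=
      ((continuous_expChar _).mul hcont).intervalIntegrable _ _
    have hi2 : IntervalIntegrable (fun t => expChar (-j) t * (starRingEnd ℂ) (F (expChar 1 t)))
        volume (-π) π :=
      ((continuous_expChar _).mul (Complex.continuous_conj.comp hcont)).intervalIntegrable _ _
    have e3 : ∀ t, expChar (-j) t * ((F (expChar 1 t)).re : ℂ) = 1 / 2 *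
        (expChar (-j) t * F (expChar 1 t) + expChar (-j) t * (starRingEnd ℂ) (F (expChar 1 t))) := by
      intro t
      rw [Complex.re_eq_add_conj]
      ring
    simp only [e3]
    rw [intervalIntegral.integral_const_mul, intervalIntegral.integral_add hi1 hi2, e1, e2]
    split_ifs with hj
    · subst hj
      ring
    · ring
  have h := hasSum_integral_expChar_mul (summable_herglotz hz) (fun k => -(k : ℤ))
    (hre.intervalIntegrable (-π) π)
  simp only [herglotzKernel_eq hz]
  refine h.unique ?_
  refine ((hF.hasSum z hz.le).mul_left (2 * π : ℂ)).congr_fun fun k => ?_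
  rw [hcoef]
  split_ifs with hk
  · subst hk
    simp
  · ring

/-! ### The Herglotz integral of `log |1 - e^{iμt}|` -/

/-- |1-w| ≤ |1-rw| + (1-r), and 1-r ≤ |1-rw| on |w| = 1. Being uniform in r, the bound controls both
the logarithms and the regularized estimates as r → 1. -/
theorem norm_one_sub_mul_expChar_le {r : ℝ} (hr0 : 0 ≤ r) (hr1 : r ≤ 1) (m : ℤ) (t : ℝ) :
    ‖1 - expChar m t‖ ≤ 2 * ‖1 - r * expChar m t‖ := by
  have h1 : 1 - r ≤ ‖1 - r * expChar m t‖ := by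
    have := norm_sub_norm_le (1 : ℂ) (r * expChar m t)
    simpa [abs_of_nonneg hr0] using this
  have h2 : ‖1 - expChar m t‖ ≤ ‖1 - r * expChar m t‖ + (1 - r) := by
    have e : 1 - expChar m t = (1 - r * expChar m t) + -((1 - r : ℝ) : ℂ) * expChar m t := by
      push_cast
      ring
    rw [e]
    refine (norm_add_le _ _).trans ?_
    rw [norm_mul, norm_neg, Complex.norm_real, norm_expChar, Real.norm_of_nonneg (by linarith), mul_one]
  linarith

theorem countable_expChar_eq_one {m : ℤ} (hm : m ≠ 0) : {t : ℝ | expChar m t = 1}.Countable := by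
  refine (Set.countable_range fun k : ℤ => (2 * π * k / m : ℝ)).mono fun t ht => ?_
  have ht' : Complex.exp (Complex.I * t * m) = 1 := ht
  obtain ⟨k, hk⟩ := Complex.exp_eq_one_iff.1 ht'
  refine ⟨k, ?_⟩
  have h : ((t * m : ℝ) : ℂ) = ((2 * π * k : ℝ) : ℂ) := by
    push_cast
    apply mul_left_cancel₀ Complex.I_ne_zero
    linear_combination hk
  have h' : t * m = 2 * π * k := by exact_mod_cast h
  have hm' : (m : ℝ) ≠ 0 := by exact_mod_cast hm
  simp only
  rw [← h']
  field_simp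

theorem ae_expChar_ne_one {m : ℤ} (hm : m ≠ 0) : ∀ᵐ t : ℝ, expChar m t ≠ 1 :=
  (countable_expChar_eq_one hm).ae_notMem volume

theorem intervalIntegrable_log_norm_one_sub_expChar (m : ℤ) :
    IntervalIntegrable (fun t => Real.log ‖1 - expChar m t‖) volume (-π) π := by
  refine MeromorphicOn.intervalIntegrable_log_norm (f := fun t : ℝ => 1 - expChar m t) ?_
  intro t _
  refine AnalyticAt.meromorphicAt ?_
  unfold expChar
  have h1 : AnalyticAt ℝ (fun t : ℝ => (t : ℂ)) t := Complex.ofRealCLM.analyticAt t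
  have h2 : AnalyticAt ℝ (fun t : ℝ => Complex.I * (t : ℂ) * m) t := by fun_prop
  exact analyticAt_const.sub ((analyticAt_cexp.restrictScalars (𝕜 := ℝ)).fun_comp h2)

theorem abs_log_norm_one_sub_le {r : ℝ} (hr0 : 0 ≤ r) (hr1 : r ≤ 1) {m : ℤ} {t : ℝ}
    (ht : expChar m t ≠ 1) :
    |Real.log ‖1 - r * expChar m t‖| ≤ Real.log 2 + |Real.log ‖1 - expChar m t‖| := by
  have h0 : 0 < ‖1 - expChar m t‖ := norm_pos_iff.2 (sub_ne_zero.2 ht.symm)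
  have h1 := norm_one_sub_mul_expChar_le hr0 hr1 m t
  have h2 : 0 < ‖1 - r * expChar m t‖ := by linarith
  have h3 : ‖1 - r * expChar m t‖ ≤ 2 := by
    refine (norm_sub_le _ _).trans ?_
    simp [abs_of_nonneg hr0]
    linarith
  have h4 := Real.log_le_log h2 h3
  have h5 := Real.log_le_log h0 h1
  rw [Real.log_mul (by norm_num) h2.ne'] at h5
  have h6 := neg_abs_le (Real.log ‖1 - expChar m t‖)
  have h7 := abs_nonneg (Real.log ‖1 - expChar m t‖)
  rw [abs_le]
  constructor <;> linarith

theorem norm_herglotzKernel_le {z : ℂ} (hz : ‖z‖ < 1) (t : ℝ) :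
    ‖(Complex.exp (Complex.I * t) + z) / (Complex.exp (Complex.I * t) - z)‖ ≤ 2 / (1 - ‖z‖) := by
  have hn : ‖Complex.exp (Complex.I * t)‖ = 1 := by
    rw [mul_comm, Complex.norm_exp_ofReal_mul_I]
  rw [norm_div]
  have h1 := norm_add_le (Complex.exp (Complex.I * t)) z
  have h2 := norm_sub_norm_le (Complex.exp (Complex.I * t)) z
  rw [hn] at h1 h2
  have h3 : 0 < 1 - ‖z‖ := by linarith
  gcongr
  linarith

theorem continuous_herglotzKernel {z : ℂ} (hz : ‖z‖ < 1) :
    Continuous fun t : ℝ =>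
      (Complex.exp (Complex.I * t) + z) / (Complex.exp (Complex.I * t) - z) := by
  refine Continuous.div (by fun_prop) (by fun_prop) fun t h => ?_
  have hn : ‖Complex.exp (Complex.I * t)‖ = 1 := by
    rw [mul_comm, Complex.norm_exp_ofReal_mul_I]
  rw [sub_eq_zero.1 h] at hn
  linarith

/-- For r < 1 the function log(1 - r z^m) belongs to the algebra and is real at 0, so
`integral_herglotz` applies to it. -/
theorem integral_herglotz_log_one_sub_mul {m : ℕ} {r : ℝ} (hm : m ≠ 0) (hr0 : 0 ≤ r) (hr1 : r < 1)
    {z : ℂ} (hz : ‖z‖ < 1) :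
    ∫ t in (-π)..π, (Complex.exp (Complex.I * t) + z) / (Complex.exp (Complex.I * t) - z) *
      (Real.log ‖1 - r * expChar m t‖ : ℂ) = 2 * π * Complex.log (1 - r * z ^ m) := by
  have hX := (HasAbsSeries.X_pow m).const_mul (r : ℂ)
  have hnorm : ∑' k, ‖(r : ℂ) * (if k = m then 1 else 0)‖ = r := by
    rw [tsum_eq_single m fun k hk => by simp [hk]]
    simp [abs_of_nonneg hr0]
  have hlt : ∀ w : ℂ, ‖w‖ ≤ 1 → ‖(r : ℂ) * w ^ m‖ < 1 := by
    intro w hw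
    rw [norm_mul, norm_pow, Complex.norm_real, Real.norm_of_nonneg hr0]
    exact lt_of_le_of_lt (mul_le_of_le_one_right hr0 (pow_le_one₀ (norm_nonneg _) hw)) hr1
  obtain ⟨e, he⟩ := hX.exists_comp (g := fun w => Complex.log (1 - w))
    (a := fun j => -(1 / (j : ℂ))) (fun w hw => by
      refine ((Complex.hasSum_taylorSeries_neg_log (hlt w hw)).neg.congr_fun fun j => by ring).trans ?_
      simp) (by
      rw [hnorm]
      refine Summable.of_nonneg_of_le (fun _ => by positivity) (fun j => ?_)
        (summable_geometric_of_lt_one hr0 hr1)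
      refine mul_le_of_le_one_left (by positivity) ?_
      rw [norm_neg, norm_div, norm_one, Complex.norm_natCast]
      rcases Nat.eq_zero_or_pos j with h | h
      · simp [h]
      · rw [div_le_one (by exact_mod_cast h)]
        exact_mod_cast h)
  have := integral_herglotz he (by simp [hm]) hz
  rw [← this]
  refine intervalIntegral.integral_congr fun t _ => ?_
  congr 2
  rw [Complex.log_re]
  congr 3
  have := expChar_nat_mul 1 m t
  rw [mul_one] at this
  rw [this]

/-- Dominated convergence r → 1; the principal logarithm is continuous at the limit because Re(1 -
z^m) > 0. -/
theorem integral_herglotz_log_one_sub {m : ℕ} (hm : m ≠ 0) {z : ℂ} (hz : ‖z‖ < 1) :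
    ∫ t in (-π)..π, (Complex.exp (Complex.I * t) + z) / (Complex.exp (Complex.I * t) - z) *
      (Real.log ‖1 - expChar m t‖ : ℂ) = 2 * π * Complex.log (1 - z ^ m) := by
  have hm' : (m : ℤ) ≠ 0 := by exact_mod_cast hm
  set r : ℕ → ℝ := fun k => 1 - 1 / ((k : ℝ) + 1)
  have hr0 : ∀ k, 0 ≤ r k := fun k => by
    have : 1 / ((k : ℝ) + 1) ≤ 1 := by
      rw [div_le_one (by positivity)]
      linarith [(Nat.cast_nonneg k : (0 : ℝ) ≤ k)]
    simp only [r]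
    linarith
  have hr1 : ∀ k, r k < 1 := fun k => by
    have : 0 < 1 / ((k : ℝ) + 1) := by positivity
    simp only [r]
    linarith
  have hr : Tendsto r atTop (𝓝 1) := by
    simpa [r] using tendsto_one_div_add_atTop_nhds_zero_nat.const_sub (1 : ℝ)
  have hrC : Tendsto (fun k => (r k : ℂ)) atTop (𝓝 1) := by
    simpa [Function.comp_def] using (Complex.continuous_ofReal.tendsto 1).comp hr
  have hae := ae_expChar_ne_one hm'
  have hL : Tendsto (fun k => ∫ t in (-π)..π,
      (Complex.exp (Complex.I * t) + z) / (Complex.exp (Complex.I * t) - z) *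
        (Real.log ‖1 - r k * expChar m t‖ : ℂ)) atTop (𝓝 (∫ t in (-π)..π,
      (Complex.exp (Complex.I * t) + z) / (Complex.exp (Complex.I * t) - z) *
        (Real.log ‖1 - expChar m t‖ : ℂ))) := by
    refine intervalIntegral.tendsto_integral_filter_of_dominated_convergence
      (fun t => 2 / (1 - ‖z‖) * (Real.log 2 + |Real.log ‖1 - expChar m t‖|)) ?_ ?_ ?_ ?_
    · refine Eventually.of_forall fun k => Measurable.aestronglyMeasurable ?_
      refine (continuous_herglotzKernel hz).measurable.mul (Complex.measurable_ofReal.comp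
        (Real.measurable_log.comp ?_))
      exact (continuous_const.sub (continuous_const.mul (continuous_expChar m))).norm.measurable
    · refine Eventually.of_forall fun k => ?_
      filter_upwards [hae] with t ht _
      rw [norm_mul, Complex.norm_real, Real.norm_eq_abs]
      exact mul_le_mul (norm_herglotzKernel_le hz t)
        (abs_log_norm_one_sub_le (hr0 k) (hr1 k).le ht) (abs_nonneg _)
        (div_nonneg zero_le_two (by linarith))
    · exact ((intervalIntegrable_const).add
        (intervalIntegrable_log_norm_one_sub_expChar m).abs).const_mul _
    · filter_upwards [hae] with t ht _
      refine Tendsto.const_mul _ ((Complex.continuous_ofReal.tendsto _).comp ?_)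
      refine Tendsto.log ?_ (norm_ne_zero_iff.2 (sub_ne_zero.2 ht.symm))
      simpa using (tendsto_const_nhds.sub (hrC.mul_const (expChar m t))).norm
  refine tendsto_nhds_unique hL ?_
  simp only [fun k => integral_herglotz_log_one_sub_mul hm (hr0 k) (hr1 k) hz]
  refine Tendsto.const_mul _ ?_
  have hz' : ‖z ^ m‖ < 1 := by
    rw [norm_pow]
    exact pow_lt_one₀ (norm_nonneg _) hz hm
  have hs : 1 - z ^ m ∈ Complex.slitPlane := by
    refine Or.inl ?_
    have := (Complex.abs_re_le_norm (z ^ m)).trans_lt hz'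
    rw [Complex.sub_re, Complex.one_re]
    linarith [le_abs_self (z ^ m).re]
  refine (continuousAt_clog hs).tendsto.comp ?_
  simpa using tendsto_const_nhds.sub (hrC.mul_const (z ^ m))

/-! ### The function `-log sinc (t/2)` -/

theorem sinc_half_pos {t : ℝ} (ht : t ∈ Set.Icc (-π) π) : 0 < Real.sinc (t / 2) := by
  rcases lt_trichotomy t 0 with h | h | h
  · rw [← Real.sinc_neg, Real.sinc_of_ne_zero (by linarith)]
    exact div_pos (Real.sin_pos_of_pos_of_lt_pi (by linarith) (by linarith [ht.1, pi_pos])) (by linarith)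
  · simp [h]
  · rw [Real.sinc_of_ne_zero (by linarith)]
    exact div_pos (Real.sin_pos_of_pos_of_lt_pi (by linarith) (by linarith [ht.2, pi_pos])) (by linarith)

theorem analyticAt_sinc (x : ℝ) : AnalyticAt ℝ Real.sinc x := by
  by_cases hx : x = 0
  · subst hx
    obtain ⟨p, hp⟩ := (analyticAt_sin : AnalyticAt ℝ Real.sin 0)
    rw [Real.sinc_eq_dslope]
    exact (hp.has_fpower_series_dslope_fslope).analyticAt
  · have h : AnalyticAt ℝ (fun y => Real.sin y / y) x := analyticAt_sin.div analyticAt_id hx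
    refine h.congr ?_
    filter_upwards [isOpen_ne.mem_nhds hx] with y hy
    rw [Real.sinc_of_ne_zero hy]

/-- Splits the zero |t| off |1 - e^{it}|, leaving a smooth positive factor. It turns the weight into
|1-e^{iμt}|/|1-e^{it}| times a power of sinc. -/
theorem norm_one_sub_expChar_one {t : ℝ} (ht : t ∈ Set.Icc (-π) π) :
    ‖1 - expChar 1 t‖ = |t| * Real.sinc (t / 2) := by
  have h1 : ‖1 - expChar 1 t‖ = 2 * |Real.sin (t / 2)| := by
    have : expChar 1 t = Complex.exp (Complex.I * t) := by simp [expChar]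
    rw [this, norm_sub_rev, Complex.norm_exp_I_mul_ofReal_sub_one, norm_mul]
    simp
  rw [h1]
  by_cases h : t = 0
  · simp [h]
  · have h2 := sinc_half_pos ht
    rw [← abs_of_pos h2, Real.sinc_of_ne_zero (by simpa using h), abs_div, abs_div]
    have : |t| ≠ 0 := abs_ne_zero.2 h
    norm_num
    field_simp

/-- The function `-log sinc (t/2) = log |t / (2 sin (t/2))|`. -/
noncomputable def logSinc (t : ℝ) : ℝ := -Real.log (Real.sinc (t / 2))

theorem contDiffAt_logSinc {t : ℝ} (ht : t ∈ Set.Icc (-π) π) : ContDiffAt ℝ 2 logSinc t := by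
  have h : ContDiffAt ℝ 2 (fun t => Real.sinc (t / 2)) t :=
    ((analyticAt_sinc (t / 2)).contDiffAt (n := 2)).comp t (contDiffAt_id.div_const 2)
  exact (h.log (sinc_half_pos ht).ne').neg

/-- Integration by parts bounds the n-th coefficient of f by a multiple of that of f' divided by
|n|; since xy ≤ x² + y², Parseval for f' and the convergence of ∑ 1/n² suffice. -/
theorem summable_fourierCoeffOn {a b : ℝ} (hab : a < b) {f f' : ℝ → ℂ}
    (hf : ∀ x ∈ Set.Icc a b, HasDerivAt f (f' x) x) (hf' : ContinuousOn f' (Set.Icc a b))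
    (hfab : f a = f b) : Summable fun n => ‖fourierCoeffOn hab f n‖ := by
  have hint : IntervalIntegrable f' volume a b := by
    refine ContinuousOn.intervalIntegrable ?_
    rwa [Set.uIcc_of_le hab.le]
  have hL2 : MemLp f' 2 (volume.restrict (Set.Ioc a b)) := by
    obtain ⟨C, hC⟩ := isCompact_Icc.exists_bound_of_continuousOn hf'
    refine MemLp.of_bound hint.1.aestronglyMeasurable C ?_
    filter_upwards [ae_restrict_mem measurableSet_Ioc] with x hx
    exact hC x (Set.Ioc_subset_Icc_self hx)
  have hsq := (hasSum_sq_fourierCoeffOn hab hL2).summable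
  have hinv : Summable fun n : ℤ => ((n : ℝ) ^ 2)⁻¹ := by
    have := Real.summable_one_div_int_pow (p := 2)
    simpa using this.2 (by norm_num)
  refine Summable.of_norm_bounded_eventually (g := fun n : ℤ =>
    (b - a) * (‖fourierCoeffOn hab f' n‖ ^ 2 + ((n : ℝ) ^ 2)⁻¹)) ((hsq.add hinv).mul_left _) ?_
  filter_upwards [(Set.finite_singleton (0 : ℤ)).compl_mem_cofinite] with n hn
  have hn0 : n ≠ 0 := by simpa using hn
  rw [fourierCoeffOn_of_hasDerivAt hab hn0 (fun x hx => hf x (by rwa [Set.uIcc_of_le hab.le] at hx)) hint,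
    hfab, sub_self, mul_zero, zero_sub, norm_norm, norm_mul, norm_neg, norm_mul, norm_div]
  have h1 : ‖((b : ℂ) - a)‖ = b - a := by
    rw [← Complex.ofReal_sub, Complex.norm_real, Real.norm_of_nonneg (by linarith)]
  have hn' : (1 : ℝ) ≤ |(n : ℝ)| := by exact_mod_cast Int.one_le_abs hn0
  have h2 : ‖(1 : ℂ)‖ / ‖-2 * (π : ℂ) * Complex.I * n‖ ≤ |(n : ℝ)|⁻¹ := by
    simp only [norm_mul, norm_neg, norm_one, Complex.norm_I, Complex.norm_intCast, Complex.norm_real,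
      Real.norm_of_nonneg pi_pos.le, one_div]
    refine inv_anti₀ (by linarith) ?_
    norm_num
    nlinarith [pi_gt_three, mul_le_mul_of_nonneg_left pi_gt_three.le (abs_nonneg (n : ℝ))]
  rw [h1]
  have h3 : |(n : ℝ)|⁻¹ ^ 2 = ((n : ℝ) ^ 2)⁻¹ := by rw [inv_pow, sq_abs]
  rw [← h3]
  set x := ‖fourierCoeffOn hab f' n‖
  set y := |(n : ℝ)|⁻¹
  have hx : 0 ≤ x := norm_nonneg _
  have hy : 0 ≤ y := by positivity
  have hba : 0 < b - a := by linarith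
  calc _ ≤ y * ((b - a) * x) := by gcongr
    _ = (b - a) * (x * y) := by ring
    _ ≤ _ := by
      refine mul_le_mul_of_nonneg_left ?_ hba.le
      nlinarith [sq_nonneg (x - y)]

theorem AddCircle.fourierCoeff_neg_of_real {T : ℝ} [Fact (0 < T)] {f : AddCircle T → ℂ}
    (hf : ∀ x, (starRingEnd ℂ) (f x) = f x) (n : ℤ) :
    fourierCoeff f (-n) = (starRingEnd ℂ) (fourierCoeff f n) := by
  unfold fourierCoeff
  rw [← integral_conj]
  refine integral_congr_ae (Eventually.of_forall fun x => ?_)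
  simp only [smul_eq_mul, map_mul, hf]
  rw [fourier_neg (n := -n)]

theorem expChar_neg_one (t : ℝ) : expChar (-1) t = expChar 1 (-t) := by
  simp [expChar]

theorem logSinc_neg (t : ℝ) : logSinc (-t) = logSinc t := by
  rw [logSinc, logSinc, neg_div, Real.sinc_neg]

/-- The function `logSinc` is the real part of an absolutely convergent power series on the unit
circle. -/
theorem exists_hasAbsSeries_logSinc : ∃ (h : ℂ → ℂ) (c : ℕ → ℂ), HasAbsSeries h c ∧ (h 0).im = 0 ∧
    ∀ t ∈ Set.Icc (-π) π, (h (expChar 1 t)).re = logSinc t := by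
  have : Fact (0 < 2 * π) := ⟨by positivity⟩
  have hpi : -π + 2 * π = π := by ring
  set f : ℝ → ℂ := fun t => (logSinc t : ℂ)
  have hd : ∀ t ∈ Set.Icc (-π) (-π + 2 * π), HasDerivAt f ((deriv logSinc t : ℝ) : ℂ) t := by
    intro t ht
    rw [hpi] at ht
    exact ((contDiffAt_logSinc ht).differentiableAt (by norm_num)).hasDerivAt.ofReal_comp
  have hd' : ContinuousOn (fun t => ((deriv logSinc t : ℝ) : ℂ)) (Set.Icc (-π) (-π + 2 * π)) := by
    intro t ht
    rw [hpi] at ht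
    have h1 : ContinuousAt (deriv logSinc) t :=
      ((contDiffAt_logSinc ht).derivWithin (m := 1) (by norm_num)).continuousAt
    exact (Complex.continuous_ofReal.continuousAt.comp h1).continuousWithinAt
  -- Evenness makes the endpoint values agree; the periodic extension may have a corner at π, which
  -- the summability lemma allows.
  have hper : f (-π) = f (-π + 2 * π) := by
    simp only [f]
    rw [hpi, logSinc_neg]
  let g : C(AddCircle (2 * π), ℂ) := ⟨AddCircle.liftIco (2 * π) (-π) f,
    AddCircle.liftIco_continuous hper fun t ht => (hd t ht).continuousAt.continuousWithinAt⟩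
  have hsum : Summable fun n => ‖fourierCoeff g n‖ := by
    have := summable_fourierCoeffOn (lt_add_of_pos_right (-π) (Fact.out : 0 < 2 * π)) hd hd' hper
    refine this.congr fun n => ?_
    rw [← fourierCoeff_liftIco_eq]
    rfl
  have hpt := has_pointwise_sum_fourier_series_of_summable hsum.of_norm
  have hneg : ∀ n, fourierCoeff g (-n) = (starRingEnd ℂ) (fourierCoeff g n) := by
    refine AddCircle.fourierCoeff_neg_of_real fun x => ?_
    exact Complex.conj_ofReal _
  have hval : ∀ t ∈ Set.Ico (-π) π, g (t : AddCircle (2 * π)) = f t := by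
    intro t ht
    exact AddCircle.liftIco_coe_apply (f := f) (by rwa [hpi])
  have hfour : ∀ (n : ℤ) (t : ℝ), fourier n (t : AddCircle (2 * π)) = expChar n t := by
    intro n t
    rw [fourier_coe_apply, expChar]
    congr 1
    push_cast
    have : (π : ℂ) ≠ 0 := by exact_mod_cast pi_ne_zero
    field_simp
  -- For real g the coefficients at k and -k are conjugate, so folding them doubles every
  -- coefficient with k > 0 and yields g as a real part.
  set c : ℕ → ℂ := fun k => (if k = 0 then 1 else 2) * fourierCoeff g k
  have hcs : Summable fun k => ‖c k‖ := by
    have h1 : Summable fun k : ℕ => ‖fourierCoeff g k‖ :=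
      hsum.comp_injective Nat.cast_injective
    refine Summable.of_nonneg_of_le (fun _ => norm_nonneg _) (fun k => ?_) (h1.mul_left 2)
    simp only [c, norm_mul]
    gcongr
    split_ifs <;> simp
  have hA := HasAbsSeries.of_summable hcs
  have hIco : ∀ t ∈ Set.Ico (-π) π, (∑' k, c k * expChar 1 t ^ k).re = logSinc t := by
    intro t ht
    have h1 := hpt (t : AddCircle (2 * π))
    rw [hval t ht] at h1
    simp only [smul_eq_mul, hfour] at h1
    -- Pairing k with -k counts the zeroth coefficient twice; the extra copy is carried on both
    -- sides.
    have h2 := HasSum.nat_add_neg h1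
    have h3 : HasSum (fun k : ℕ => (c k * expChar 1 t ^ k).re +
        if k = 0 then (fourierCoeff g 0).re else 0) (logSinc t + (fourierCoeff g 0).re) := by
      have h4 := Complex.hasSum_re h2
      simp only [Complex.add_re, expChar_zero, mul_one] at h4
      refine h4.congr_fun fun k => ?_
      have h5 : expChar k t = expChar 1 t ^ k := by
        have := expChar_nat_mul 1 k t
        rwa [mul_one] at this
      rw [hneg, expChar_neg, ← map_mul, Complex.conj_re, h5]
      by_cases hk : k = 0
      · subst hk
        simp [c]
      · simp [c, hk]
        ring
    have h4 := (Complex.hasSum_re (hA.hasSum (expChar 1 t) (norm_expChar 1 t).le)).add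
      (hasSum_ite_eq 0 (fourierCoeff g 0).re)
    exact add_right_cancel (h4.unique h3)
  refine ⟨_, c, hA, ?_, fun t ht => ?_⟩
  · rw [tsum_eq_single 0 fun k hk => by simp [hk]]
    have := hneg 0
    rw [neg_zero] at this
    simpa [c] using Complex.conj_eq_iff_im.1 this.symm
  -- The endpoint π is outside the fundamental domain and is reached through -π.
  · rcases eq_or_lt_of_le ht.2 with h | h
    · have h1 : expChar 1 π = expChar 1 (-π) := by
        simp only [expChar]
        rw [Complex.exp_eq_exp_iff_exists_int]
        refine ⟨1, ?_⟩
        push_cast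
        ring
      rw [h, h1, ← logSinc_neg]
      exact hIco _ ⟨le_rfl, by linarith [pi_pos]⟩
    · exact hIco t ⟨ht.1, h⟩

/-! ### The factorization of `w_μ` -/

theorem norm_one_sub_exp_neg (μ : ℕ) (t : ℝ) :
    ‖1 - Complex.exp (-(Complex.I * t * μ))‖ = ‖1 - expChar μ t‖ := by
  have h : Complex.exp (-(Complex.I * t * μ)) = (starRingEnd ℂ) (expChar μ t) := by
    rw [← expChar_neg, expChar]
    push_cast
    congr 1
    ring
  rw [h, ← Complex.norm_conj]
  simp

theorem log_weight_eq {n μ : ℕ} {t : ℝ} (ht : t ∈ Set.Icc (-π) π)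
    (h1 : expChar 1 t ≠ 1) (hμ : expChar μ t ≠ 1) :
    Real.log (‖1 - Complex.exp (-(Complex.I * t * μ))‖ ^ (2 * n) / t ^ (2 * n)) =
      2 * n * (Real.log ‖1 - expChar μ t‖ - Real.log ‖1 - expChar 1 t‖ - logSinc t) := by
  have ht0 : t ≠ 0 := by
    rintro rfl
    simp [expChar] at h1
  have hμ0 : ‖1 - expChar μ t‖ ≠ 0 := norm_ne_zero_iff.2 (sub_ne_zero.2 hμ.symm)
  rw [norm_one_sub_exp_neg, ← div_pow, Real.log_pow, Real.log_div hμ0 ht0, norm_one_sub_expChar_one ht,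
    Real.log_mul (abs_ne_zero.2 ht0) (sinc_half_pos ht).ne', logSinc, Real.log_abs]
  push_cast
  ring

/-- On the open disc `w_μ` is the product of `(1 + z + … + z^{μ-1})^n` and of a function which has,
together with its reciprocal, an absolutely convergent power series. -/
theorem exists_wFun_factorization (n μ : ℕ) (hμ : 1 ≤ μ) :
    ∃ (E : ℂ → ℂ) (e e' : ℕ → ℂ), HasAbsSeries E e ∧ HasAbsSeries (fun z => (E z)⁻¹) e' ∧
      (∀ z, E z ≠ 0) ∧
      (∀ z : ℂ, ‖z‖ < 1 → wFun n μ z = (∑ i ∈ Finset.range μ, z ^ i) ^ n * E z) ∧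
      ∀ t ∈ Set.Icc (-π) π, t ≠ 0 →
        ‖(∑ i ∈ Finset.range μ, expChar (-1) t ^ i) ^ n * E (expChar (-1) t)‖ ^ 2 =
          ‖1 - Complex.exp (-(Complex.I * t * μ))‖ ^ (2 * n) / t ^ (2 * n) := by
  obtain ⟨h, c, hc, h0, hre⟩ := exists_hasAbsSeries_logSinc
  -- The factor E is exp(-n h) with Re h = -log sinc(t/2) on the circle; its reciprocal exp(n h)
  -- lies in the algebra as well.
  obtain ⟨e, he⟩ := (hc.const_mul (-n : ℂ)).exists_exp
  obtain ⟨e', he'⟩ := (hc.const_mul (n : ℂ)).exists_exp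
  refine ⟨_, e, e', he, he'.congr fun z _ => ?_, fun z => Complex.exp_ne_zero _, fun z hz => ?_,
    fun t ht ht0 => ?_⟩
  · rw [← Complex.exp_neg]
    ring_nf
  · have hcont : Continuous fun t : ℝ => h (expChar 1 t) :=
      hc.continuousOn.comp_continuous (continuous_expChar 1) fun t => by simp
    set K : ℝ → ℂ := fun t => (Complex.exp (Complex.I * t) + z) / (Complex.exp (Complex.I * t) - z)
    have hK : Continuous K := continuous_herglotzKernel hz
    have hlog : ∀ m : ℤ, IntervalIntegrable (fun t => K t * (Real.log ‖1 - expChar m t‖ : ℂ))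
        volume (-π) π := fun m =>
      IntervalIntegrable.continuousOn_mul (f := fun t => (Real.log ‖1 - expChar m t‖ : ℂ))
        ⟨(intervalIntegrable_log_norm_one_sub_expChar m).1.ofReal,
          (intervalIntegrable_log_norm_one_sub_expChar m).2.ofReal⟩
        hK.continuousOn
    have hsin : IntervalIntegrable (fun t => K t * ((h (expChar 1 t)).re : ℂ)) volume (-π) π :=
      (hK.mul (Complex.continuous_ofReal.comp
        (Complex.continuous_re.comp hcont))).intervalIntegrable _ _
    have e1 : ∫ t in (-π)..π, K t *
        (Real.log (‖1 - Complex.exp (-(Complex.I * t * μ))‖ ^ (2 * n) / t ^ (2 * n)) : ℂ) =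
        ∫ t in (-π)..π, (2 * n : ℂ) * (K t * (Real.log ‖1 - expChar μ t‖ : ℂ) -
          K t * (Real.log ‖1 - expChar 1 t‖ : ℂ) - K t * ((h (expChar 1 t)).re : ℂ)) := by
      refine intervalIntegral.integral_congr_ae ?_
      have hμ' : (μ : ℤ) ≠ 0 := by exact_mod_cast (by omega : μ ≠ 0)
      filter_upwards [ae_expChar_ne_one one_ne_zero, ae_expChar_ne_one hμ'] with t h1 h2 ht
      rw [Set.uIoc_of_le (neg_le_self pi_pos.le)] at ht
      have ht' := Set.Ioc_subset_Icc_self ht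
      rw [log_weight_eq ht' h1 h2, hre t ht']
      push_cast
      ring
    have hL1 := integral_herglotz_log_one_sub one_ne_zero hz
    have hLμ := integral_herglotz_log_one_sub (by omega : μ ≠ 0) hz
    have hH := integral_herglotz hc h0 hz
    rw [Nat.cast_one] at hL1
    have hz1 : 1 - z ≠ 0 := by
      intro h
      rw [← sub_eq_zero.1 h] at hz
      simp at hz
    have hzμ : 1 - z ^ μ ≠ 0 := by
      intro h
      have : ‖z ^ μ‖ < 1 := by
        rw [norm_pow]
        exact pow_lt_one₀ (norm_nonneg _) hz (by omega)
      rw [← sub_eq_zero.1 h] at this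
      simp at this
    have hq : ∑ i ∈ Finset.range μ, z ^ i = (1 - z ^ μ) / (1 - z) := by
      rw [geom_sum_eq (fun h => hz1 (by rw [h, sub_self])), ← neg_sub, ← neg_sub (1 : ℂ) z, neg_div_neg_eq]
    -- Since n is an integer, exponentiating n times a logarithm gives an exact n-th power, whatever
    -- the branch.
    have e2 : wFun n μ z = Complex.exp ((n : ℂ) * (Complex.log (1 - z ^ μ) - Complex.log (1 - z) - h z)) := by
      unfold wFun
      congr 1
      change 1 / (4 * (π : ℂ)) * ∫ t in (-π)..π, K t * _ = _
      rw [e1, intervalIntegral.integral_const_mul, intervalIntegral.integral_sub ((hlog _).sub (hlog _)) hsin,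
        intervalIntegral.integral_sub (hlog _) (hlog _), hLμ, hL1, hH, pow_one]
      have : (π : ℂ) ≠ 0 := by exact_mod_cast pi_ne_zero
      field_simp
      ring
    rw [e2, hq, mul_sub, mul_sub, Complex.exp_sub, Complex.exp_sub, Complex.exp_nat_mul, Complex.exp_nat_mul,
      Complex.exp_log hz1, Complex.exp_log hzμ, div_pow, neg_mul, Complex.exp_neg]
    rfl
  · set z := expChar (-1) t
    have hz : z = expChar 1 (-t) := expChar_neg_one t
    have ht' : -t ∈ Set.Icc (-π) π := ⟨by linarith [ht.2], by linarith [ht.1]⟩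
    have hsc := sinc_half_pos ht
    have hre' : (h z).re = -Real.log (Real.sinc (t / 2)) := by
      rw [hz, hre _ ht', logSinc_neg, logSinc]
    have hnz : ‖1 - z‖ = |t| * Real.sinc (t / 2) := by
      rw [hz, norm_one_sub_expChar_one ht', neg_div, Real.sinc_neg, abs_neg]
    have hpos : 0 < ‖1 - z‖ := by
      rw [hnz]
      exact mul_pos (abs_pos.2 ht0) hsc
    have hz1 : z ≠ 1 := fun h => by simp [h] at hpos
    -- On the circle E contributes sinc(t/2)^n, which cancels the sinc factor of |1 - z|^n and
    -- leaves |t|^n in the denominator.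
    have hE : ‖Complex.exp (-n * h z)‖ = Real.sinc (t / 2) ^ n := by
      rw [Complex.norm_exp]
      have : (-n * h z).re = n * Real.log (Real.sinc (t / 2)) := by
        simp [hre']
      rw [this, Real.exp_nat_mul, Real.exp_log hsc]
    have hzμ : ‖1 - z ^ μ‖ = ‖1 - Complex.exp (-(Complex.I * t * μ))‖ := by
      congr 2
      simp only [z]
      rw [← expChar_nat_mul, expChar]
      congr 1
      push_cast
      ring
    have h2 : t ^ (2 * n) = |t| ^ (2 * n) := by
      rw [pow_mul, pow_mul, sq_abs]
    rw [norm_mul, hE, norm_pow, geom_sum_eq hz1, norm_div, norm_sub_rev, norm_sub_rev z, hzμ, hnz, h2]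
    rw [← mul_pow, ← pow_mul, mul_comm n 2, ← div_pow, div_mul_eq_mul_div, mul_div_mul_right _ _ hsc.ne']

/-! ### Sequences with a spectral density in a Hilbert space -/

section Hilbert

variable {H : Type*} [NormedAddCommGroup H] [InnerProductSpace ℂ H] [CompleteSpace H]

/-- The spectral isometry on absolutely summable combinations. -/
theorem norm_tsum_smul_sq {η : ℤ → H} {v : ℝ → ℝ} (hv : IntervalIntegrable v volume (-π) π)
    (hη : ∀ k m, inner ℂ (η k) (η m) = 1 / (2 * π) * ∫ t in (-π)..π, expChar (m - k) t * (v t : ℂ))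
    {c : ℤ → ℂ} (hc : Summable fun k => ‖c k‖) :
    (Summable fun k => c k • η k) ∧
      ‖∑' k, c k • η k‖ ^ 2 =
        1 / (2 * π) * ∫ t in (-π)..π, ‖∑' k, c k * expChar k t‖ ^ 2 * v t := by
  have hvC : IntervalIntegrable (fun t => (v t : ℂ)) volume (-π) π := ⟨hv.1.ofReal, hv.2.ofReal⟩
  have hnorm : ∀ k, ‖η k‖ = ‖η 0‖ := by
    intro k
    have h : inner ℂ (η k) (η k) = inner ℂ (η 0) (η 0) := by rw [hη, hη, sub_self, sub_self]
    rw [inner_self_eq_norm_sq_to_K, inner_self_eq_norm_sq_to_K] at h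
    have h' : ‖η k‖ ^ 2 = ‖η 0‖ ^ 2 := by exact_mod_cast h
    exact (sq_eq_sq₀ (norm_nonneg _) (norm_nonneg _)).1 h'
  have hs : Summable fun k => c k • η k := by
    refine Summable.of_norm ?_
    simp only [norm_smul, hnorm]
    exact hc.mul_right _
  refine ⟨hs, ?_⟩
  set X := ∑' k, c k • η k
  set C : ℝ → ℂ := fun t => ∑' k, c k * expChar k t
  have hC : Continuous C := continuous_tsum_expChar hc _
  have hCconj : ∀ t, (starRingEnd ℂ) (C t) = ∑' k, (starRingEnd ℂ) (c k) * expChar (-k) t := by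
    intro t
    simp only [C]
    rw [Complex.conj_tsum]
    exact tsum_congr fun k => by rw [map_mul, expChar_neg]
  have hc' : Summable fun k => ‖(starRingEnd ℂ) (c k)‖ := by simpa only [RCLike.norm_conj] using hc
  have h1 : ∀ m, inner ℂ X (η m) =
      1 / (2 * π) * ∫ t in (-π)..π, expChar m t * ((starRingEnd ℂ) (C t) * v t) := by
    intro m
    have e1 : HasSum (fun k => (starRingEnd ℂ) (c k) * inner ℂ (η k) (η m)) (inner ℂ X (η m)) := by
      have := (hs.hasSum.mapL (innerSL ℂ (η m))).map (starRingEnd ℂ) Complex.continuous_conj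
      simp only [innerSL_apply_apply, inner_conj_symm] at this
      refine this.congr_fun fun k => ?_
      simp only [Function.comp, inner_conj_symm, inner_smul_left]
    have e2 := (hasSum_integral_expChar_mul hc' (fun k => -k)
      (G := fun t => expChar m t * (v t : ℂ))
      (hvC.continuousOn_mul (continuous_expChar m).continuousOn)).mul_left (1 / (2 * π : ℂ))
    refine (e1.unique (e2.congr_fun fun k => ?_)).trans ?_
    · rw [hη]
      simp only [← mul_assoc, ← expChar_add]
      rw [neg_add_eq_sub]
      ring
    · congr 1
      refine intervalIntegral.integral_congr fun t _ => ?_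
      rw [hCconj]
      ring
  have h2 := hs.hasSum.mapL (innerSL ℂ X)
  simp only [innerSL_apply_apply, inner_smul_right, h1] at h2
  have hG : IntervalIntegrable (fun t => (starRingEnd ℂ) (C t) * (v t : ℂ)) volume (-π) π :=
    hvC.continuousOn_mul (Complex.continuous_conj.comp hC).continuousOn
  have h3 := (hasSum_integral_expChar_mul hc (fun k => k) hG).mul_left (1 / (2 * π : ℂ))
  have h4 := h2.unique (h3.congr_fun fun k => by ring)
  change inner ℂ X X = _ at h4
  rw [inner_self_eq_norm_sq_to_K] at h4
  have h5 : ∫ t in (-π)..π, (∑' k, c k * expChar k t) * ((starRingEnd ℂ) (C t) * v t) =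
      ((∫ t in (-π)..π, ‖C t‖ ^ 2 * v t : ℝ) : ℂ) := by
    rw [← intervalIntegral.integral_ofReal]
    refine intervalIntegral.integral_congr fun t _ => ?_
    change C t * _ = _
    rw [← mul_assoc, Complex.mul_conj, Complex.normSq_eq_norm_sq]
    push_cast
    rfl
  rw [h5] at h4
  change ‖X‖ ^ 2 = 1 / (2 * π) * ∫ t in (-π)..π, ‖C t‖ ^ 2 * v t
  refine Complex.ofReal_injective ?_
  push_cast
  simpa using h4

/-- The vectors `η(-1), η(-2), …` span the observed space. -/
def pastSpan (η : ℤ → H) : Submodule ℂ H :=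
  (Submodule.span ℂ (Set.range fun l : ℕ => η (-((l : ℤ) + 1)))).topologicalClosure

theorem tsum_int_eq {E : Type*} [NormedAddCommGroup E] [CompleteSpace E] {f : ℤ → E}
    (hf : Summable f) :
    (Summable fun k : ℕ => f k) ∧ (Summable fun k : ℕ => f (-((k : ℤ) + 1))) ∧
      ∑' k, f k = ∑' k : ℕ, f k + ∑' k : ℕ, f (-((k : ℤ) + 1)) := by
  have h1 : Summable fun k : ℕ => f k := hf.comp_injective Nat.cast_injective
  have h2 : Summable fun k : ℕ => f (-((k : ℤ) + 1)) :=
    hf.comp_injective fun a b h => by simpa using h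
  exact ⟨h1, h2, tsum_of_nat_of_neg_add_one h1 h2⟩

/-- The terms of negative index sum to an element of the closed past, whose negative is an
admissible approximation. -/
theorem infDist_pastSpan_le {η : ℤ → H} {b : ℕ → ℂ} {c : ℤ → ℂ} (hcb : ∀ k : ℕ, c k = b k)
    (hs : Summable fun k => c k • η k) :
    Metric.infDist (∑' k : ℕ, b k • η k) (pastSpan η : Set H) ≤ ‖∑' k, c k • η k‖ := by
  obtain ⟨-, hs2, hs3⟩ := tsum_int_eq hs
  simp only [hcb] at hs3
  rw [hs3]
  set Y := ∑' k : ℕ, c (-((k : ℤ) + 1)) • η (-((k : ℤ) + 1))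
  have hY : Y ∈ pastSpan η := by
    refine (Submodule.isClosed_topologicalClosure _).mem_of_tendsto hs2.hasSum.tendsto_sum_nat
      (Eventually.of_forall fun N => ?_)
    exact Submodule.le_topologicalClosure _ (Submodule.sum_mem _ fun k _ => Submodule.smul_mem _ _
      (Submodule.subset_span ⟨k, rfl⟩))
  have hY' : -Y ∈ (pastSpan η : Set H) := Submodule.neg_mem _ hY
  refine (Metric.infDist_le_dist_of_mem hY').trans (le_of_eq ?_)
  rw [dist_eq_norm, sub_neg_eq_add]

/-- Testing finite combinations of the past suffices: each produces a summable c extending b, and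
the bound passes to the closure by continuity of the distance. -/
theorem le_infDist_pastSpan {η : ℤ → H} {b : ℕ → ℂ} (hb : Summable fun k => ‖b k‖)
    (hη : ∀ c : ℤ → ℂ, (Summable fun k => ‖c k‖) → Summable fun k => c k • η k) {L : ℝ}
    (hL : ∀ c : ℤ → ℂ, (Summable fun k => ‖c k‖) → (∀ k : ℕ, c k = b k) →
      L ≤ ‖∑' k, c k • η k‖) :
    L ≤ Metric.infDist (∑' k : ℕ, b k • η k) (pastSpan η : Set H) := by
  have hspan : ∀ Y ∈ Submodule.span ℂ (Set.range fun l : ℕ => η (-((l : ℤ) + 1))),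
      L ≤ dist (∑' k : ℕ, b k • η k) Y := by
    intro Y hY
    rw [Finsupp.mem_span_range_iff_exists_finsupp] at hY
    obtain ⟨κ, rfl⟩ := hY
    -- The minus sign turns the distance to Y into the norm of one two-sided sum; the negative index
    -- -(l+1) corresponds to l.
    let c : ℤ → ℂ := fun k => if 0 ≤ k then b k.toNat else -κ (-k - 1).toNat
    have hc1 : ∀ k : ℕ, c k = b k := fun k => by simp [c]
    have hc2 : ∀ k : ℕ, c (-((k : ℤ) + 1)) = -κ k := fun k => by
      simp only [c]
      rw [if_neg (by omega)]
      congr 2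
      omega
    have hκ0 : ∀ l ∉ κ.support, κ l = 0 := fun l hl => Finsupp.notMem_support_iff.1 hl
    have hc : Summable fun k => ‖c k‖ := by
      refine Summable.of_nat_of_neg_add_one ?_ ?_
      · simpa only [hc1] using hb
      · simp only [hc2]
        exact summable_of_ne_finset_zero (s := κ.support) fun l hl => by rw [hκ0 l hl]; simp
    obtain ⟨-, -, hs3⟩ := tsum_int_eq (hη c hc)
    simp only [hc1, hc2] at hs3
    have h := hL c hc hc1
    have hfin : ∑' k : ℕ, -κ k • η (-((k : ℤ) + 1)) =
        ∑ k ∈ κ.support, -κ k • η (-((k : ℤ) + 1)) :=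
      tsum_eq_sum fun l hl => by rw [hκ0 l hl, neg_zero, zero_smul]
    rw [hs3, hfin] at h
    refine h.trans (le_of_eq ?_)
    rw [dist_eq_norm, sub_eq_add_neg]
    simp only [neg_smul, Finset.sum_neg_distrib, Finsupp.sum]
  refine (Metric.le_infDist ⟨0, Submodule.zero_mem _⟩).2 fun Y hY => ?_
  exact closure_minimal (fun Z hZ => hspan Z hZ)
    (isClosed_le continuous_const (continuous_const.dist continuous_id)) hY

/-- Translation invariance: the observed part Vξ drops out of the estimation problem. -/
theorem infDist_sub_image {E : Type*} [NormedAddCommGroup E] (x v : E) (S : Set E) :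
    Metric.infDist (x - v) {X | ∃ η ∈ S, X = -v + η} = Metric.infDist x S := by
  have h : {X | ∃ η ∈ S, X = -v + η} = (fun y => -v + y) '' S := by
    ext X
    exact ⟨fun ⟨η, h1, h2⟩ => ⟨η, h1, h2.symm⟩, fun ⟨η, h1, h2⟩ => ⟨η, h1, h2.symm⟩⟩
  rw [h, sub_eq_neg_add]
  exact Metric.infDist_image (Φ := fun y => -v + y) (isometry_add_left _)

end Hilbert

/-! ### The optimal error in terms of the spectral density -/

/-- The factor `|1 - e^{-iμt}|^{2n} / t^{2n}` which relates `f` to the spectral density of the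
increments with step `μ`. -/
noncomputable def incrWeight (n μ : ℕ) (t : ℝ) : ℝ :=
  ‖1 - Complex.exp (-(Complex.I * t * μ))‖ ^ (2 * n) / t ^ (2 * n)

theorem inner_increment_eq {Ω : Type} [MeasurableSpace Ω] {P : Measure Ω} {n : ℕ} {f : ℝ → ℝ}
    {ξ : ℤ → Lp ℂ 2 P} (h : HasSpectralDensity P n f ξ) (μ : ℕ) (k m : ℤ) :
    inner ℂ (increment n μ ξ k) (increment n μ ξ m) = 1 / (2 * π) *
      ∫ t in (-π)..π, expChar (m - k) t * ((incrWeight n μ t * f t : ℝ) : ℂ) := by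
  have := h.structural k (m - k) μ μ
  rw [add_sub_cancel] at this
  rw [this]
  congr 1
  refine intervalIntegral.integral_congr fun t _ => ?_
  simp only [incrWeight, expChar]
  have e1 : Complex.I * ((μ : ℤ) : ℂ) * t = Complex.I * t * μ := by
    push_cast
    ring
  rw [e1]
  have e2 : (1 - Complex.exp (-(Complex.I * t * μ))) * (1 - Complex.exp (Complex.I * t * μ)) =
      ((‖1 - Complex.exp (-(Complex.I * t * μ))‖ ^ 2 : ℝ) : ℂ) := by
    rw [← Complex.normSq_eq_norm_sq, ← Complex.mul_conj]
    congr 1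
    simp [← Complex.exp_conj]
  push_cast at e2 ⊢
  rw [pow_mul (‖_‖ : ℂ) 2 n, ← e2, mul_pow]
  ring

section Error

variable {Ω : Type} [MeasurableSpace Ω] {P : Measure Ω} {n μ : ℕ} {a : ℕ → ℂ} {f : ℝ → ℝ}
  {ξ : ℤ → Lp ℂ 2 P}

theorem setOf_increment_eq_range (n μ : ℕ) (ξ : ℤ → Lp ℂ 2 P) :
    {Y : Lp ℂ 2 P | ∃ k : ℤ, k ≤ -1 ∧ Y = increment n (μ : ℤ) ξ k} =
      Set.range fun l : ℕ => increment n (μ : ℤ) ξ (-((l : ℤ) + 1)) := by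
  ext Y
  constructor
  · rintro ⟨k, hk, rfl⟩
    refine ⟨(-k - 1).toNat, ?_⟩
    simp only
    congr 1
    omega
  · rintro ⟨l, rfl⟩
    exact ⟨_, by omega, rfl⟩

theorem optimalError_eq (n μ : ℕ) (a : ℕ → ℂ) (ξ : ℤ → Lp ℂ 2 P) :
    optimalError n μ a ξ = Metric.infDist (∑' k : ℕ, bCoeff n μ a k • increment n (μ : ℤ) ξ k)
      (pastSpan (increment n (μ : ℤ) ξ) : Set (Lp ℂ 2 P)) ^ 2 := by
  unfold optimalError pastSpan
  rw [← setOf_increment_eq_range, functionalA, linearEstimates]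
  congr 1
  exact infDist_sub_image _ _ _

/-- The error of the optimal estimate is at most the error of any linear estimate. -/
theorem optimalError_le (hξ : HasSpectralDensity P n f ξ)
    (hf : IntervalIntegrable (fun t => incrWeight n μ t * f t) volume (-π) π)
    {c : ℤ → ℂ} (hc : Summable fun k => ‖c k‖) (hcb : ∀ k : ℕ, c k = bCoeff n μ a k) :
    optimalError n μ a ξ ≤ 1 / (2 * π) *
      ∫ t in (-π)..π, ‖∑' k, c k * expChar k t‖ ^ 2 * (incrWeight n μ t * f t) := by
  obtain ⟨hs, hn⟩ := norm_tsum_smul_sq hf (inner_increment_eq hξ μ) hc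
  rw [← hn, optimalError_eq]
  exact pow_le_pow_left₀ Metric.infDist_nonneg (infDist_pastSpan_le hcb hs) 2

/-- A lower bound for the errors of all linear estimates bounds the optimal error. -/
theorem le_optimalError (hξ : HasSpectralDensity P n f ξ)
    (hf : IntervalIntegrable (fun t => incrWeight n μ t * f t) volume (-π) π)
    (hb : Summable fun k => ‖bCoeff n μ a k‖) {L : ℝ}
    (hL : ∀ c : ℤ → ℂ, (Summable fun k => ‖c k‖) → (∀ k : ℕ, c k = bCoeff n μ a k) →
      L ≤ 1 / (2 * π) *
        ∫ t in (-π)..π, ‖∑' k, c k * expChar k t‖ ^ 2 * (incrWeight n μ t * f t)) :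
    L ≤ optimalError n μ a ξ := by
  rw [optimalError_eq]
  -- Passing to square roots needs no sign condition on L, since the real square root vanishes at
  -- negative numbers.
  refine (Real.sqrt_le_left Metric.infDist_nonneg).1 ?_
  have hη : ∀ c : ℤ → ℂ, (Summable fun k => ‖c k‖) → _ := fun c hc =>
    norm_tsum_smul_sq hf (inner_increment_eq hξ μ) hc
  refine le_infDist_pastSpan hb (fun c hc => (hη c hc).1) fun c hc hcb => ?_
  rw [← Real.sqrt_sq (norm_nonneg (∑' k, c k • increment n (μ : ℤ) ξ k)), (hη c hc).2]
  exact Real.sqrt_le_sqrt (hL c hc hcb)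

end Error

/-! ### Boundary values of `w_μ` and Hankel operators -/

/-- Passage from the open disc to the circle: the series of the product converges absolutely up to
the boundary, and its coefficients are the Taylor coefficients of w_μ. -/
theorem exists_wFun_boundary (n μ : ℕ) (hμ : 1 ≤ μ) :
    ∃ (E : ℂ → ℂ) (e' : ℕ → ℂ), HasAbsSeries (fun z => (E z)⁻¹) e' ∧
      (∀ z, E z ≠ 0) ∧
      HasAbsSeries (fun z => (∑ i ∈ Finset.range μ, z ^ i) ^ n * E z) (wCoeff n μ) ∧
      ∀ t ∈ Set.Icc (-π) π, t ≠ 0 →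
        ‖(∑ i ∈ Finset.range μ, expChar (-1) t ^ i) ^ n * E (expChar (-1) t)‖ ^ 2 =
          incrWeight n μ t := by
  obtain ⟨E, e, e', hE, hE', hE0, hw, hbd⟩ := exists_wFun_factorization n μ hμ
  obtain ⟨q, hq⟩ := HasAbsSeries.exists_finset_sum (Finset.range μ)
    (F := fun i z => z ^ i) fun i _ => ⟨_, HasAbsSeries.X_pow i⟩
  obtain ⟨d, hd, -⟩ := hq.exists_pow n
  have hW := hd.mul hE
  refine ⟨E, e', hE', hE0, ?_, hbd⟩
  have : wCoeff n μ = fun j => ∑ k ∈ Finset.range (j + 1), d k * e (j - k) := by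
    ext k
    exact hW.coeff_eq_iteratedDeriv hw k
  rw [this]
  exact hW

theorem opW_hasAbsSeries {n μ : ℕ} {W : ℂ → ℂ} (hW : HasAbsSeries W (wCoeff n μ)) {Φ : ℂ → ℂ}
    {φ : ℕ → ℂ} (hφ : HasAbsSeries Φ φ) : HasAbsSeries (fun z => Φ z * W z) (opW n μ φ) := by
  have h := hφ.mul hW
  have : opW n μ φ = fun j => ∑ k ∈ Finset.range (j + 1), φ k * wCoeff n μ (j - k) := by
    ext j
    exact Finset.sum_congr rfl fun k _ => mul_comm _ _
  rwa [this]

/-- Exhibits D^μ A as the Hankel operator with symbol b_μ. -/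
theorem opDA_eq (n μ : ℕ) (a ψ : ℕ → ℂ) (k : ℕ) :
    opDA n μ a ψ k = ∑' m, ψ m * bCoeff n μ a (m + k) := by
  simp only [opDA, bCoeff, add_assoc]

/-- The splitting of `ℕ × ℕ` along the diagonal. -/
theorem bijective_diagonal_split : Function.Bijective
    (Sum.elim (fun p : ℕ × ℕ => (p.2 + p.1, p.2)) (fun p : ℕ × ℕ => (p.2, p.2 + p.1 + 1))) := by
  constructor
  · rintro (⟨a, b⟩ | ⟨a, b⟩) (⟨c, d⟩ | ⟨c, d⟩) h <;>
      simp only [Sum.elim_inl, Sum.elim_inr, Prod.mk.injEq] at h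
    · rw [show a = c by omega, show b = d by omega]
    · omega
    · omega
    · rw [show a = c by omega, show b = d by omega]
  · rintro ⟨k, m⟩
    rcases le_or_gt m k with h | h
    · exact ⟨Sum.inl (k - m, m), by simp; omega⟩
    · exact ⟨Sum.inr (m - k - 1, k), by simp; omega⟩

/-- Separates the pairs with k ≥ m from those with k < m; for a product of two series these are the
nonnegative and the negative frequencies. -/
theorem tsum_prod_diagonal_split {F : ℕ × ℕ → ℂ} (hF : Summable fun p => ‖F p‖) :
    (∑' j, ∑' m, F (m + j, m)) + ∑' l, ∑' k, F (k, k + l + 1) = ∑' p, F p := by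
  set F₁ : ℕ × ℕ → ℂ := fun p => F (p.2 + p.1, p.2)
  set F₂ : ℕ × ℕ → ℂ := fun p => F (p.2, p.2 + p.1 + 1)
  have h1 : Summable F₁ :=
    hF.of_norm.comp_injective (bijective_diagonal_split.1.comp Sum.inl_injective)
  have h2 : Summable F₂ :=
    hF.of_norm.comp_injective (bijective_diagonal_split.1.comp Sum.inr_injective)
  have h3 : HasSum (Sum.elim F₁ F₂) (∑' p, F₁ p + ∑' p, F₂ p) :=
    _root_.HasSum.sum (f := Sum.elim F₁ F₂) (a := ∑' p, F₁ p) (b := ∑' p, F₂ p) h1.hasSum h2.hasSum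
  have h4 : Sum.elim F₁ F₂ = F ∘ Equiv.ofBijective _ bijective_diagonal_split := by
    ext (p | p) <;> rfl
  rw [h4] at h3
  have h5 := (Equiv.ofBijective _ bijective_diagonal_split).hasSum_iff.1 h3
  rw [h5.tsum_eq, h1.tsum_prod, h2.tsum_prod]

/-- An injective reindexing of the absolutely summable product family stays summable, and row sums
inherit this. Injectivity holds along diagonals. -/
theorem summable_norm_diagonal {b ψ : ℕ → ℂ} (hb : Summable fun k => ‖b k‖)
    (hψ : Summable fun k => ‖ψ k‖) {u v : ℕ → ℕ → ℕ}
    (huv : Function.Injective fun p : ℕ × ℕ => (u p.1 p.2, v p.1 p.2)) :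
    Summable fun j => ‖∑' m, b (u j m) * ψ (v j m)‖ := by
  have h0 : Summable fun p : ℕ × ℕ => ‖b p.1 * ψ p.2‖ := hb.mul_norm hψ
  have h : Summable fun p : ℕ × ℕ => ‖b (u p.1 p.2) * ψ (v p.1 p.2)‖ := by
    simpa only [Function.comp_def] using h0.comp_injective huv
  have h1 : Summable fun j => ∑' m, ‖b (u j m) * ψ (v j m)‖ := h.prod
  have h2 : ∀ j, Summable fun m => ‖b (u j m) * ψ (v j m)‖ := fun j => h.prod_factor j
  exact Summable.of_nonneg_of_le (fun _ => norm_nonneg _)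
    (fun j => norm_tsum_le_tsum_norm (h2 j)) h1

theorem summable_norm_hankel {b ψ : ℕ → ℂ} (hb : Summable fun k => ‖b k‖)
    (hψ : Summable fun k => ‖ψ k‖) : Summable fun j => ‖∑' m, ψ m * b (m + j)‖ := by
  refine summable_norm_diagonal hψ hb (u := fun _ m => m) (v := fun j m => m + j) ?_
  rintro ⟨a, b⟩ ⟨c, d⟩ h
  simp only [Prod.mk.injEq] at h
  rw [show a = c by omega, show b = d by omega]

theorem summable_norm_tail {b ψ : ℕ → ℂ} (hb : Summable fun k => ‖b k‖)
    (hψ : Summable fun k => ‖ψ k‖) : Summable fun l => ‖∑' k, b k * ψ (k + l + 1)‖ := by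
  refine summable_norm_diagonal hb hψ (u := fun _ k => k) (v := fun l k => k + l + 1) ?_
  rintro ⟨a, b⟩ ⟨c, d⟩ h
  simp only [Prod.mk.injEq] at h
  rw [show a = c by omega, show b = d by omega]

/-- The product of an analytic and an antianalytic absolutely convergent series. -/
theorem tsum_mul_tsum_expChar {b ψ : ℕ → ℂ} (hb : Summable fun k => ‖b k‖)
    (hψ : Summable fun k => ‖ψ k‖) (t : ℝ) :
    (∑' k : ℕ, b k * expChar k t) * ∑' m : ℕ, ψ m * expChar (-m) t =
      ∑' j : ℕ, (∑' m, ψ m * b (m + j)) * expChar j t +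
        ∑' l : ℕ, (∑' k, b k * ψ (k + l + 1)) * expChar (-((l : ℤ) + 1)) t := by
  have h1 : Summable fun k : ℕ => ‖b k * expChar k t‖ := by simpa using hb
  have h2 : Summable fun m : ℕ => ‖ψ m * expChar (-m) t‖ := by simpa using hψ
  have h3 := tsum_prod_diagonal_split (h1.mul_norm h2)
  rw [← tsum_mul_tsum_of_summable_norm h1 h2] at h3
  refine h3.symm.trans (congrArg₂ (· + ·) ?_ ?_)
  · refine tsum_congr fun j => ?_
    rw [← tsum_mul_right]
    refine tsum_congr fun m => ?_
    have : expChar j t = expChar ((m + j : ℕ) : ℤ) t * expChar (-m) t := by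
      rw [← expChar_add]
      congr 1
      push_cast
      ring
    rw [this]
    ring
  · refine tsum_congr fun l => ?_
    rw [← tsum_mul_right]
    refine tsum_congr fun k => ?_
    have : expChar (-((l : ℤ) + 1)) t = expChar k t * expChar (-((k + l + 1 : ℕ) : ℤ)) t := by
      rw [← expChar_add]
      congr 1
      push_cast
      ring
    rw [this]
    ring

/-! ### Regularized estimates attached to a canonical factor -/

theorem HasAbsSeries.eq_tsum_expChar_neg {F : ℂ → ℂ} {c : ℕ → ℂ} (h : HasAbsSeries F c) (t : ℝ) :
    F (expChar (-1) t) = ∑' k : ℕ, c k * expChar (-k) t := by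
  rw [h.hasSum_expChar]
  simp only [mul_neg_one]

theorem HasAbsSeries.continuous_expChar {F : ℂ → ℂ} {c : ℕ → ℂ} (h : HasAbsSeries F c) (s : ℤ) :
    Continuous fun t => F (expChar s t) :=
  h.continuousOn.comp_continuous (_root_.continuous_expChar s) fun t => by simp

theorem HasAbsSeries.norm_expChar_le {F : ℂ → ℂ} {c : ℕ → ℂ} (h : HasAbsSeries F c) (s : ℤ)
    (t : ℝ) : ‖F (expChar s t)‖ ≤ ∑' k, ‖c k‖ := by
  rw [h.hasSum_expChar]
  exact norm_tsum_expChar_le h.summable _ t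

theorem ae_ne_zero_of_restrict : ∀ᵐ t : ℝ, t ≠ 0 := by
  have : (volume : Measure ℝ) {0} = 0 := by simp
  exact compl_mem_ae_iff.2 this

/-- Off t = 0, a null set, the weight agrees with the continuous function |W|², although its formula
has t^{2n} in the denominator. -/
theorem intervalIntegrable_incrWeight_mul {n μ : ℕ} (hμ : 1 ≤ μ) {f : ℝ → ℝ}
    (hf : IntervalIntegrable f volume (-π) π) :
    IntervalIntegrable (fun t => incrWeight n μ t * f t) volume (-π) π := by
  obtain ⟨E, e', -, -, hW, hbd⟩ := exists_wFun_boundary n μ hμ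
  have h : IntervalIntegrable (fun t => ‖(∑ i ∈ Finset.range μ, expChar (-1) t ^ i) ^ n *
      E (expChar (-1) t)‖ ^ 2 * f t) volume (-π) π :=
    hf.continuousOn_mul ((hW.continuous_expChar (-1)).norm.pow 2).continuousOn
  refine h.congr_ae ?_
  rw [Filter.EventuallyEq, ae_restrict_iff' measurableSet_uIoc]
  filter_upwards [ae_ne_zero_of_restrict] with t ht0 ht
  rw [Set.uIoc_of_le (neg_le_self pi_pos.le)] at ht
  rw [hbd t (Set.Ioc_subset_Icc_self ht) ht0]

/-- An extension of `b` from `ℕ` to `ℤ`. -/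
def extendInt (b κ : ℕ → ℂ) (k : ℤ) : ℂ := if 0 ≤ k then b k.toNat else κ (-k - 1).toNat

theorem extendInt_nat (b κ : ℕ → ℂ) (k : ℕ) : extendInt b κ k = b k := by simp [extendInt]

theorem extendInt_neg (b κ : ℕ → ℂ) (k : ℕ) : extendInt b κ (-((k : ℤ) + 1)) = κ k := by
  rw [extendInt, if_neg (by omega)]
  congr 1
  omega

theorem summable_extendInt {b κ : ℕ → ℂ} (hb : Summable fun k => ‖b k‖)
    (hκ : Summable fun k => ‖κ k‖) : Summable fun k => ‖extendInt b κ k‖ := by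
  refine Summable.of_nat_of_neg_add_one ?_ ?_
  · simpa only [extendInt_nat] using hb
  · simpa only [extendInt_neg] using hκ

theorem tsum_extendInt {b κ : ℕ → ℂ} (hb : Summable fun k => ‖b k‖)
    (hκ : Summable fun k => ‖κ k‖) (t : ℝ) :
    ∑' k, extendInt b κ k * expChar k t =
      ∑' k : ℕ, b k * expChar k t + expChar (-1) t * ∑' k : ℕ, κ k * expChar (-k) t := by
  obtain ⟨-, -, h⟩ := tsum_int_eq (summable_mul_expChar (summable_extendInt hb hκ) (fun k => k) t)
  simp only [extendInt_nat, extendInt_neg] at h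
  rw [h, ← tsum_mul_left]
  congr 1
  refine tsum_congr fun k => ?_
  rw [neg_add, expChar_add]
  ring

/-- A substitute for the inverse of (1+z+…+z^{μ-1})^n, which has poles on the circle when μ > 1.
Multiplied by that polynomial power it becomes ((1-z^μ)/(1-rz^μ))^n, bounded by 2^n and tending to 1
almost everywhere as r → 1. -/
theorem exists_hasAbsSeries_regularization (n μ : ℕ) {r : ℝ} (hr0 : 0 ≤ r) (hr1 : r < 1) :
    ∃ d, HasAbsSeries (fun z => ((1 - z) * (1 - r * z ^ μ)⁻¹) ^ n) d := by
  have hX := (HasAbsSeries.X_pow μ).const_mul (r : ℂ)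
  have hnorm : ∑' k, ‖(r : ℂ) * (if k = μ then 1 else 0)‖ = r := by
    rw [tsum_eq_single μ fun k hk => by simp [hk]]
    simp [abs_of_nonneg hr0]
  obtain ⟨e, he⟩ := hX.exists_comp (g := fun w => (1 - w)⁻¹) (a := fun _ => 1) (fun w hw => by
      simp only [one_mul]
      refine hasSum_geometric_of_norm_lt_one ?_
      rw [norm_mul, norm_pow, Complex.norm_real, Real.norm_of_nonneg hr0]
      exact lt_of_le_of_lt (mul_le_of_le_one_right hr0 (pow_le_one₀ (norm_nonneg _) hw)) hr1) (by
      simp only [norm_one, one_mul]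
      rw [hnorm]
      exact summable_geometric_of_lt_one hr0 hr1)
  have h1 : HasAbsSeries (fun z => 1 - z) _ :=
    (HasAbsSeries.one.add ((HasAbsSeries.X_pow 1).const_mul (-1))).congr fun z _ => by ring
  obtain ⟨d, hd, -⟩ := (h1.mul he).exists_pow n
  exact ⟨d, hd⟩

/-- Linear estimates whose errors converge to the error of the estimate which is optimal for the
density with the canonical factor `φ`. -/
theorem exists_tendsto_error {n μ : ℕ} (hμ : 1 ≤ μ) {b φ : ℕ → ℂ} (hb : Summable fun k => ‖b k‖)
    (hφ : IsCanonical φ) {f : ℝ → ℝ} (hf : IntervalIntegrable f volume (-π) π) :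
    ∃ c : ℕ → ℤ → ℂ, (∀ N, (Summable fun k => ‖c N k‖) ∧ ∀ k : ℕ, c N k = b k) ∧
      Tendsto (fun N => ∫ t in (-π)..π,
          ‖∑' k, c N k * expChar k t‖ ^ 2 * (incrWeight n μ t * f t)) atTop
        (𝓝 (∫ t in (-π)..π, ‖∑' j : ℕ, (∑' m, opW n μ φ m * b (m + j)) * expChar j t‖ ^ 2 /
          ‖∑' k : ℕ, φ k * expChar (-k) t‖ ^ 2 * f t)) := by
  obtain ⟨E, e', hE', hE0, hW, hbd⟩ := exists_wFun_boundary n μ hμ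
  have hΦ := HasAbsSeries.of_summable hφ.summable_norm
  obtain ⟨φ', hφ'⟩ := hφ.exists_inv
  have hΨ := opW_hasAbsSeries hW hΦ
  set ψ := opW n μ φ
  set Φ : ℂ → ℂ := fun z => ∑' k, φ k * z ^ k
  have hC := summable_norm_hankel hb hΨ.summable
  have hN := summable_norm_tail hb hΨ.summable
  have hNs := HasAbsSeries.of_summable hN
  set ν : ℕ → ℂ := fun l => ∑' k, b k * ψ (k + l + 1)
  set N₁ : ℂ → ℂ := fun z => ∑' l, ν l * z ^ l
  set C : ℝ → ℂ := fun t => ∑' j : ℕ, (∑' m, ψ m * b (m + j)) * expChar j t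
  set r : ℕ → ℝ := fun k => 1 - 1 / ((k : ℝ) + 1)
  have hr0 : ∀ k, 0 ≤ r k := fun k => by
    have : 1 / ((k : ℝ) + 1) ≤ 1 := by
      rw [div_le_one (by positivity)]
      linarith [(Nat.cast_nonneg k : (0 : ℝ) ≤ k)]
    simp only [r]
    linarith
  have hr1 : ∀ k, r k < 1 := fun k => by
    have : 0 < 1 / ((k : ℝ) + 1) := by positivity
    simp only [r]
    linarith
  have hr : Tendsto r atTop (𝓝 1) := by
    simpa [r] using tendsto_one_div_add_atTop_nhds_zero_nat.const_sub (1 : ℝ)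
  have hrC : Tendsto (fun k => (r k : ℂ)) atTop (𝓝 1) := by
    simpa [Function.comp_def] using (Complex.continuous_ofReal.tendsto 1).comp hr
  choose d hd using fun N => exists_hasAbsSeries_regularization n μ (hr0 N) (hr1 N)
  -- With z = e^{-it}, the negative frequencies of the product of the b-series and ΦW are z N₁(z).
  -- Exact cancellation would need past coefficients with sum -N₁/(ΦW); here 1/W is replaced by 1/E
  -- times the regularization.
  have hK : ∀ N, ∃ κ, HasAbsSeries (fun z => -1 * (N₁ z * ((Φ z)⁻¹ * ((E z)⁻¹ *
      ((1 - z) * (1 - r N * z ^ μ)⁻¹) ^ n)))) κ := fun N =>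
    ⟨_, (hNs.mul (hφ'.mul (hE'.mul (hd N)))).const_mul (-1)⟩
  choose κ hκ using hK
  refine ⟨fun N => extendInt b (κ N), fun N => ⟨summable_extendInt hb (hκ N).summable,
    extendInt_nat b (κ N)⟩, ?_⟩
  set σ : ℕ → ℝ → ℂ := fun N t => ((1 - expChar (-μ) t) * (1 - r N * expChar (-μ) t)⁻¹) ^ n
  have hσ : ∀ N t, ‖σ N t‖ ≤ 2 ^ n := by
    intro N t
    simp only [σ]
    rw [norm_pow, norm_mul, norm_inv]
    refine pow_le_pow_left₀ (by positivity) ?_ n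
    refine mul_inv_le_of_le_mul₀ (norm_nonneg _) zero_le_two ?_
    exact norm_one_sub_mul_expChar_le (hr0 N) (hr1 N).le _ t
  have hμ' : (-(μ : ℤ)) ≠ 0 := by omega
  have hΦt : ∀ t, Φ (expChar (-1) t) = ∑' k : ℕ, φ k * expChar (-k) t := fun t =>
    hΦ.eq_tsum_expChar_neg t
  simp only [← hΦt]
  -- The uncancelled part of the negative frequencies is z N₁(1 - σ), which disappears as σ → 1.
  have hident : ∀ N t, t ∈ Set.Icc (-π) π → t ≠ 0 →
      ‖∑' k, extendInt b (κ N) k * expChar k t‖ ^ 2 * (incrWeight n μ t * f t) =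
        ‖C t + expChar (-1) t * N₁ (expChar (-1) t) * (1 - σ N t)‖ ^ 2 /
          ‖Φ (expChar (-1) t)‖ ^ 2 * f t := by
    intro N t ht ht0
    have hz : ‖expChar (-1) t‖ ≤ 1 := (norm_expChar _ _).le
    have hΦ0 : Φ (expChar (-1) t) ≠ 0 := hφ.2 _ hz
    have hzμ : expChar (-μ) t = expChar (-1) t ^ μ := by
      rw [← expChar_nat_mul, mul_neg_one]
    have hprod := tsum_mul_tsum_expChar hb hΨ.summable t
    rw [← hΨ.eq_tsum_expChar_neg] at hprod
    have hNt : ∑' l : ℕ, ν l * expChar (-((l : ℤ) + 1)) t =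
        expChar (-1) t * N₁ (expChar (-1) t) := by
      rw [hNs.eq_tsum_expChar_neg, ← tsum_mul_left]
      refine tsum_congr fun l => ?_
      rw [neg_add, expChar_add]
      ring
    change _ = C t + _ at hprod
    rw [hNt] at hprod
    rw [← hbd t ht ht0, tsum_extendInt hb (hκ N).summable, ← (hκ N).eq_tsum_expChar_neg]
    rw [← mul_assoc, ← mul_pow, ← norm_mul, ← div_pow, ← norm_div]
    congr 3
    rw [eq_div_iff hΦ0]
    have hgeom : (∑ i ∈ Finset.range μ, expChar (-1) t ^ i) * (1 - expChar (-1) t) =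
        1 - expChar (-1) t ^ μ := geom_sum_mul_neg _ _
    simp only [σ]
    rw [hzμ, ← hgeom]
    set z := expChar (-1) t
    set q := ∑ i ∈ Finset.range μ, z ^ i
    have h1 : (E z)⁻¹ * E z = 1 := inv_mul_cancel₀ (hE0 z)
    have h2 : (Φ z)⁻¹ * Φ z = 1 := inv_mul_cancel₀ hΦ0
    simp only [mul_pow]
    linear_combination hprod - z * N₁ z * (1 - z) ^ n * (1 - r N * z ^ μ)⁻¹ ^ n * q ^ n *
      ((Φ z)⁻¹ * Φ z * h1 + h2)
  have hlim : ∀ t, expChar (-μ) t ≠ 1 → Tendsto (fun N => σ N t) atTop (𝓝 1) := by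
    intro t ht
    have h0 : 1 - expChar (-μ) t ≠ 0 := sub_ne_zero.2 ht.symm
    have h1 : Tendsto (fun N => 1 - (r N : ℂ) * expChar (-μ) t) atTop (𝓝 (1 - expChar (-μ) t)) := by
      simpa using tendsto_const_nhds.sub (hrC.mul_const (expChar (-μ) t))
    have h2 := ((h1.inv₀ h0).const_mul (1 - expChar (-μ) t)).pow n
    rwa [mul_inv_cancel₀ h0, one_pow] at h2
  set SC := ∑' j, ‖∑' m, ψ m * b (m + j)‖
  set SN := ∑' l, ‖ν l‖
  set SP := ∑' k, ‖φ' k‖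
  have hSN : 0 ≤ SN := tsum_nonneg fun _ => norm_nonneg _
  -- The constants bound |C|, |N₁| and 1/|Φ| by coefficient norms, and |1 - σ| by 1 + 2^n.
  refine intervalIntegral.tendsto_integral_filter_of_dominated_convergence
    (fun t => ((SC + SN * (1 + 2 ^ n)) * SP) ^ 2 * ‖f t‖) ?_ ?_ ?_ ?_
  · refine Eventually.of_forall fun N => ?_
    refine AEStronglyMeasurable.mul ?_
      (intervalIntegrable_incrWeight_mul hμ hf).def'.aestronglyMeasurable
    exact ((continuous_tsum_expChar (summable_extendInt hb (hκ N).summable) _).norm.pow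
      2).aestronglyMeasurable
  · refine Eventually.of_forall fun N => ?_
    filter_upwards [ae_ne_zero_of_restrict] with t ht0 ht
    rw [Set.uIoc_of_le (neg_le_self pi_pos.le)] at ht
    rw [hident N t (Set.Ioc_subset_Icc_self ht) ht0, norm_mul]
    refine mul_le_mul_of_nonneg_right ?_ (norm_nonneg _)
    rw [Real.norm_of_nonneg (by positivity), ← div_pow, div_eq_mul_inv, ← norm_inv]
    refine pow_le_pow_left₀ (by positivity) ?_ 2
    refine mul_le_mul ?_ (hφ'.norm_expChar_le (-1) t) (norm_nonneg _) ?_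
    · refine (norm_add_le _ _).trans (add_le_add (norm_tsum_expChar_le hC _ t) ?_)
      rw [norm_mul, norm_mul, norm_expChar, one_mul]
      refine mul_le_mul (hNs.norm_expChar_le (-1) t) ?_ (norm_nonneg _) hSN
      refine (norm_sub_le _ _).trans ?_
      rw [norm_one]
      linarith [hσ N t]
    · have : 0 ≤ SC := tsum_nonneg fun _ => norm_nonneg _
      positivity
  · exact hf.norm.const_mul _
  · filter_upwards [ae_ne_zero_of_restrict, ae_expChar_ne_one hμ'] with t ht0 htμ ht
    rw [Set.uIoc_of_le (neg_le_self pi_pos.le)] at ht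
    simp only [fun N => hident N t (Set.Ioc_subset_Icc_self ht) ht0]
    refine Tendsto.mul_const _ (Tendsto.div_const ((Tendsto.norm ?_).pow 2) _)
    have := ((hlim t htμ).const_sub 1).const_mul (expChar (-1) t * N₁ (expChar (-1) t))
    simpa using this.const_add (C t)

/-! ### Mean square convergent series -/

theorem intervalIntegrable_of_memLp_two {G : ℝ → ℂ}
    (hG : MemLp G 2 (volume.restrict (Set.Ioc (-π) π))) : IntervalIntegrable G volume (-π) π :=
  (intervalIntegrable_iff_integrableOn_Ioc_of_le (neg_le_self pi_pos.le)).2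
    (hG.integrable (by norm_num))

theorem intervalIntegrable_norm_sq {G : ℝ → ℂ}
    (hG : MemLp G 2 (volume.restrict (Set.Ioc (-π) π))) :
    IntervalIntegrable (fun t => ‖G t‖ ^ 2) volume (-π) π :=
  (intervalIntegrable_iff_integrableOn_Ioc_of_le (neg_le_self pi_pos.le)).2
    ((memLp_two_iff_integrable_sq_norm hG.1).1 hG)

theorem memLp_of_continuous {G : ℝ → ℂ} (hG : Continuous G) :
    MemLp G 2 (volume.restrict (Set.Ioc (-π) π)) := by
  obtain ⟨C, hC⟩ := isCompact_Icc.exists_bound_of_continuousOn (s := Set.Icc (-π) π) hG.continuousOn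
  refine MemLp.of_bound hG.aestronglyMeasurable C ?_
  filter_upwards [ae_restrict_mem measurableSet_Ioc] with x hx
  exact hC x (Set.Ioc_subset_Icc_self hx)

/-- Parseval's identity on `(-π, π]`. -/
theorem hasSum_sq_integral_expChar {X : ℝ → ℂ}
    (hX : MemLp X 2 (volume.restrict (Set.Ioc (-π) π))) :
    HasSum (fun m : ℤ => ‖1 / (2 * π) * ∫ t in (-π)..π, expChar (-m) t * X t‖ ^ 2)
      (1 / (2 * π) * ∫ t in (-π)..π, ‖X t‖ ^ 2) := by
  have h := hasSum_sq_fourierCoeffOn (neg_lt_self pi_pos) hX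
  have h1 : (π - -π)⁻¹ • ∫ t in (-π)..π, ‖X t‖ ^ 2 = 1 / (2 * π) * ∫ t in (-π)..π, ‖X t‖ ^ 2 := by
    rw [smul_eq_mul]
    congr 1
    rw [one_div]
    congr 1
    ring
  rw [h1] at h
  refine h.congr_fun fun m => ?_
  congr 2
  rw [fourierCoeffOn_eq_integral, Complex.real_smul]
  have h2 : ((1 / (π - -π) : ℝ) : ℂ) = 1 / (2 * π) := by
    push_cast
    ring
  rw [h2]
  congr 1
  refine intervalIntegral.integral_congr fun t _ => ?_
  simp only [smul_eq_mul]
  congr 1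
  rw [fourier_coe_apply, expChar]
  congr 1
  have : (π : ℂ) ≠ 0 := by exact_mod_cast pi_ne_zero
  push_cast
  have h3 : (π : ℂ) - -π = 2 * π := by ring
  rw [h3]
  field_simp

theorem sq_norm_integral_expChar_le {X : ℝ → ℂ}
    (hX : MemLp X 2 (volume.restrict (Set.Ioc (-π) π))) (m : ℤ) :
    ‖1 / (2 * π) * ∫ t in (-π)..π, expChar m t * X t‖ ^ 2 ≤
      1 / (2 * π) * ∫ t in (-π)..π, ‖X t‖ ^ 2 := by
  have h := hasSum_sq_integral_expChar hX
  have := le_hasSum h (-m) fun _ _ => by positivity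
  rwa [neg_neg] at this

theorem exp_eq_expChar (σ : ℤ) (t : ℝ) (k : ℕ) :
    Complex.exp (Complex.I * σ * t * k) = expChar (k * σ) t := by
  rw [expChar]
  congr 1
  push_cast
  ring

theorem memLp_partial_sum (σ : ℤ) (c : ℕ → ℂ) (N : ℕ) :
    MemLp (fun t : ℝ => ∑ k ∈ Finset.range N, c k * expChar (k * σ) t) 2
      (volume.restrict (Set.Ioc (-π) π)) :=
  memLp_of_continuous (continuous_finsetSum _ fun _ _ => continuous_const.mul (continuous_expChar _))

theorem Extrapolation.IsMeanSquareSum.ae_eq {σ : ℤ} {c : ℕ → ℂ} {R R' : ℝ → ℂ}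
    (h : IsMeanSquareSum σ c R) (h' : IsMeanSquareSum σ c R') :
    R =ᵐ[volume.restrict (Set.Ioc (-π) π)] R' := by
  obtain ⟨hR, ht⟩ := h
  obtain ⟨hR', ht'⟩ := h'
  simp only [exp_eq_expChar] at ht ht'
  have hle : ∫ t in (-π)..π, ‖R t - R' t‖ ^ 2 ≤ 0 := by
    have hlim := (ht.const_mul 2).add (ht'.const_mul 2)
    rw [mul_zero, add_zero] at hlim
    refine ge_of_tendsto' hlim fun N => ?_
    have hS := memLp_partial_sum σ c N
    have i1 := intervalIntegrable_norm_sq (hR.sub hS)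
    have i2 := intervalIntegrable_norm_sq (hR'.sub hS)
    have i3 := intervalIntegrable_norm_sq (hR.sub hR')
    simp only [Pi.sub_apply] at i1 i2 i3
    rw [← intervalIntegral.integral_const_mul, ← intervalIntegral.integral_const_mul,
      ← intervalIntegral.integral_add (i1.const_mul 2) (i2.const_mul 2)]
    refine intervalIntegral.integral_mono (neg_le_self pi_pos.le) i3
      ((i1.const_mul 2).add (i2.const_mul 2)) fun t => ?_
    set S := ∑ k ∈ Finset.range N, c k * expChar (k * σ) t
    have h1 : ‖R t - R' t‖ ≤ ‖R t - S‖ + ‖R' t - S‖ := by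
      have : R t - R' t = (R t - S) - (R' t - S) := by ring
      rw [this]
      exact norm_sub_le _ _
    nlinarith [norm_nonneg (R t - R' t), sq_nonneg (‖R t - S‖ - ‖R' t - S‖)]
  rw [intervalIntegral.integral_of_le (neg_le_self pi_pos.le)] at hle
  have h0 : ∫ t in Set.Ioc (-π) π, ‖R t - R' t‖ ^ 2 = 0 :=
    le_antisymm hle (integral_nonneg fun t => by positivity)
  have hi := (memLp_two_iff_integrable_sq_norm (hR.sub hR').1).1 (hR.sub hR')
  have := (integral_eq_zero_iff_of_nonneg (fun t => by positivity) hi).1 h0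
  filter_upwards [this] with t ht
  simpa [sub_eq_zero] using ht

theorem isMeanSquareSum_tsum (σ : ℤ) {c : ℕ → ℂ} (hc : Summable fun k => ‖c k‖) :
    IsMeanSquareSum σ c fun t => ∑' k : ℕ, c k * expChar (k * σ) t := by
  have hcont := continuous_tsum_expChar hc fun k : ℕ => (k : ℤ) * σ
  refine ⟨memLp_of_continuous hcont, ?_⟩
  simp only [exp_eq_expChar]
  have h0 : (0 : ℝ) = ∫ _ in (-π)..π, (0 : ℝ) := by simp
  rw [h0]
  refine intervalIntegral.tendsto_integral_filter_of_dominated_convergence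
    (fun _ => (2 * ∑' k, ‖c k‖) ^ 2) ?_ ?_ ?_ ?_
  · exact Eventually.of_forall fun N => (((hcont.sub (continuous_finsetSum _ fun k _ =>
      continuous_const.mul (continuous_expChar _))).norm).pow 2).aestronglyMeasurable
  · refine Eventually.of_forall fun N => Eventually.of_forall fun t _ => ?_
    rw [Real.norm_of_nonneg (by positivity)]
    refine pow_le_pow_left₀ (norm_nonneg _) ?_ 2
    refine (norm_sub_le _ _).trans ?_
    have h1 := norm_tsum_expChar_le hc (fun k : ℕ => (k : ℤ) * σ) t
    have h2 : ‖∑ k ∈ Finset.range N, c k * expChar (k * σ) t‖ ≤ ∑' k, ‖c k‖ := by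
      refine (norm_sum_le _ _).trans ?_
      simp only [norm_mul, norm_expChar, mul_one]
      exact hc.sum_le_tsum _ fun _ _ => norm_nonneg _
    linarith
  · exact intervalIntegrable_const
  · refine Eventually.of_forall fun t _ => ?_
    have := (summable_mul_expChar hc (fun k : ℕ => (k : ℤ) * σ) t).hasSum.tendsto_sum_nat
    have h2 := ((tendsto_const_nhds (x := ∑' k : ℕ, c k * expChar (k * σ) t)).sub this).norm.pow 2
    simpa using h2

/-- The Fourier coefficients of a mean square convergent series `∑ c(k) e^{-itk}`. -/
theorem Extrapolation.IsMeanSquareSum.integral_expChar {c : ℕ → ℂ} {G : ℝ → ℂ}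
    (h : IsMeanSquareSum (-1) c G) (m : ℤ) :
    ∫ t in (-π)..π, expChar m t * G t = if 0 ≤ m then 2 * π * c m.toNat else 0 := by
  obtain ⟨hG, ht⟩ := h
  simp only [exp_eq_expChar] at ht
  set L : ℂ := if 0 ≤ m then 2 * π * c m.toNat else 0
  have hπ : (π : ℂ) ≠ 0 := by exact_mod_cast pi_ne_zero
  have hlim := ht.const_mul (1 / (2 * π))
  rw [mul_zero] at hlim
  have hle : ‖1 / (2 * π) * ((∫ t in (-π)..π, expChar m t * G t) - L)‖ ^ 2 ≤ 0 := by
    refine ge_of_tendsto hlim ?_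
    -- For N > m the partial sum already has the asserted coefficient, so the discrepancy is bounded
    -- by the L² distance to G for all such N.
    filter_upwards [eventually_gt_atTop m.toNat] with N hN
    have hS := memLp_partial_sum (-1) c N
    have h1 := sq_norm_integral_expChar_le (hG.sub hS) m
    simp only [Pi.sub_apply, mul_sub] at h1
    have i1 : IntervalIntegrable (fun t => expChar m t * G t) volume (-π) π :=
      (intervalIntegrable_of_memLp_two hG).continuousOn_mul (continuous_expChar m).continuousOn
    have i2 : IntervalIntegrable (fun t => expChar m t *
        ∑ k ∈ Finset.range N, c k * expChar (k * -1) t) volume (-π) π :=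
      (intervalIntegrable_of_memLp_two hS).continuousOn_mul (continuous_expChar m).continuousOn
    rw [intervalIntegral.integral_sub i1 i2] at h1
    have h2 : ∫ t in (-π)..π, expChar m t * ∑ k ∈ Finset.range N, c k * expChar (k * -1) t = L := by
      simp only [Finset.mul_sum]
      have h3 : ∀ (k : ℕ) (t : ℝ), expChar m t * (c k * expChar (k * -1) t) =
          c k * expChar (m - k) t := by
        intro k t
        rw [sub_eq_add_neg, expChar_add, mul_neg_one]
        ring
      simp only [h3]
      have h4 : ∀ k ∈ Finset.range N,
          IntervalIntegrable (fun t => c k * expChar (m - k) t) volume (-π) π := fun k _ =>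
        (continuous_const.mul (continuous_expChar _)).intervalIntegrable _ _
      rw [intervalIntegral.integral_finsetSum h4]
      simp only [intervalIntegral.integral_const_mul, _root_.integral_expChar]
      simp only [L]
      split_ifs with hm
      · rw [Finset.sum_eq_single m.toNat]
        · rw [if_pos (by omega)]
          ring
        · intro k _ hk
          rw [if_neg (by omega), mul_zero]
        · intro hk
          simp at hk
          omega
      · refine Finset.sum_eq_zero fun k _ => ?_
        rw [if_neg (by omega), mul_zero]
    rw [h2] at h1
    simpa only [mul_sub] using h1
  have h4 : ‖1 / (2 * (π : ℂ)) * ((∫ t in (-π)..π, expChar m t * G t) - L)‖ = 0 := by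
    have := le_antisymm hle (by positivity)
    exact pow_eq_zero_iff (two_ne_zero) |>.1 this
  rw [norm_eq_zero, mul_eq_zero] at h4
  rcases h4 with h4 | h4
  · exact absurd h4 (by simp [hπ])
  · exact sub_eq_zero.1 h4

/-! ### A lower bound for the errors of linear estimates -/

/-- Multiplication by W acts on Fourier coefficients as the convolution W^μ. As c need not be
absolutely summable, only the series of W is integrated termwise. -/
theorem integral_expChar_mul_boundary {n μ : ℕ} {W : ℂ → ℂ} (hW : HasAbsSeries W (wCoeff n μ))
    {c : ℕ → ℂ} {G : ℝ → ℂ} (hG : IsMeanSquareSum (-1) c G) (p : ℤ) :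
    ∫ t in (-π)..π, expChar p t * (W (expChar (-1) t) * G t) =
      if 0 ≤ p then 2 * π * opW n μ c p.toNat else 0 := by
  have hGi := intervalIntegrable_of_memLp_two hG.1
  have h1 := hasSum_integral_expChar_mul hW.summable (fun k : ℕ => -(k : ℤ))
    (G := fun t => expChar p t * G t) (hGi.continuousOn_mul (continuous_expChar p).continuousOn)
  have h2 : ∀ t, expChar p t * (W (expChar (-1) t) * G t) =
      (∑' k : ℕ, wCoeff n μ k * expChar (-k) t) * (expChar p t * G t) := by
    intro t
    rw [hW.eq_tsum_expChar_neg]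
    ring
  simp only [h2]
  refine h1.unique ?_
  have h3 : ∀ k : ℕ, ∫ t in (-π)..π, expChar (-k) t * (expChar p t * G t) =
      if 0 ≤ p - k then 2 * π * c (p - k).toNat else 0 := by
    intro k
    rw [← hG.integral_expChar (p - k)]
    refine intervalIntegral.integral_congr fun t _ => ?_
    rw [← mul_assoc, ← expChar_add, neg_add_eq_sub]
  simp only [h3]
  split_ifs with hp
  · obtain ⟨q, rfl⟩ := Int.eq_ofNat_of_zero_le hp
    rw [Int.toNat_natCast, opW, Finset.mul_sum, ← Finset.sum_flip]
    have h5 : ∑ r ∈ Finset.range (q + 1), 2 * (π : ℂ) * (wCoeff n μ (q - (q - r)) * c (q - r)) =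
        ∑ r ∈ Finset.range (q + 1), wCoeff n μ r *
          (if 0 ≤ (q : ℤ) - r then 2 * π * c ((q : ℤ) - r).toNat else 0) := by
      refine Finset.sum_congr rfl fun r hr => ?_
      have hr' : r ≤ q := Nat.lt_succ_iff.1 (Finset.mem_range.1 hr)
      rw [if_pos (by omega), Nat.sub_sub_self hr', show ((q : ℤ) - r).toNat = q - r by omega]
      ring
    rw [h5]
    refine hasSum_sum_of_ne_finset_zero fun r hr => ?_
    simp only [Finset.mem_range] at hr
    rw [if_neg (by omega), mul_zero]
  · convert hasSum_zero using 2 with k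
    rw [if_neg (by omega), mul_zero]

/-- W G has no frequencies above 0, so a coefficient of the product at frequency -m + k = j ≥ 0 with
m ≥ 0 uses only k = m + j ≥ 0, where c is prescribed. Bessel's inequality discards the frequencies
that the estimate can change. -/
theorem sum_norm_opDAW_le {n μ : ℕ} (hμ : 1 ≤ μ) {a : ℕ → ℂ} {ψ : ℕ → ℂ} {G : ℝ → ℂ}
    (hG : IsMeanSquareSum (-1) ψ G) {c : ℤ → ℂ} (hc : Summable fun k => ‖c k‖)
    (hcb : ∀ k : ℕ, c k = bCoeff n μ a k) (N : ℕ) :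
    ∑ j ∈ Finset.range N, ‖opDAW n μ a ψ j‖ ^ 2 ≤ 1 / (2 * π) *
      ∫ t in (-π)..π, ‖∑' k, c k * expChar k t‖ ^ 2 * (incrWeight n μ t * ‖G t‖ ^ 2) := by
  obtain ⟨E, e', -, -, hW, hbd⟩ := exists_wFun_boundary n μ hμ
  set W : ℂ → ℂ := fun z => (∑ i ∈ Finset.range μ, z ^ i) ^ n * E z
  have hWc := hW.continuous_expChar (-1)
  have hcc := continuous_tsum_expChar hc fun k => k
  set X : ℝ → ℂ := fun t => (∑' k, c k * expChar k t) * (W (expChar (-1) t) * G t)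
  have hX : MemLp X 2 (volume.restrict (Set.Ioc (-π) π)) := by
    refine MemLp.of_le_mul (c := (∑' k, ‖c k‖) * ∑' k, ‖wCoeff n μ k‖) hG.1
      (hcc.aestronglyMeasurable.mul (hWc.aestronglyMeasurable.mul hG.1.1))
      (Eventually.of_forall fun t => ?_)
    simp only [X]
    rw [norm_mul, norm_mul, ← mul_assoc]
    have h1 := norm_tsum_expChar_le hc (fun k => k) t
    have h2 := hW.norm_expChar_le (-1) t
    gcongr
  have hcoef : ∀ j : ℕ, 1 / (2 * π) * ∫ t in (-π)..π, expChar (-j) t * X t = opDAW n μ a ψ j := by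
    intro j
    have i1 : IntervalIntegrable (fun t => expChar (-j) t * (W (expChar (-1) t) * G t)) volume (-π) π :=
      ((intervalIntegrable_of_memLp_two hG.1).continuousOn_mul hWc.continuousOn).continuousOn_mul
        (continuous_expChar _).continuousOn
    have h1 := hasSum_integral_expChar_mul hc (fun k => k) i1
    have h2 : ∀ t, expChar (-j) t * X t =
        (∑' k, c k * expChar k t) * (expChar (-j) t * (W (expChar (-1) t) * G t)) := fun t => by
      simp only [X]
      ring
    have h3 : ∀ k : ℤ, ∫ t in (-π)..π, expChar k t * (expChar (-j) t * (W (expChar (-1) t) * G t)) =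
        if 0 ≤ k - j then 2 * π * opW n μ ψ (k - j).toNat else 0 := by
      intro k
      rw [← integral_expChar_mul_boundary hW hG (k - j)]
      refine intervalIntegral.integral_congr fun t _ => ?_
      rw [sub_eq_add_neg, expChar_add]
      ring
    simp only [h3] at h1
    simp only [h2]
    -- The substitution k = m + j reaches every nonvanishing term.
    have hinj : Function.Injective fun m : ℕ => (m : ℤ) + j := fun x y h => by simpa using h
    have h4 := (hinj.hasSum_iff (fun k hk => by
      rw [if_neg, mul_zero]
      intro h
      exact hk ⟨(k - j).toNat, by simp only; omega⟩)).2 h1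
    have h5 := h4.mul_left (1 / (2 * π : ℂ))
    rw [← h5.tsum_eq, opDAW, opDA_eq]
    refine tsum_congr fun m => ?_
    simp only [Function.comp]
    have hπ : (π : ℂ) ≠ 0 := by exact_mod_cast pi_ne_zero
    have h6 : c ((m : ℤ) + j) = bCoeff n μ a (m + j) := by
      rw [← hcb]
      push_cast
      rfl
    rw [h6, if_pos (by omega), show ((m : ℤ) + j - j).toNat = m by omega]
    field_simp
  have hpars := hasSum_sq_integral_expChar hX
  have h1 := sum_le_hasSum ((Finset.range N).map ⟨((↑) : ℕ → ℤ), Nat.cast_injective⟩)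
    (fun _ _ => by positivity) hpars
  rw [Finset.sum_map] at h1
  simp only [Function.Embedding.coeFn_mk, hcoef] at h1
  refine h1.trans (le_of_eq ?_)
  congr 1
  refine intervalIntegral.integral_congr_ae ?_
  filter_upwards [ae_ne_zero_of_restrict] with t ht0 ht
  rw [Set.uIoc_of_le (neg_le_self pi_pos.le)] at ht
  rw [← hbd t (Set.Ioc_subset_Icc_self ht) ht0]
  simp only [X, W]
  rw [norm_mul, norm_mul, mul_pow, mul_pow]

/-! ### Bounds for the optimal error -/

theorem normSq_le_ofReal {c : ℕ → ℂ} {B : ℝ} (h : ∀ N, ∑ j ∈ Finset.range N, ‖c j‖ ^ 2 ≤ B) :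
    normSq c ≤ ENNReal.ofReal B := by
  refine ENNReal.tsum_le_of_sum_range_le fun N => ?_
  have h1 : ∀ j, ‖c j‖ₑ ^ 2 = ENNReal.ofReal (‖c j‖ ^ 2) := fun j => by
    rw [ENNReal.ofReal_pow (norm_nonneg _), ofReal_norm]
  simp only [h1]
  rw [← ENNReal.ofReal_sum_of_nonneg fun _ _ => by positivity]
  exact ENNReal.ofReal_le_ofReal (h N)

theorem factorDensity_eq (φ : ℕ → ℂ) (t : ℝ) :
    factorDensity φ t = ‖∑' k : ℕ, φ k * expChar (-k) t‖ ^ 2 := by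
  unfold factorDensity
  congr 3
  ext k
  rw [expChar]
  push_cast
  ring_nf

/-- The sum `∑_j (D^μ A W^μ φ)_j e^{itj}`. -/
noncomputable def residualSeries (n μ : ℕ) (a φ : ℕ → ℂ) (t : ℝ) : ℂ :=
  ∑' j : ℕ, opDAW n μ a φ j * expChar j t

theorem opDAW_eq_hankel (n μ : ℕ) (a φ : ℕ → ℂ) (j : ℕ) :
    opDAW n μ a φ j = ∑' m, opW n μ φ m * bCoeff n μ a (m + j) := opDA_eq _ _ _ _ _

/-- The error under the density `f` of the estimate which is optimal for the density with the
canonical factor `φ`. -/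
noncomputable def errorAt (n μ : ℕ) (a φ : ℕ → ℂ) (f : ℝ → ℝ) : ℝ :=
  1 / (2 * π) * ∫ t in (-π)..π, ‖residualSeries n μ a φ t‖ ^ 2 / factorDensity φ t * f t

section Bounds

variable {n μ : ℕ} {a φ : ℕ → ℂ} {f : ℝ → ℝ}

theorem summable_norm_opDAW (hμ : 1 ≤ μ) (hb : Summable fun k => ‖bCoeff n μ a k‖)
    (hφ : Summable fun k => ‖φ k‖) : Summable fun j => ‖opDAW n μ a φ j‖ := by
  obtain ⟨E, e', -, -, hW, -⟩ := exists_wFun_boundary n μ hμ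
  simp only [opDAW_eq_hankel]
  exact summable_norm_hankel hb (opW_hasAbsSeries hW (HasAbsSeries.of_summable hφ)).summable

theorem exists_tendsto_errorAt (hμ : 1 ≤ μ) (hb : Summable fun k => ‖bCoeff n μ a k‖)
    (hφ : IsCanonical φ) (hf : IntervalIntegrable f volume (-π) π) :
    ∃ c : ℕ → ℤ → ℂ, (∀ N, (Summable fun k => ‖c N k‖) ∧ ∀ k : ℕ, c N k = bCoeff n μ a k) ∧
      Tendsto (fun N => 1 / (2 * π) * ∫ t in (-π)..π,
          ‖∑' k, c N k * expChar k t‖ ^ 2 * (incrWeight n μ t * f t)) atTop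
        (𝓝 (errorAt n μ a φ f)) := by
  obtain ⟨c, hc, hlim⟩ := exists_tendsto_error (n := n) hμ hb hφ hf
  refine ⟨c, hc, ?_⟩
  simp only [← opDAW_eq_hankel n μ a φ, ← factorDensity_eq] at hlim
  exact hlim.const_mul _

theorem optimalError_le_errorAt {Ω : Type} [MeasurableSpace Ω] {P : Measure Ω}
    {ξ : ℤ → Lp ℂ 2 P} (hμ : 1 ≤ μ) (hb : Summable fun k => ‖bCoeff n μ a k‖)
    (hφ : IsCanonical φ) (hf : IntervalIntegrable f volume (-π) π)
    (hξ : HasSpectralDensity P n f ξ) : optimalError n μ a ξ ≤ errorAt n μ a φ f := by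
  obtain ⟨c, hc, hlim⟩ := exists_tendsto_errorAt hμ hb hφ hf
  exact ge_of_tendsto' hlim fun N =>
    optimalError_le hξ (intervalIntegrable_incrWeight_mul hμ hf) (hc N).1 (hc N).2

/-- Compares the extremum functional at ψ with estimates built from φ. The bound is purely analytic,
so ψ may be any ℓ² factor, with zeros in the disc allowed. -/
theorem normSq_opDAW_le_errorAt (hμ : 1 ≤ μ) (hb : Summable fun k => ‖bCoeff n μ a k‖)
    (hφ : IsCanonical φ) {ψ : ℕ → ℂ} {G : ℝ → ℂ} (hG : IsMeanSquareSum (-1) ψ G) :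
    normSq (opDAW n μ a ψ) ≤ ENNReal.ofReal (errorAt n μ a φ fun t => ‖G t‖ ^ 2) := by
  obtain ⟨c, hc, hlim⟩ := exists_tendsto_errorAt hμ hb hφ (intervalIntegrable_norm_sq hG.1)
  exact normSq_le_ofReal fun K => ge_of_tendsto' hlim fun N =>
    sum_norm_opDAW_le hμ hG (hc N).1 (hc N).2 K

theorem isMeanSquareSum_factor (hφ : Summable fun k => ‖φ k‖) :
    IsMeanSquareSum (-1) φ fun t => ∑' k : ℕ, φ k * expChar (-k) t := by
  have := isMeanSquareSum_tsum (-1) hφ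
  simpa only [mul_neg_one] using this

/-- The Bessel bound holds for every choice of past coefficients, hence for the optimal error. -/
theorem normSq_opDAW_le_optimalError {Ω : Type} [MeasurableSpace Ω] {P : Measure Ω}
    {ξ : ℤ → Lp ℂ 2 P} (hμ : 1 ≤ μ) (hb : Summable fun k => ‖bCoeff n μ a k‖)
    (hφ : Summable fun k => ‖φ k‖) (hf : IntervalIntegrable f volume (-π) π)
    (hfφ : f =ᵐ[volume.restrict (Set.Ioc (-π) π)] factorDensity φ)
    (hξ : HasSpectralDensity P n f ξ) :
    normSq (opDAW n μ a φ) ≤ ENNReal.ofReal (optimalError n μ a ξ) := by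
  refine normSq_le_ofReal fun N => ?_
  refine le_optimalError hξ (intervalIntegrable_incrWeight_mul hμ hf) hb fun c hc hcb => ?_
  refine (sum_norm_opDAW_le hμ (isMeanSquareSum_factor hφ) hc hcb N).trans (le_of_eq ?_)
  congr 1
  refine intervalIntegral.integral_congr_ae_restrict ?_
  rw [Set.uIoc_of_le (neg_le_self pi_pos.le)]
  filter_upwards [hfφ] with t ht
  rw [ht, factorDensity_eq]

theorem factorDensity_pos (hφ : IsCanonical φ) (t : ℝ) : 0 < factorDensity φ t := by
  rw [factorDensity_eq, ← (HasAbsSeries.of_summable hφ.summable_norm).eq_tsum_expChar_neg]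
  have := hφ.2 (expChar (-1) t) (norm_expChar _ _).le
  positivity

/-- At its own density |Φ|² cancels, leaving the mean of |C|², which Parseval evaluates. -/
theorem errorAt_factorDensity_le (hμ : 1 ≤ μ) (hb : Summable fun k => ‖bCoeff n μ a k‖)
    (hφ : IsCanonical φ) :
    ENNReal.ofReal (errorAt n μ a φ (factorDensity φ)) ≤ normSq (opDAW n μ a φ) := by
  have hs := summable_norm_opDAW hμ hb hφ.summable_norm
  have h1 : errorAt n μ a φ (factorDensity φ) =
      1 / (2 * π) * ∫ t in (-π)..π, ‖residualSeries n μ a φ t‖ ^ 2 := by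
    unfold errorAt
    congr 1
    exact intervalIntegral.integral_congr fun t _ => div_mul_cancel₀ _ (factorDensity_pos hφ t).ne'
  have hpars := hasSum_sq_integral_expChar (memLp_of_continuous
    (continuous_tsum_expChar hs fun j : ℕ => (j : ℤ)))
  have hπ : (π : ℂ) ≠ 0 := by exact_mod_cast pi_ne_zero
  have hcoef : ∀ m : ℤ, 1 / (2 * π) * ∫ t in (-π)..π, expChar (-m) t *
      ∑' j : ℕ, opDAW n μ a φ j * expChar j t = if 0 ≤ m then opDAW n μ a φ m.toNat else 0 := by
    intro m
    have h := integral_expChar_mul_tsum hs (k := fun j : ℕ => (j : ℤ)) (-m)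
    rw [← h.tsum_eq]
    split_ifs with hm
    · rw [tsum_eq_single m.toNat fun j hj => by rw [if_neg]; omega, if_pos (by omega)]
      field_simp
    · rw [tsum_congr fun j : ℕ => if_neg (by omega)]
      simp
  simp only [hcoef] at hpars
  have h2 := (Nat.cast_injective (R := ℤ)).hasSum_iff (fun m hm => by
    rw [if_neg, norm_zero, zero_pow two_ne_zero]
    intro h
    exact hm ⟨m.toNat, Int.toNat_of_nonneg h⟩) |>.2 hpars
  have h3 : HasSum (fun j : ℕ => ‖opDAW n μ a φ j‖ ^ 2) (errorAt n μ a φ (factorDensity φ)) := by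
    rw [h1]
    refine h2.congr_fun fun j => ?_
    simp
  rw [← h3.tsum_eq, ENNReal.ofReal_tsum_of_nonneg (fun _ => by positivity) h3.summable]
  refine le_of_eq (tsum_congr fun j => ?_)
  rw [ENNReal.ofReal_pow (norm_nonneg _), ofReal_norm]

end Bounds

/-! ### Densities of the rational form -/

/-- Because p is real the imaginary parts drop out and only cosine moments of order |m-k| ≤ M occur,
exactly those fixed by the class. -/
theorem integral_norm_sq_trigPolynomial_mul {M : ℕ} {ρ : ℕ → ℝ} {f : ℝ → ℝ}
    (hf : f ∈ momentClass M ρ) (p : ℕ → ℝ) :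
    ∫ t in (-π)..π, ‖∑ m ∈ Finset.range (M + 1),
        (p m : ℂ) * Complex.exp (-(Complex.I * t * m))‖ ^ 2 * f t =
      ∑ m ∈ Finset.range (M + 1), ∑ k ∈ Finset.range (M + 1),
        p m * p k * (2 * π * ρ ((m : ℤ) - k).natAbs) := by
  obtain ⟨hi, -, hρ⟩ := hf
  have hcos : ∀ (j : ℕ), IntervalIntegrable (fun t => f t * Real.cos (j * t)) volume (-π) π :=
    fun j => hi.mul_continuousOn (by fun_prop)
  have h1 : ∀ t : ℝ, ‖∑ m ∈ Finset.range (M + 1),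
      (p m : ℂ) * Complex.exp (-(Complex.I * t * m))‖ ^ 2 * f t =
      ∑ m ∈ Finset.range (M + 1), ∑ k ∈ Finset.range (M + 1),
        p m * p k * (f t * Real.cos (((m : ℤ) - k).natAbs * t)) := by
    intro t
    have e1 : ∀ m : ℕ, Complex.exp (-(Complex.I * t * m)) = expChar (-m) t := fun m => by
      rw [expChar]
      push_cast
      ring_nf
    simp only [e1]
    rw [← Complex.normSq_eq_norm_sq, ← Complex.ofReal_re (Complex.normSq _), ← Complex.mul_conj,
      map_sum, Finset.sum_mul_sum, Complex.re_sum, Finset.sum_mul]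
    refine Finset.sum_congr rfl fun m _ => ?_
    rw [Complex.re_sum, Finset.sum_mul]
    refine Finset.sum_congr rfl fun k _ => ?_
    rw [map_mul, Complex.conj_ofReal, ← expChar_neg, neg_neg]
    have e2 : (p m : ℂ) * expChar (-m) t * (p k * expChar k t) =
        ((p m * p k : ℝ) : ℂ) * expChar (-((m : ℤ) - k)) t := by
      rw [neg_sub, sub_eq_add_neg, add_comm, expChar_add]
      push_cast
      ring
    have e3 : (expChar (-((m : ℤ) - k)) t).re = Real.cos (((m : ℤ) - k).natAbs * t) := by
      have : expChar (-((m : ℤ) - k)) t =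
          Complex.exp (((-(((m : ℤ) - k : ℤ) : ℝ) * t : ℝ) : ℂ) * Complex.I) := by
        rw [expChar]
        congr 1
        push_cast
        ring
      rw [this, Complex.exp_ofReal_mul_I_re, neg_mul, Real.cos_neg, Nat.cast_natAbs, Int.cast_abs]
      rcases abs_choice ((((m : ℤ) - k : ℤ)) : ℝ) with h | h <;> rw [h]
      rw [neg_mul, Real.cos_neg]
    rw [e2, Complex.re_ofReal_mul, e3]
    ring
  simp only [h1]
  have hterm : ∀ m k : ℕ, IntervalIntegrable
      (fun t => p m * p k * (f t * Real.cos (((m : ℤ) - k).natAbs * t))) volume (-π) π :=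
    fun m k => (hcos _).const_mul _
  have hsum : ∀ m : ℕ, IntervalIntegrable (fun t => ∑ k ∈ Finset.range (M + 1),
      p m * p k * (f t * Real.cos (((m : ℤ) - k).natAbs * t))) volume (-π) π := fun m => by
    simpa only [Finset.sum_fn] using
      IntervalIntegrable.sum (Finset.range (M + 1)) fun k _ => hterm m k
  rw [intervalIntegral.integral_finsetSum fun m _ => hsum m]
  refine Finset.sum_congr rfl fun m hm => ?_
  rw [intervalIntegral.integral_finsetSum fun k _ => hterm m k]
  refine Finset.sum_congr rfl fun k hk => ?_
  simp only [Finset.mem_range] at hm hk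
  rw [intervalIntegral.integral_const_mul, ← hρ _ (by omega)]
  have := pi_ne_zero
  field_simp

/-- For a density of the rational form the error of its optimal estimate is constant on the class
`D_M`. -/
theorem errorAt_eq_of_rational {n μ M : ℕ} {a φ : ℕ → ℂ} {ρ : ℕ → ℝ} (hμ : 1 ≤ μ)
    (hb : Summable fun k => ‖bCoeff n μ a k‖) (hφ : φ ∈ admissible M ρ) {c : ℂ} {p : ℕ → ℝ}
    {f₀ : ℝ → ℝ} (hr : IsRationalForm n μ M a φ c p f₀)
    (hf₀ : f₀ =ᵐ[volume.restrict (Set.Ioc (-π) π)] factorDensity φ) {f : ℝ → ℝ}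
    (hf : f ∈ momentClass M ρ) : errorAt n μ a φ f = errorAt n μ a φ (factorDensity φ) := by
  obtain ⟨R, hR, hform⟩ := hr
  have hs := summable_norm_opDAW hμ hb hφ.2.1.summable_norm
  have hR' : IsMeanSquareSum 1 (opDA n μ a (opW n μ φ)) (residualSeries n μ a φ) := by
    have := isMeanSquareSum_tsum 1 hs
    simp only [mul_one] at this
    exact this
  -- Solving (52) for |C|²/|Φ|² leaves the squared modulus of the denominator polynomial over |c|².
  have hae : ∀ᵐ t ∂volume.restrict (Set.Ioc (-π) π),
      ‖residualSeries n μ a φ t‖ ^ 2 / factorDensity φ t = (‖c‖ ^ 2)⁻¹ *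
        ‖∑ m ∈ Finset.range (M + 1), (p m : ℂ) * Complex.exp (-(Complex.I * t * m))‖ ^ 2 := by
    filter_upwards [hform, hf₀, hR.ae_eq hR'] with t h1 h2 h3
    have hpos := factorDensity_pos hφ.2.1 t
    rw [h2, h3, norm_mul, mul_pow] at h1
    set D := ‖∑ m ∈ Finset.range (M + 1), (p m : ℂ) * Complex.exp (-(Complex.I * t * m))‖ ^ 2
    -- Division by zero gives 0, so a vanishing denominator would contradict the positivity of the
    -- canonical density; the same positivity excludes c = 0 and a zero of C.
    have hD : D ≠ 0 := fun h => by
      rw [h, div_zero] at h1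
      exact hpos.ne' h1
    have hc : ‖c‖ ^ 2 ≠ 0 := fun h => by
      rw [h, zero_mul, zero_div] at h1
      exact hpos.ne' h1
    have hC : ‖residualSeries n μ a φ t‖ ≠ 0 := fun h => by
      rw [h, zero_pow two_ne_zero, mul_zero, zero_div] at h1
      exact hpos.ne' h1
    rw [h1]
    field_simp
  have hval : ∀ g ∈ momentClass M ρ, errorAt n μ a φ g = 1 / (2 * π) * ((‖c‖ ^ 2)⁻¹ *
      ∑ m ∈ Finset.range (M + 1), ∑ k ∈ Finset.range (M + 1),
        p m * p k * (2 * π * ρ ((m : ℤ) - k).natAbs)) := by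
    intro g hg
    rw [← integral_norm_sq_trigPolynomial_mul hg, ← intervalIntegral.integral_const_mul]
    unfold errorAt
    congr 1
    refine intervalIntegral.integral_congr_ae_restrict ?_
    rw [Set.uIoc_of_le (neg_le_self pi_pos.le)]
    filter_upwards [hae] with t ht
    rw [ht, mul_assoc]
  rw [hval f hf, hval _ hφ.2.2]

/-! ### Least favorable densities -/

theorem momentClass_congr {M : ℕ} {ρ : ℕ → ℝ} {f g : ℝ → ℝ} (hf : f ∈ momentClass M ρ)
    (hfg : g =ᵐ[volume.restrict (Set.Ioc (-π) π)] f) : g ∈ momentClass M ρ := by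
  obtain ⟨h1, h2, h3⟩ := hf
  have hfg' : g =ᵐ[volume.restrict (Set.uIoc (-π) π)] f := by
    rwa [Set.uIoc_of_le (neg_le_self pi_pos.le)]
  refine ⟨h1.congr_ae hfg'.symm, ?_, fun m hm => ?_⟩
  · filter_upwards [h2, hfg] with t ht1 ht2
    rwa [ht2]
  · rw [← h3 m hm]
    congr 1
    refine intervalIntegral.integral_congr_ae_restrict ?_
    filter_upwards [hfg'] with t ht
    rw [ht]

/-- A density is least favorable if its optimal error bounds the errors over the class. -/
theorem isLeastFavorable_of_le {n μ M : ℕ} {a φ : ℕ → ℂ} {ρ : ℕ → ℝ} {f₀ : ℝ → ℝ} (hμ : 1 ≤ μ)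
    (hb : Summable fun k => ‖bCoeff n μ a k‖) (hφ : φ ∈ admissible M ρ)
    (hf₀ : f₀ =ᵐ[volume.restrict (Set.Ioc (-π) π)] factorDensity φ) {φ₁ : ℕ → ℂ}
    (hφ₁ : IsCanonical φ₁)
    (hle : ∀ f ∈ momentClass M ρ,
      ENNReal.ofReal (errorAt n μ a φ₁ f) ≤ normSq (opDAW n μ a φ)) :
    IsLeastFavorable n μ a (momentClass M ρ) f₀ := by
  have hmem := momentClass_congr hφ.2.2 hf₀
  refine ⟨hmem, exists_hasSpectralDensity n f₀ hmem.1 hmem.2.1, ?_⟩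
  intro Ω₀ _ P₀ _ ξ₀ hξ₀ f hf Ω _ P _ ξ hξ
  refine (optimalError_le_errorAt hμ hb hφ₁ hf.1 hξ).trans ?_
  have h := (hle f hf).trans
    (normSq_opDAW_le_optimalError hμ hb hφ.2.1.summable_norm hmem.1 hf₀ hξ₀)
  exact (ENNReal.ofReal_le_ofReal_iff (sq_nonneg _)).1 h

theorem theorem6p1 (n μ M : ℕ) (hn : 1 ≤ n) (hμ : 1 ≤ μ) (a : ℕ → ℂ)
    (ha : ∀ k, Summable fun i => a (k + i) * dCoeff n μ i)
    (hb : Summable fun k => ‖bCoeff n μ a k‖)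
    (hb' : Summable fun k : ℕ => ((k : ℝ) + 1) * ‖bCoeff n μ a k‖ ^ 2)
    (ρ : ℕ → ℝ)
    (hρ : (Matrix.of fun i j : Fin (M + 1) => ρ ((i : ℤ) - (j : ℤ)).natAbs).PosDef) :
    (∀ φ₀ ∈ eigenSolutions n μ M a ρ,
        nuEigen n μ M a ρ = nuRational n μ M a ρ →
        nuRational n μ M a ρ = normSq (opDAW n μ a φ₀) →
        IsLeastFavorable n μ a (momentClass M ρ) (factorDensity φ₀)) ∧
    (nuEigen n μ M a ρ < nuRational n μ M a ρ →
        (rationalSolutions n μ M a ρ).Nonempty ∧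
        ∀ φ ∈ admissible M ρ, ∀ (c : ℂ) (p : ℕ → ℝ) (f₀ : ℝ → ℝ),
          IsRationalForm n μ M a φ c p f₀ →
          f₀ =ᵐ[volume.restrict (Set.Ioc (-π) π)] factorDensity φ →
          IsLeastFavorable n μ a (momentClass M ρ) f₀ ∧
          SolvesExtremumProblem n μ a (momentClass M ρ) φ) := by
  constructor
  · intro φ₀ hφ₀ _ hν
    -- With no candidate of the form (52) the supremum is 0, so φ₀ has zero residual and its own
    -- estimates have limiting error 0 under every density of the class.
    rcases Set.eq_empty_or_nonempty (rationalSolutions n μ M a ρ) with he | ⟨φ, hφ, c, p, hr⟩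
    · have h0 : normSq (opDAW n μ a φ₀) = 0 := by
        rw [← hν, nuRational, he]
        simp
      have hzero : ∀ j, opDAW n μ a φ₀ j = 0 := fun j => by
        simpa using ENNReal.tsum_eq_zero.1 h0 j
      refine isLeastFavorable_of_le hμ hb hφ₀.1 EventuallyEq.rfl hφ₀.1.2.1 fun f _ => ?_
      simp [errorAt, residualSeries, hzero]
    -- Any φ of the form (52) serves, whether or not it attains the supremum: its constant error is
    -- at most ν_M⁺P₀, the value at φ₀.
    · refine isLeastFavorable_of_le hμ hb hφ₀.1 EventuallyEq.rfl hφ.2.1 fun f hf => ?_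
      rw [errorAt_eq_of_rational hμ hb hφ hr EventuallyEq.rfl hf, ← hν]
      exact (errorAt_factorDensity_le hμ hb hφ.2.1).trans
        (le_iSup₂ (f := fun φ _ => normSq (opDAW n μ a φ)) φ ⟨hφ, c, p, hr⟩)
  · intro hlt
    refine ⟨?_, fun φ hφ c p f₀ hr hf₀ => ⟨?_, ?_⟩⟩
    · rw [Set.nonempty_iff_ne_empty]
      intro he
      rw [nuRational, he] at hlt
      simp at hlt
    · refine isLeastFavorable_of_le hμ hb hφ hf₀ hφ.2.1 fun f hf => ?_
      rw [errorAt_eq_of_rational hμ hb hφ hr hf₀ hf]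
      exact errorAt_factorDensity_le hμ hb hφ.2.1
    · refine ⟨?_, ⟨_, isMeanSquareSum_factor hφ.2.1.summable_norm, ?_⟩, ?_⟩
      · rw [hφ.1]
        exact ENNReal.ofReal_lt_top
      · simp only [← factorDensity_eq]
        exact hφ.2.2
      · intro ψ _ G hG hGD
        -- The bound on least squares errors is reused with |G|² as the density in D_M.
        refine (normSq_opDAW_le_errorAt hμ hb hφ.2.1 hG).trans ?_
        rw [errorAt_eq_of_rational hμ hb hφ hr hf₀ hGD]
        exact errorAt_factorDensity_le hμ hb hφ.2.1
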